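/- Let $F : Q \to \bar Q = Q/G$ be a smooth principal $G$-bundle ($G$ a Lie group acting smoothly on the manifold $Q$ on the left). Let $g$ be a $G$-invariant Riemannian metric on $Q$, $V \in C^\infty(Q)$ a $G$-invariant function and $i : D \hookrightarrow TQ$ a $G$-invariant distribution (a vector subbundle of $TQ$), so that $(L, D)$, $L(v) = \tfrac12 g(v,v) - V(\tau_{TQ}(v))$, is a $G$-invariant nonholonomic mechanical system on the Lie algebroid $TQ$. Let $TQ/G \to \bar Q$ be the Atiyah algebroid: its sections are the $G$-invariant vector fields on $Q$, its bracket is the Lie bracket of vector fields, and its anchor is induced by $TF$. The metric, the potential and the distribution induce a bundle metric $\bar g$ on $TQ/G$, a function $\bar V \in C^\infty(\bar Q)$ with $\bar V \circ F = V$, and a vector subbundle $\bar D = D/G \subseteq TQ/G$, hence a nonholonomic system $(\bar L, \bar D)$ on $TQ/G$. For a vector bundle $\tau : A^* \to B$, dual to $A$, a linear almost Poisson structure on $A^*$ is an $\mathbb R$-bilinear, skew-symmetric bracket on $C^\infty(A^*)$ which is a derivation in each argument and for which the bracket of two fibrewise linear functions is fibrewise linear. For a Lie algebroid $(A, [\![\cdot,\cdot]\!],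 \rho)$ let $\{\cdot,\cdot\}_{A^*}$ be the induced linear Poisson structure on $A^*$, that is, the unique linear almost Poisson structure with $$\{\hat X, \hat Y\} = -\widehat{[\![X,Y]\!]},\qquad \{f\circ\tau, \hat X\} = \rho(X)(f)\circ\tau,\qquad \{f\circ\tau, h\circ\tau\} = 0$$ for $X, Y \in \Gamma(A)$ and $f,h \in C^\infty(B)$, where $\hat X$ is the linear function on $A^*$ given by $X$. (For $A = TQ$ and $A = TQ/G$ it exists and is unique.) If $A$ carries a bundle metric and $i: D \hookrightarrow A$ is a vector subbundle with orthogonal projector $P : A \to D$, the nonholonomic bracket on $D^*$ is $\{\varphi,\psi\}_{D^*} = \{\varphi\circ i^*, \psi\circ i^*\}_{A^*}\circ P^*$; this is a linear almost Poisson structure on $D^*$. Let $\{\cdot,\cdot\}_{D^*}$ and $\{\cdot,\cdot\}_{\bar D^*}$ be the nonholonomic brackets of $(L, D)$ and $(\bar L, \bar D)$. Let $\tilde F_D : D^* \to \bar D^*$ be the vector bundle morphism over $F$ dual, on each fibre, to the inverse of the isomorphism $D_q \to \bar D_{F(q)}$. It is surjective and its fibres are exactly the orbits of $G$ in $D^*$,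 so it is the canonical projection $D^* \to D^*/G \cong \bar D^*$. Then $(\tilde F_D, F)$ is a linear almost Poisson morphism: $$\{\bar\varphi\circ\tilde F_D, \bar\psi\circ\tilde F_D\}_{D^*} = \{\bar\varphi,\bar\psi\}_{\bar D^*}\circ\tilde F_D \qquad\text{for all } \bar\varphi,\bar\psi\in C^\infty(\bar D^*).$$ This characterizes the reduced bracket: $\{\cdot,\cdot\}_{\bar D^*}$ is the only linear almost Poisson structure on $\bar D^*$ for which $(\tilde F_D, F)$ is a linear almost Poisson morphism from $(D^*, \{\cdot,\cdot\}_{D^*})$. -/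

import Mathlib

open Bundle Set Filter
open scoped Manifold ContDiff Topology

noncomputable section

set_option linter.unusedSectionVars false

namespace NH

section Fibers

theorem finiteDimensional_fiber {B : Type*} [TopologicalSpace B]
    (F : Type*) [NormedAddCommGroup F] [NormedSpace ℝ F] [FiniteDimensional ℝ F]
    (E : B → Type*) [∀ x, AddCommGroup (E x)] [∀ x, Module ℝ (E x)]
    [∀ x, TopologicalSpace (E x)] [TopologicalSpace (TotalSpace F E)] [FiberBundle F E]
    [VectorBundle ℝ F E] (x : B) : FiniteDimensional ℝ (E x) :=
  ((trivializationAt F E x).continuousLinearEquivAt ℝ x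
    (mem_baseSet_trivializationAt F E x)).symm.toLinearEquiv.finiteDimensional

theorem t2Space_fiber {B : Type*} [TopologicalSpace B]
    (F : Type*) [NormedAddCommGroup F] [NormedSpace ℝ F]
    (E : B → Type*) [∀ x, AddCommGroup (E x)] [∀ x, Module ℝ (E x)]
    [∀ x, TopologicalSpace (E x)] [TopologicalSpace (TotalSpace F E)] [FiberBundle F E]
    [VectorBundle ℝ F E] (x : B) : T2Space (E x) :=
  ((trivializationAt F E x).continuousLinearEquivAt ℝ x
    (mem_baseSet_trivializationAt F E x)).symm.toHomeomorph.t2Space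

end Fibers

section General

variable {EB : Type*} [NormedAddCommGroup EB] [NormedSpace ℝ EB]
  {B : Type*} [TopologicalSpace B] [ChartedSpace EB B]
  {EM : Type*} [NormedAddCommGroup EM] [NormedSpace ℝ EM] {HM : Type*} [TopologicalSpace HM]
  {IM : ModelWithCorners ℝ EM HM} {M : Type*} [TopologicalSpace M] [ChartedSpace HM M]
  {F₁ : Type*} [NormedAddCommGroup F₁] [NormedSpace ℝ F₁]
  {E₁ : B → Type*} [∀ x, AddCommGroup (E₁ x)] [∀ x, Module ℝ (E₁ x)]
  [∀ x, TopologicalSpace (E₁ x)]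
  [TopologicalSpace (TotalSpace F₁ E₁)] [FiberBundle F₁ E₁] [VectorBundle ℝ F₁ E₁]
  {F₂ : Type*} [NormedAddCommGroup F₂] [NormedSpace ℝ F₂]
  {E₂ : B → Type*} [∀ x, AddCommGroup (E₂ x)] [∀ x, Module ℝ (E₂ x)]
  [∀ x, TopologicalSpace (E₂ x)]
  [TopologicalSpace (TotalSpace F₂ E₂)] [FiberBundle F₂ E₂] [VectorBundle ℝ F₂ E₂]

theorem contMDiffAt_clm_of_apply [FiniteDimensional ℝ F₁] {f : M → F₁ →L[ℝ] F₂} {m₀ : M}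
    (h : ∀ v, ContMDiffAt IM 𝓘(ℝ, F₂) ∞ (fun m ↦ f m v) m₀) :
    ContMDiffAt IM 𝓘(ℝ, F₁ →L[ℝ] F₂) ∞ f m₀ := by
  let b := Module.finBasis ℝ F₁
  have key : f = fun m ↦ ∑ i, ContinuousLinearMap.smulRightL ℝ F₁ F₂
      (LinearMap.toContinuousLinearMap (b.coord i)) (f m (b i)) := by
    funext m
    ext v
    have h1 : f m v = ∑ i, b.repr v i • f m (b i) := by
      conv_lhs => rw [← b.sum_repr v, map_sum]
      simp only [map_smul]
    simp [h1]
  rw [key]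
  refine contMDiffAt_finsetSum fun i _ ↦ ?_
  exact (ContinuousLinearMap.contMDiff _).contMDiffAt.comp m₀ (h _)

variable [∀ x, IsTopologicalAddGroup (E₂ x)] [∀ x, ContinuousSMul ℝ (E₂ x)]

theorem contMDiffAt_symm_const [ContMDiffVectorBundle ∞ F₁ E₁ 𝓘(ℝ, EB)] {b : M → B} {m₀ : M}
    (hb : ContMDiffAt IM 𝓘(ℝ, EB) ∞ b m₀)
    (e : Trivialization F₁ (π F₁ E₁)) [MemTrivializationAtlas e] (he : b m₀ ∈ e.baseSet)
    (v : F₁) :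
    ContMDiffAt IM (𝓘(ℝ, EB).prod 𝓘(ℝ, F₁)) ∞
      (fun m ↦ (⟨b m, e.symm (b m) v⟩ : TotalSpace F₁ E₁)) m₀ := by
  rw [e.contMDiffAt_iff (by simpa [e.mem_source] using he)]
  refine ⟨hb, (contMDiffAt_const (c := v)).congr_of_eventuallyEq ?_⟩
  filter_upwards [hb.continuousAt (e.open_baseSet.mem_nhds he)] with m hm
  simp [e.apply_mk_symm hm]

/-- A map into a bundle of continuous linear maps is smooth as soon as its evaluations on
local frames are. -/
theorem contMDiffAt_hom_of_apply [FiniteDimensional ℝ F₁]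
    [ContMDiffVectorBundle ∞ F₂ E₂ 𝓘(ℝ, EB)]
    {b : M → B} {m₀ : M} {ϕ : ∀ m, E₁ (b m) →L[ℝ] E₂ (b m)}
    (hb : ContMDiffAt IM 𝓘(ℝ, EB) ∞ b m₀)
    (h : ∀ v : F₁, ContMDiffAt IM (𝓘(ℝ, EB).prod 𝓘(ℝ, F₂)) ∞
      (fun m ↦ (⟨b m, ϕ m ((trivializationAt F₁ E₁ (b m₀)).symm (b m) v)⟩ :
        TotalSpace F₂ E₂)) m₀) :
    ContMDiffAt IM (𝓘(ℝ, EB).prod 𝓘(ℝ, F₁ →L[ℝ] F₂)) ∞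
      (fun m ↦ (⟨b m, ϕ m⟩ : TotalSpace (F₁ →L[ℝ] F₂) (fun x ↦ E₁ x →L[ℝ] E₂ x))) m₀ := by
  rw [contMDiffAt_hom_bundle]
  refine ⟨hb, contMDiffAt_clm_of_apply fun v ↦ ?_⟩
  have := (contMDiffAt_totalSpace.1 (h v)).2
  refine this.congr_of_eventuallyEq ?_
  filter_upwards [hb.continuousAt ((trivializationAt F₁ E₁ (b m₀)).open_baseSet.mem_nhds
      (mem_baseSet_trivializationAt F₁ E₁ (b m₀))),
    hb.continuousAt ((trivializationAt F₂ E₂ (b m₀)).open_baseSet.mem_nhds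
      (mem_baseSet_trivializationAt F₂ E₂ (b m₀)))] with m hm hm'
  simp [ContinuousLinearMap.inCoordinates, Trivialization.coe_linearMapAt_of_mem _ hm',
    Trivialization.symmL_apply _ hm]

/-- An injective smooth bundle morphism detects smoothness. -/
theorem contMDiffAt_of_injective [FiniteDimensional ℝ F₁] [FiniteDimensional ℝ F₂]
    [ContMDiffVectorBundle ∞ F₁ E₁ 𝓘(ℝ, EB)] [ContMDiffVectorBundle ∞ F₂ E₂ 𝓘(ℝ, EB)]
    {i : ∀ x, E₁ x →L[ℝ] E₂ x} (hi : ∀ x, Function.Injective (i x))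
    (hs : ContMDiff (𝓘(ℝ, EB).prod 𝓘(ℝ, F₁)) (𝓘(ℝ, EB).prod 𝓘(ℝ, F₂)) ∞
      (fun v : TotalSpace F₁ E₁ ↦ (⟨v.1, i v.1 v.2⟩ : TotalSpace F₂ E₂)))
    {γ : M → TotalSpace F₁ E₁} {m₀ : M}
    (hγ : ContMDiffAt IM (𝓘(ℝ, EB).prod 𝓘(ℝ, F₂)) ∞
      (fun m ↦ (⟨(γ m).1, i (γ m).1 (γ m).2⟩ : TotalSpace F₂ E₂)) m₀) :
    ContMDiffAt IM (𝓘(ℝ, EB).prod 𝓘(ℝ, F₁)) ∞ γ m₀ := by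
  have hb : ContMDiffAt IM 𝓘(ℝ, EB) ∞ (fun m ↦ (γ m).1) m₀ := (contMDiffAt_totalSpace.1 hγ).1
  set e₁ := trivializationAt F₁ E₁ (γ m₀).1 with he₁
  set e₂ := trivializationAt F₂ E₂ (γ m₀).1 with he₂
  have m₁ : (γ m₀).1 ∈ e₁.baseSet := mem_baseSet_trivializationAt F₁ E₁ _
  have m₂ : (γ m₀).1 ∈ e₂.baseSet := mem_baseSet_trivializationAt F₂ E₂ _
  let A : M → F₁ →L[ℝ] F₂ := fun m ↦
    ContinuousLinearMap.inCoordinates F₁ E₁ F₂ E₂ (γ m₀).1 (γ m).1 (γ m₀).1 (γ m).1 (i (γ m).1)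
  have hA : ContMDiffAt IM 𝓘(ℝ, F₁ →L[ℝ] F₂) ∞ A m₀ := by
    have : ContMDiffAt IM (𝓘(ℝ, EB).prod 𝓘(ℝ, F₁ →L[ℝ] F₂)) ∞
      (fun m ↦ (⟨(γ m).1, i (γ m).1⟩ :
        TotalSpace (F₁ →L[ℝ] F₂) (fun x ↦ E₁ x →L[ℝ] E₂ x))) m₀ := by
      refine contMDiffAt_hom_of_apply hb fun v ↦ ?_
      exact hs.contMDiffAt.comp m₀ (contMDiffAt_symm_const hb e₁ m₁ v)
    exact ((contMDiffAt_hom_bundle _).1 this).2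
  have ev : ∀ᶠ m in 𝓝 m₀, (γ m).1 ∈ e₁.baseSet ∧ (γ m).1 ∈ e₂.baseSet :=
    Filter.Eventually.and (hb.continuousAt (e₁.open_baseSet.mem_nhds m₁))
      (hb.continuousAt (e₂.open_baseSet.mem_nhds m₂))
  have hinj : Function.Injective (A m₀) := by
    have : A m₀ = _ := ContinuousLinearMap.inCoordinates_eq m₁ m₂
    rw [this]
    simp only [ContinuousLinearMap.coe_comp, ContinuousLinearEquiv.coe_coe]
    exact (ContinuousLinearEquiv.injective _).comp
      ((hi _).comp (ContinuousLinearEquiv.injective _))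
  obtain ⟨L, hL⟩ := (A m₀ : F₁ →ₗ[ℝ] F₂).exists_leftInverse_of_injective
    (LinearMap.ker_eq_bot.2 hinj)
  let L' : F₂ →L[ℝ] F₁ := LinearMap.toContinuousLinearMap L
  let K : M → F₁ →L[ℝ] F₁ := fun m ↦ L'.comp (A m)
  have hK : ContMDiffAt IM 𝓘(ℝ, F₁ →L[ℝ] F₁) ∞ K m₀ := contMDiffAt_const.clm_comp hA
  have hK0 : K m₀ = ContinuousLinearMap.id ℝ F₁ := by
    ext v
    exact LinearMap.congr_fun hL v
  have hinvK : (K m₀).IsInvertible := by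
    rw [hK0]
    exact ContinuousLinearMap.isInvertible_equiv (f := ContinuousLinearEquiv.refl ℝ F₁)
  have hI : ContMDiffAt IM 𝓘(ℝ, F₁ →L[ℝ] F₁) ∞ (fun m ↦ (K m).inverse) m₀ :=
    (hinvK.contDiffAt_map_inverse (n := ∞)).contMDiffAt.comp m₀ hK
  have hevK : ∀ᶠ m in 𝓝 m₀, (K m).IsInvertible := by
    have hopen : IsOpen {f : F₁ →L[ℝ] F₁ | f.IsInvertible} := by
      have : {f : F₁ →L[ℝ] F₁ | f.IsInvertible}
          = range ((↑) : (F₁ ≃L[ℝ] F₁) → F₁ →L[ℝ] F₁) := by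
        ext f; rfl
      rw [this]
      exact ContinuousLinearEquiv.isOpen
    exact hK.continuousAt (hopen.mem_nhds hinvK)
  refine contMDiffAt_totalSpace.2 ⟨hb, ?_⟩
  have hw := (contMDiffAt_totalSpace.1 hγ).2
  have hc := hI.clm_apply ((contMDiffAt_const (c := L')).clm_apply hw)
  refine hc.congr_of_eventuallyEq ?_
  filter_upwards [ev, hevK] with m hm hKm
  obtain ⟨k, hk⟩ := hKm
  have h2 : (e₂ ⟨(γ m).1, i (γ m).1 (γ m).2⟩).2 = A m ((e₁ (γ m)).2) := by
    have : A m = _ := ContinuousLinearMap.inCoordinates_eq hm.1 hm.2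
    have h3 : (e₁ (γ m)).2 = e₁.continuousLinearEquivAt ℝ _ hm.1 (γ m).2 := rfl
    rw [this, h3]
    simp only [ContinuousLinearMap.coe_comp, ContinuousLinearEquiv.coe_coe, Function.comp_apply,
      ← he₁, ContinuousLinearEquiv.symm_apply_apply]
    rfl
  show (e₁ (γ m)).2 = (K m).inverse (L' (e₂ ⟨(γ m).1, i (γ m).1 (γ m).2⟩).2)
  rw [h2]
  show _ = (K m).inverse (K m _)
  rw [← hk]
  simp

theorem contMDiffAt_dual_apply {b : M → B} {m₀ : M} {α : ∀ m, E₁ (b m) →L[ℝ] ℝ}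
    {v : ∀ m, E₁ (b m)}
    (hα : ContMDiffAt IM (𝓘(ℝ, EB).prod 𝓘(ℝ, F₁ →L[ℝ] ℝ)) ∞
      (fun m ↦ (⟨b m, α m⟩ : TotalSpace (F₁ →L[ℝ] ℝ) (fun x ↦ E₁ x →L[ℝ] ℝ))) m₀)
    (hv : ContMDiffAt IM (𝓘(ℝ, EB).prod 𝓘(ℝ, F₁)) ∞
      (fun m ↦ (⟨b m, v m⟩ : TotalSpace F₁ E₁)) m₀) :
    ContMDiffAt IM 𝓘(ℝ, ℝ) ∞ (fun m ↦ α m (v m)) m₀ :=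
  (contMDiffAt_totalSpace.1 (ContMDiffAt.clm_bundle_apply (E₂ := Bundle.Trivial B ℝ) hα hv)).2

/-- A map into a dual bundle is smooth as soon as its evaluations on local frames are. -/
theorem contMDiffAt_dual_of_apply [FiniteDimensional ℝ F₁]
    {b : M → B} {m₀ : M} {α : ∀ m, E₁ (b m) →L[ℝ] ℝ}
    (hb : ContMDiffAt IM 𝓘(ℝ, EB) ∞ b m₀)
    (h : ∀ v : F₁, ContMDiffAt IM 𝓘(ℝ, ℝ) ∞
      (fun m ↦ α m ((trivializationAt F₁ E₁ (b m₀)).symm (b m) v)) m₀) :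
    ContMDiffAt IM (𝓘(ℝ, EB).prod 𝓘(ℝ, F₁ →L[ℝ] ℝ)) ∞
      (fun m ↦ (⟨b m, α m⟩ : TotalSpace (F₁ →L[ℝ] ℝ) (fun x ↦ E₁ x →L[ℝ] ℝ))) m₀ := by
  refine contMDiffAt_hom_of_apply (E₂ := Bundle.Trivial B ℝ) hb fun v ↦ ?_
  exact contMDiffAt_totalSpace.2 ⟨hb, h v⟩

end General

/-- The dual `α ↦ α ∘ L` of a continuous linear map. -/
def dualMap {V W : Type*} [AddCommGroup V] [Module ℝ V] [TopologicalSpace V]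
    [AddCommGroup W] [Module ℝ W] [TopologicalSpace W] (L : V →L[ℝ] W) :
    (W →L[ℝ] ℝ) →ₗ[ℝ] (V →L[ℝ] ℝ) where
  toFun α := α.comp L
  map_add' _ _ := rfl
  map_smul' _ _ := rfl

section Bundles

variable {EB : Type*} [NormedAddCommGroup EB] [NormedSpace ℝ EB]
  {B : Type*} [TopologicalSpace B] [ChartedSpace EB B]
  (F : Type*) [NormedAddCommGroup F] [NormedSpace ℝ F]
  (E : B → Type*) [∀ x, AddCommGroup (E x)] [∀ x, Module ℝ (E x)]
  [∀ x, TopologicalSpace (E x)]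
  [TopologicalSpace (TotalSpace F E)] [FiberBundle F E] [VectorBundle ℝ F E]

/-- The total space of the dual bundle `E*` of a vector bundle `E`. -/
abbrev DualTotal : Type _ := TotalSpace (F →L[ℝ] ℝ) (fun x ↦ E x →L[ℝ] ℝ)

/-- `C^∞(B)`. -/
abbrev Smooth (EB : Type*) [NormedAddCommGroup EB] [NormedSpace ℝ EB]
    (B : Type*) [TopologicalSpace B] [ChartedSpace EB B] : Type _ :=
  C^∞⟮𝓘(ℝ, EB), B; 𝓘(ℝ), ℝ⟯

/-- `C^∞(E*)`. -/
abbrev SmoothDual : Type _ :=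
  C^∞⟮𝓘(ℝ, EB).prod 𝓘(ℝ, F →L[ℝ] ℝ), DualTotal F E; 𝓘(ℝ), ℝ⟯

/-- The space `Γ(E)` of smooth sections. -/
abbrev Sections : Type _ := Cₛ^∞⟮𝓘(ℝ, EB); F, E⟯

variable {F E}

/-- A function on `E*` is linear if it is linear on each fibre. -/
def IsFiberLinear (φ : SmoothDual (EB := EB) F E) : Prop :=
  ∀ x, IsLinearMap ℝ (fun α : E x →L[ℝ] ℝ ↦ φ ⟨x, α⟩)

/-- The basic function `f ∘ τ` on `E*`. -/
def basicFun (f : Smooth EB B) : SmoothDual (EB := EB) F E :=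
  ⟨fun α ↦ f α.1, f.contMDiff.comp (contMDiff_proj _)⟩

/-- The linear function on `E*` given by a section `X` of `E`. -/
def linearFun [ContMDiffVectorBundle ∞ F E 𝓘(ℝ, EB)] (X : Sections (EB := EB) F E) :
    SmoothDual (EB := EB) F E :=
  ⟨fun α ↦ α.2 (X α.1), fun _ ↦ contMDiffAt_dual_apply (b := fun α : DualTotal F E ↦ α.1)
    (α := fun β ↦ β.2) contMDiffAt_id (X.contMDiff.comp (contMDiff_proj _)).contMDiffAt⟩

variable (F E)

/-- A linear almost Poisson structure on the dual bundle `E*`. -/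
structure LinearAlmostPoisson where
  bracket : SmoothDual (EB := EB) F E → SmoothDual (EB := EB) F E → SmoothDual (EB := EB) F E
  add_left : ∀ φ φ' ψ, bracket (φ + φ') ψ = bracket φ ψ + bracket φ' ψ
  smul_left : ∀ (c : ℝ) φ ψ, bracket (c • φ) ψ = c • bracket φ ψ
  skew : ∀ φ ψ, bracket φ ψ = -bracket ψ φ
  leibniz : ∀ φ φ' ψ, bracket (φ * φ') ψ = φ * bracket φ' ψ + φ' * bracket φ ψ
  linear : ∀ φ ψ, IsFiberLinear φ → IsFiberLinear ψ → IsFiberLinear (bracket φ ψ)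

end Bundles

section Algebroids

variable {EB : Type*} [NormedAddCommGroup EB] [NormedSpace ℝ EB]
  {B : Type*} [TopologicalSpace B] [ChartedSpace EB B]
  {F : Type*} [NormedAddCommGroup F] [NormedSpace ℝ F]
  {E : B → Type*} [∀ x, AddCommGroup (E x)] [∀ x, Module ℝ (E x)]
  [∀ x, TopologicalSpace (E x)]
  [TopologicalSpace (TotalSpace F E)] [FiberBundle F E] [VectorBundle ℝ F E]
  {EB' : Type*} [NormedAddCommGroup EB'] [NormedSpace ℝ EB']
  {B' : Type*} [TopologicalSpace B'] [ChartedSpace EB' B']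
  {F' : Type*} [NormedAddCommGroup F'] [NormedSpace ℝ F']
  {E' : B' → Type*} [∀ x, AddCommGroup (E' x)] [∀ x, Module ℝ (E' x)]
  [∀ x, TopologicalSpace (E' x)]
  [TopologicalSpace (TotalSpace F' E')] [FiberBundle F' E'] [VectorBundle ℝ F' E']

/-- The derivative `v(f)` of a function `f` along a tangent vector `v`. -/
def dirDeriv (f : B → ℝ) (x : B) (v : TangentSpace 𝓘(ℝ, EB) x) : ℝ :=
  mfderiv 𝓘(ℝ, EB) 𝓘(ℝ) f x v

/-- The section `f X`, for a function `f` and a section `X`. -/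
def smulSection [ContMDiffVectorBundle ∞ F E 𝓘(ℝ, EB)] (f : Smooth EB B)
    (X : Sections (EB := EB) F E) : Sections (EB := EB) F E :=
  ⟨fun x ↦ f x • X x, f.contMDiff.smul_section X.contMDiff⟩

variable (F E) in
/-- A skew-symmetric algebroid structure on a vector bundle `E`. -/
structure SkewAlgebroid [IsManifold 𝓘(ℝ, EB) ∞ B] [ContMDiffVectorBundle ∞ F E 𝓘(ℝ, EB)] where
  bracket : Sections (EB := EB) F E → Sections (EB := EB) F E → Sections (EB := EB) F E
  anchor : ∀ x, E x →L[ℝ] TangentSpace 𝓘(ℝ, EB) x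
  anchor_smooth : ContMDiff (𝓘(ℝ, EB).prod 𝓘(ℝ, F)) 𝓘(ℝ, EB).tangent ∞
    (fun v : TotalSpace F E ↦ (⟨v.1, anchor v.1 v.2⟩ : TangentBundle 𝓘(ℝ, EB) B))
  add_left : ∀ X X' Y, bracket (X + X') Y = bracket X Y + bracket X' Y
  smul_left : ∀ (c : ℝ) X Y, bracket (c • X) Y = c • bracket X Y
  skew : ∀ X Y, bracket X Y = -bracket Y X
  leibniz : ∀ (X Y : Sections (EB := EB) F E) (f : Smooth EB B) (x : B),
    bracket X (smulSection f Y) x = f x • bracket X Y x + dirDeriv f x (anchor x (X x)) • Y x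

variable (F E) in
/-- A Lie algebroid structure on a vector bundle `E`. -/
structure LieAlgebroid [IsManifold 𝓘(ℝ, EB) ∞ B] [ContMDiffVectorBundle ∞ F E 𝓘(ℝ, EB)] extends
    SkewAlgebroid (EB := EB) F E where
  jacobi : ∀ X Y Z, bracket X (bracket Y Z) = bracket (bracket X Y) Z + bracket Y (bracket X Z)

/-- `P` is the linear almost Poisson structure on `E*` induced by the algebroid structure `S`. -/
structure LinearAlmostPoisson.IsInducedBy [IsManifold 𝓘(ℝ, EB) ∞ B]
    [ContMDiffVectorBundle ∞ F E 𝓘(ℝ, EB)] (P : LinearAlmostPoisson (EB := EB) F E)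
    (S : SkewAlgebroid (EB := EB) F E) : Prop where
  linear_linear : ∀ X Y, P.bracket (linearFun X) (linearFun Y) = -linearFun (S.bracket X Y)
  basic_linear : ∀ (f : Smooth EB B) (X : Sections (EB := EB) F E) (α : DualTotal F E),
    P.bracket (basicFun f) (linearFun X) α = dirDeriv f α.1 (S.anchor α.1 (X α.1))
  basic_basic : ∀ f g, P.bracket (basicFun f) (basicFun g) = 0

variable (EB F E EB' F' E') in
/-- A smooth vector bundle morphism between the dual bundles `E*` and `E'*`, over `f`. -/
structure DualMorphism (f : B → B') where
  toFun : ∀ x, (E x →L[ℝ] ℝ) →ₗ[ℝ] (E' (f x) →L[ℝ] ℝ)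
  smooth : ContMDiff (𝓘(ℝ, EB).prod 𝓘(ℝ, F →L[ℝ] ℝ)) (𝓘(ℝ, EB').prod 𝓘(ℝ, F' →L[ℝ] ℝ)) ∞
    (fun α : DualTotal F E ↦ (⟨f α.1, toFun α.1 α.2⟩ : DualTotal F' E'))

/-- The map of total spaces underlying a vector bundle morphism. -/
def DualMorphism.total {f : B → B'} (Φ : DualMorphism EB F E EB' F' E' f)
    (α : DualTotal F E) : DualTotal F' E' := ⟨f α.1, Φ.toFun α.1 α.2⟩

/-- The pull-back `φ ∘ Φ` of a smooth function. -/
def DualMorphism.pullback {f : B → B'} (Φ : DualMorphism EB F E EB' F' E' f)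
    (φ : SmoothDual (EB := EB') F' E') : SmoothDual (EB := EB) F E :=
  ⟨fun α ↦ φ (Φ.total α), φ.contMDiff.comp Φ.smooth⟩

/-- A vector bundle morphism between dual bundles is a linear almost Poisson morphism if
it preserves the brackets. -/
def IsLinearAlmostPoissonMorphism {f : B → B'} (Φ : DualMorphism EB F E EB' F' E' f)
    (P : LinearAlmostPoisson (EB := EB) F E) (P' : LinearAlmostPoisson (EB := EB') F' E') : Prop :=
  ∀ φ ψ : SmoothDual (EB := EB') F' E',
    P.bracket (Φ.pullback φ) (Φ.pullback ψ) = Φ.pullback (P'.bracket φ ψ)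

end Algebroids

section Nonholonomic

variable {EB : Type*} [NormedAddCommGroup EB] [NormedSpace ℝ EB]
  {B : Type*} [TopologicalSpace B] [ChartedSpace EB B]
  {F : Type*} [NormedAddCommGroup F] [NormedSpace ℝ F]
  {E : B → Type*} [∀ x, AddCommGroup (E x)] [∀ x, Module ℝ (E x)]
  [∀ x, TopologicalSpace (E x)]
  [TopologicalSpace (TotalSpace F E)] [FiberBundle F E] [VectorBundle ℝ F E]
  [∀ x, IsTopologicalAddGroup (E x)] [∀ x, ContinuousSMul ℝ (E x)]
  {FD : Type*} [NormedAddCommGroup FD] [NormedSpace ℝ FD]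
  {D : B → Type*} [∀ x, AddCommGroup (D x)] [∀ x, Module ℝ (D x)]
  [∀ x, TopologicalSpace (D x)]
  [TopologicalSpace (TotalSpace FD D)] [FiberBundle FD D] [VectorBundle ℝ FD D]
  [∀ x, IsTopologicalAddGroup (D x)] [∀ x, ContinuousSMul ℝ (D x)]

variable (EB F E FD D) in
/-- A mechanical system with linear nonholonomic constraints on (the Lie algebroid) `E`: a bundle
metric and a potential, which define the Lagrangian, and a vector subbundle `D` of `E`, given as a
vector bundle together with its inclusion, an injective smooth vector bundle morphism. -/
structure NonholonomicSystem where
  metric : ContMDiffRiemannianMetric 𝓘(ℝ, EB) ∞ F E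
  potential : Smooth EB B
  incl : ∀ x, D x →L[ℝ] E x
  incl_injective : ∀ x, Function.Injective (incl x)
  incl_smooth : ContMDiff (𝓘(ℝ, EB).prod 𝓘(ℝ, FD)) (𝓘(ℝ, EB).prod 𝓘(ℝ, F)) ∞
    (fun v : TotalSpace FD D ↦ (⟨v.1, incl v.1 v.2⟩ : TotalSpace F E))

namespace NonholonomicSystem

variable (S : NonholonomicSystem EB F E FD D)

/-- The Lagrangian `L(v) = 𝒢(v, v) / 2 - V(τ(v))`. -/
def lagrangian (v : TotalSpace F E) : ℝ :=
  S.metric.inner v.1 v.2 v.2 / 2 - S.potential v.1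

/-- The restriction of the bundle metric to `D`, as a map `D → D*`. -/
def flatD (x : B) : D x →L[ℝ] (D x →L[ℝ] ℝ) :=
  (ContinuousLinearMap.precomp ℝ (S.incl x)).comp ((S.metric.inner x).comp (S.incl x))

theorem flatD_apply (x : B) (d d' : D x) :
    S.flatD x d d' = S.metric.inner x (S.incl x d) (S.incl x d') := rfl

theorem flatD_injective (x : B) : Function.Injective (S.flatD x) := by
  refine (injective_iff_map_eq_zero _).2 fun d hd ↦ ?_
  by_contra hne
  have h1 : S.incl x d ≠ 0 := fun h ↦ hne (S.incl_injective x (by simpa using h))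
  have h2 := S.metric.pos x _ h1
  rw [← flatD_apply, hd] at h2
  simp at h2

variable [FiniteDimensional ℝ F] [FiniteDimensional ℝ FD]

theorem flatD_bijective (x : B) : Function.Bijective (S.flatD x) := by
  have := finiteDimensional_fiber FD D x
  have := t2Space_fiber FD D x
  have e : (D x →ₗ[ℝ] ℝ) ≃ₗ[ℝ] (D x →L[ℝ] ℝ) := LinearMap.toContinuousLinearMap
  have hr : Module.finrank ℝ (D x) = Module.finrank ℝ (D x →L[ℝ] ℝ) := by
    rw [← e.finrank_eq]
    exact (Subspace.dual_finrank_eq (K := ℝ) (V := D x)).symm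
  have : FiniteDimensional ℝ (D x →L[ℝ] ℝ) := e.finiteDimensional
  exact ⟨S.flatD_injective x,
    (LinearMap.injective_iff_surjective_of_finrank_eq_finrank
      (f := (S.flatD x : D x →ₗ[ℝ] (D x →L[ℝ] ℝ))) hr).1 (S.flatD_injective x)⟩

/-- The inverse `D* → D` of the musical isomorphism of `D`. -/
def sharpD (x : B) : (D x →L[ℝ] ℝ) ≃ₗ[ℝ] D x :=
  (LinearEquiv.ofBijective (S.flatD x : D x →ₗ[ℝ] (D x →L[ℝ] ℝ)) (S.flatD_bijective x)).symm

theorem flatD_sharpD (x : B) (β : D x →L[ℝ] ℝ) : S.flatD x (S.sharpD x β) = β :=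
  (LinearEquiv.ofBijective (S.flatD x : D x →ₗ[ℝ] (D x →L[ℝ] ℝ))
    (S.flatD_bijective x)).apply_symm_apply β

/-- The orthogonal projector `P : E → D`. -/
def orthProj (x : B) : E x →L[ℝ] D x :=
  haveI := finiteDimensional_fiber F E x
  haveI := t2Space_fiber F E x
  LinearMap.toContinuousLinearMap ((S.sharpD x : (D x →L[ℝ] ℝ) →ₗ[ℝ] D x).comp
    ((ContinuousLinearMap.precomp ℝ (S.incl x)).comp (S.metric.inner x) :
      E x →ₗ[ℝ] (D x →L[ℝ] ℝ)))

/-- `P v` is characterized by `v - P v` being orthogonal to `D`. -/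
theorem orthProj_spec (x : B) (v : E x) (d : D x) :
    S.metric.inner x (v - S.incl x (S.orthProj x v)) (S.incl x d) = 0 := by
  have h : S.flatD x (S.orthProj x v) d = S.metric.inner x v (S.incl x d) :=
    congrArg (fun β : D x →L[ℝ] ℝ ↦ β d) (S.flatD_sharpD x _)
  rw [flatD_apply] at h
  simp [h]

theorem orthProj_incl (x : B) (d : D x) : S.orthProj x (S.incl x d) = d := by
  refine S.flatD_injective x (ContinuousLinearMap.ext fun d' ↦ ?_)
  have h := S.orthProj_spec x (S.incl x d) d'
  rw [map_sub, _root_.sub_apply, sub_eq_zero] at h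
  exact h.symm

variable [ContMDiffVectorBundle ∞ F E 𝓘(ℝ, EB)] [ContMDiffVectorBundle ∞ FD D 𝓘(ℝ, EB)]

/-- The dual `i* : E* → D*` of the inclusion. -/
def inclDual : DualMorphism EB F E EB FD D id where
  toFun x := dualMap (S.incl x)
  smooth α₀ := by
    have hb : ContMDiffAt (𝓘(ℝ, EB).prod 𝓘(ℝ, F →L[ℝ] ℝ)) 𝓘(ℝ, EB) ∞
      (fun α : DualTotal F E ↦ α.1) α₀ := (contMDiff_proj _).contMDiffAt
    refine contMDiffAt_dual_of_apply (b := fun α : DualTotal F E ↦ α.1) hb fun v ↦ ?_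
    exact contMDiffAt_dual_apply (b := fun α : DualTotal F E ↦ α.1) (α := fun β ↦ β.2)
      contMDiffAt_id (S.incl_smooth.contMDiffAt.comp α₀
        (contMDiffAt_symm_const hb _ (mem_baseSet_trivializationAt FD D α₀.1) v))

theorem sharpD_smooth : ContMDiff (𝓘(ℝ, EB).prod 𝓘(ℝ, FD →L[ℝ] ℝ)) (𝓘(ℝ, EB).prod 𝓘(ℝ, FD)) ∞
    (fun β : DualTotal FD D ↦ (⟨β.1, S.sharpD β.1 β.2⟩ : TotalSpace FD D)) := by
  intro β₀
  refine contMDiffAt_of_injective (F₂ := FD →L[ℝ] ℝ) (E₂ := fun x ↦ D x →L[ℝ] ℝ) (i := S.flatD) S.flatD_injective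
    ?_ ?_
  · intro d₀
    have hb : ContMDiffAt (𝓘(ℝ, EB).prod 𝓘(ℝ, FD)) 𝓘(ℝ, EB) ∞
      (fun d : TotalSpace FD D ↦ d.1) d₀ := (contMDiff_proj _).contMDiffAt
    refine contMDiffAt_dual_of_apply hb fun v ↦ ?_
    refine contMDiffAt_dual_apply (E₁ := E) (v := fun d ↦ S.incl d.1 _) (b := fun d : TotalSpace FD D ↦ d.1)
      (ContMDiffAt.clm_bundle_apply (E₁ := E) (E₂ := fun x ↦ E x →L[ℝ] ℝ)
        (ϕ := fun d : TotalSpace FD D ↦ S.metric.inner d.1)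
        (S.metric.contMDiff.contMDiffAt.comp d₀ hb) (S.incl_smooth d₀))
      (S.incl_smooth.contMDiffAt.comp d₀
        (contMDiffAt_symm_const hb _ (mem_baseSet_trivializationAt FD D d₀.1) v))
  · simp only [flatD_sharpD]
    exact contMDiffAt_id

theorem comp_orthProj (x : B) (β : D x →L[ℝ] ℝ) :
    β.comp (S.orthProj x) = S.metric.inner x (S.incl x (S.sharpD x β)) := by
  ext v
  have h := S.orthProj_spec x v (S.sharpD x β)
  rw [map_sub, _root_.sub_apply, sub_eq_zero] at h
  rw [S.metric.symm, h, S.metric.symm, ← flatD_apply, flatD_sharpD]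
  rfl

/-- The dual `P* : D* → E*` of the orthogonal projector. -/
def projDual : DualMorphism EB FD D EB F E id where
  toFun x := dualMap (S.orthProj x)
  smooth β₀ := by
    have hb : ContMDiffAt (𝓘(ℝ, EB).prod 𝓘(ℝ, FD →L[ℝ] ℝ)) 𝓘(ℝ, EB) ∞
      (fun β : DualTotal FD D ↦ β.1) β₀ := (contMDiff_proj _).contMDiffAt
    have h : (fun β : DualTotal FD D ↦ (⟨β.1, β.2.comp (S.orthProj β.1)⟩ : DualTotal F E)) =
        fun β ↦ ⟨β.1, S.metric.inner β.1 (S.incl β.1 (S.sharpD β.1 β.2))⟩ := by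
      funext β
      rw [comp_orthProj]
    refine ContMDiffAt.congr_of_eventuallyEq ?_ (Filter.Eventually.of_forall (congrFun h))
    exact ContMDiffAt.clm_bundle_apply (E₁ := E) (E₂ := fun x ↦ E x →L[ℝ] ℝ)
        (ϕ := fun d : DualTotal FD D ↦ S.metric.inner d.1)
        (S.metric.contMDiff.contMDiffAt.comp β₀ hb)
        (S.incl_smooth.contMDiffAt.comp β₀ (S.sharpD_smooth β₀))

/-- The nonholonomic bracket `{φ, ψ}_{D*} = {φ ∘ i*, ψ ∘ i*}_{E*} ∘ P*` on `D*`, where `P` is the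
linear Poisson structure on `E*`. -/
def nonholonomicBracket (P : LinearAlmostPoisson (EB := EB) F E) :
    LinearAlmostPoisson (EB := EB) FD D where
  bracket φ ψ := S.projDual.pullback (P.bracket (S.inclDual.pullback φ) (S.inclDual.pullback ψ))
  add_left φ φ' ψ := by
    ext β
    exact congrFun (congrArg DFunLike.coe
      (P.add_left (S.inclDual.pullback φ) (S.inclDual.pullback φ') (S.inclDual.pullback ψ))) _
  smul_left c φ ψ := by
    ext β
    exact congrFun (congrArg DFunLike.coe
      (P.smul_left c (S.inclDual.pullback φ) (S.inclDual.pullback ψ))) _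
  skew φ ψ := by
    ext β
    exact congrFun (congrArg DFunLike.coe
      (P.skew (S.inclDual.pullback φ) (S.inclDual.pullback ψ))) _
  leibniz φ φ' ψ := by
    ext β
    have h := congrFun (congrArg DFunLike.coe
      (P.leibniz (S.inclDual.pullback φ) (S.inclDual.pullback φ') (S.inclDual.pullback ψ)))
      (S.projDual.total β)
    have hid : S.inclDual.total (S.projDual.total β) = β := by
      obtain ⟨x, β⟩ := β
      refine congrArg (TotalSpace.mk x) (ContinuousLinearMap.ext fun d ↦ ?_)
      exact congrArg β (S.orthProj_incl x d)
    change (P.bracket (S.inclDual.pullback φ * S.inclDual.pullback φ') (S.inclDual.pullback ψ))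
      (S.projDual.total β) = φ β * _ + φ' β * _
    have hφ : S.inclDual.pullback φ (S.projDual.total β) = φ β := congrArg φ hid
    have hφ' : S.inclDual.pullback φ' (S.projDual.total β) = φ' β := congrArg φ' hid
    rw [← hφ, ← hφ']
    exact h
  linear φ ψ hφ hψ x := by
    have h1 : ∀ φ, IsFiberLinear φ → IsFiberLinear (S.inclDual.pullback φ) := fun φ hφ x ↦
      ⟨fun α α' ↦ by
        have := (hφ x).map_add (dualMap (S.incl x) α) (dualMap (S.incl x) α')
        rw [← map_add] at this
        exact this,
      fun c α ↦ by
        have := (hφ x).map_smul c (dualMap (S.incl x) α)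
        rw [← map_smul] at this
        exact this⟩
    have h2 := P.linear _ _ (h1 φ hφ) (h1 ψ hψ) x
    exact ⟨fun β β' ↦ by
        have := h2.map_add (dualMap (S.orthProj x) β) (dualMap (S.orthProj x) β')
        rw [← map_add] at this
        exact this,
      fun c β ↦ by
        have := h2.map_smul c (dualMap (S.orthProj x) β)
        rw [← map_smul] at this
        exact this⟩

end NonholonomicSystem

end Nonholonomic

section Principal

variable {EG : Type*} [NormedAddCommGroup EG] [NormedSpace ℝ EG]
  {G : Type*} [Group G] [TopologicalSpace G] [ChartedSpace EG G]
  {EQ : Type*} [NormedAddCommGroup EQ] [NormedSpace ℝ EQ]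
  {Q : Type*} [TopologicalSpace Q] [ChartedSpace EQ Q] [MulAction G Q]
  {EN : Type*} [NormedAddCommGroup EN] [NormedSpace ℝ EN]
  {N : Type*} [TopologicalSpace N] [ChartedSpace EN N]

variable (EG G EQ Q EN N) in
/-- A smooth principal `G`-bundle `Q → N`: the smooth action of `G` on `Q` (an instance argument
elsewhere) preserves the fibres, and there are smooth `G`-equivariant local trivializations. -/
structure PrincipalBundle where
  proj : Q → N
  proj_smooth : ContMDiff 𝓘(ℝ, EQ) 𝓘(ℝ, EN) ∞ proj
  proj_smul : ∀ (g : G) (q : Q), proj (g • q) = proj q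
  locally_trivial : ∀ b : N, ∃ e : Trivialization G proj, b ∈ e.baseSet ∧
    ContMDiffOn 𝓘(ℝ, EQ) (𝓘(ℝ, EN).prod 𝓘(ℝ, EG)) ∞ e e.source ∧
    ContMDiffOn (𝓘(ℝ, EN).prod 𝓘(ℝ, EG)) 𝓘(ℝ, EQ) ∞ e.toOpenPartialHomeomorph.symm e.target ∧
    ∀ (g : G), ∀ q ∈ e.source, (e (g • q)).2 = g * (e q).2

namespace PrincipalBundle

variable (P : PrincipalBundle EG G EQ Q EN N)

theorem exists_smul {q q' : Q} (h : P.proj q = P.proj q') : ∃ g : G, g • q = q' := by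
  obtain ⟨e, hb, -, -, he⟩ := P.locally_trivial (P.proj q)
  have hq : q ∈ e.source := e.mem_source.2 hb
  have hq' : q' ∈ e.source := e.mem_source.2 (h ▸ hb)
  refine ⟨(e q').2 * ((e q).2)⁻¹, ?_⟩
  have hm : ((e q').2 * ((e q).2)⁻¹) • q ∈ e.source :=
    e.mem_source.2 (by rw [P.proj_smul]; exact hb)
  refine e.injOn hm hq' (Prod.ext ?_ ?_)
  · change (e _).1 = (e _).1
    rw [e.coe_fst hm, e.coe_fst hq', P.proj_smul, h]
  · change (e _).2 = (e _).2
    rw [he _ _ hq]; group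

theorem smul_cancel (P : PrincipalBundle EG G EQ Q EN N) {g g' : G} {q : Q} (h : g • q = g' • q) : g = g' := by
  obtain ⟨e, hb, -, -, he⟩ := P.locally_trivial (P.proj q)
  have hq : q ∈ e.source := e.mem_source.2 hb
  have h1 := he g q hq
  rw [h, he g' q hq] at h1
  exact (mul_right_cancel h1).symm

theorem surjective : Function.Surjective P.proj := by
  intro b
  obtain ⟨e, hb, -⟩ := P.locally_trivial b
  have ht : (b, (1 : G)) ∈ e.target := e.mem_target.2 hb
  exact ⟨e.toOpenPartialHomeomorph.symm (b, 1), e.proj_symm_apply ht⟩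

/-- The fibre of `Q → N` over `b`. -/
abbrev Fib (b : N) : Type _ := {q : Q // P.proj q = b}

variable {P} in
/-- The action of `G` on a fibre. -/
abbrev Fib.act {b : N} (g : G) (q : P.Fib b) : P.Fib b := ⟨g • q.1, by rw [P.proj_smul, q.2]⟩

/-- The element of `G` moving `q` to `q'`, for `q` and `q'` in the same fibre. -/
def div (q q' : Q) (h : P.proj q = P.proj q') : G := Classical.choose (P.exists_smul h)

theorem div_smul {q q' : Q} (h : P.proj q = P.proj q') : P.div q q' h • q = q' :=
  Classical.choose_spec (P.exists_smul h)

variable {EM : Type*} [NormedAddCommGroup EM] [NormedSpace ℝ EM] {HM : Type*} [TopologicalSpace HM]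
  {IM : ModelWithCorners ℝ EM HM} {M : Type*} [TopologicalSpace M] [ChartedSpace HM M]

theorem contMDiffAt_div [LieGroup 𝓘(ℝ, EG) ∞ G] {u w : M → Q} {m₀ : M} (h : ∀ m, P.proj (u m) = P.proj (w m))
    (hu : ContMDiffAt IM 𝓘(ℝ, EQ) ∞ u m₀) (hw : ContMDiffAt IM 𝓘(ℝ, EQ) ∞ w m₀) :
    ContMDiffAt IM 𝓘(ℝ, EG) ∞ (fun m ↦ P.div (u m) (w m) (h m)) m₀ := by
  obtain ⟨e, hb, hs, -, he⟩ := P.locally_trivial (P.proj (u m₀))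
  have hq : u m₀ ∈ e.source := e.mem_source.2 hb
  have hq' : w m₀ ∈ e.source := e.mem_source.2 (h m₀ ▸ hb)
  have h1 : ContMDiffAt IM 𝓘(ℝ, EG) ∞ (fun m ↦ (e (u m)).2) m₀ :=
    contMDiffAt_snd.comp m₀ ((hs.contMDiffAt (e.open_source.mem_nhds hq)).comp m₀ hu)
  have h2 : ContMDiffAt IM 𝓘(ℝ, EG) ∞ (fun m ↦ (e (w m)).2) m₀ :=
    contMDiffAt_snd.comp m₀ ((hs.contMDiffAt (e.open_source.mem_nhds hq')).comp m₀ hw)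
  refine (h2.mul h1.inv).congr_of_eventuallyEq ?_
  filter_upwards [hu.continuousAt (e.open_source.mem_nhds hq)] with m hm
  have := he (P.div (u m) (w m) (h m)) (u m) hm
  rw [P.div_smul] at this
  simp [this]

/-- A section of `Q → N` which is smooth on an open set `baseSet`. -/
structure LocalSection where
  sec : N → Q
  proj_sec : ∀ b, P.proj (sec b) = b
  baseSet : Set N
  isOpen_baseSet : IsOpen baseSet
  smooth : ContMDiffOn 𝓘(ℝ, EN) 𝓘(ℝ, EQ) ∞ sec baseSet

theorem exists_localSection (b : N) : ∃ σ : P.LocalSection, b ∈ σ.baseSet := by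
  classical
  obtain ⟨e, hb, -, hs, -⟩ := P.locally_trivial b
  choose r hr using P.surjective
  refine ⟨⟨fun c ↦ if c ∈ e.baseSet then e.toOpenPartialHomeomorph.symm (c, 1) else r c,
    fun c ↦ ?_, e.baseSet, e.open_baseSet, ?_⟩, hb⟩
  · split_ifs with hc
    · exact e.proj_symm_apply (e.mem_target.2 hc)
    · exact hr c
  · have h2 : ContMDiffOn 𝓘(ℝ, EN) 𝓘(ℝ, EQ) ∞
        (fun c ↦ e.toOpenPartialHomeomorph.symm (c, 1)) e.baseSet :=
      hs.comp (contMDiffOn_id.prodMk contMDiffOn_const) fun c hc ↦ e.mem_target.2 hc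
    exact h2.congr fun c hc ↦ by simp [hc]

/-- A section which is smooth near `b`. -/
def sectionAt (b : N) : P.LocalSection := Classical.choose (P.exists_localSection b)

theorem mem_sectionAt (b : N) : b ∈ (P.sectionAt b).baseSet :=
  Classical.choose_spec (P.exists_localSection b)

end PrincipalBundle

end Principal

theorem totalSpace_mk_inj {B F : Type*} {E : B → Type*} {x : B} {v w : E x}
    (h : (⟨x, v⟩ : TotalSpace F E) = ⟨x, w⟩) : v = w := by
  simpa using h

section Lift

variable {EG : Type*} [NormedAddCommGroup EG] [NormedSpace ℝ EG]
  {G : Type*} [Group G] [TopologicalSpace G] [ChartedSpace EG G]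
  {EQ : Type*} [NormedAddCommGroup EQ] [NormedSpace ℝ EQ]
  {Q : Type*} [TopologicalSpace Q] [ChartedSpace EQ Q] [MulAction G Q]
  {F : Type*} [NormedAddCommGroup F] [NormedSpace ℝ F]
  {E : Q → Type*} [∀ x, AddCommGroup (E x)] [∀ x, Module ℝ (E x)]
  [∀ x, TopologicalSpace (E x)]
  [TopologicalSpace (TotalSpace F E)] [FiberBundle F E] [VectorBundle ℝ F E]

variable (EG G EQ F E) in
/-- A smooth action of `G` on the vector bundle `E → Q` by vector bundle automorphisms which
cover the action of `G` on `Q`. -/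
structure BundleAction where
  act : ∀ (g : G) (q : Q), E q →L[ℝ] E (g • q)
  act_one : ∀ q (v : E q), (⟨(1 : G) • q, act 1 q v⟩ : TotalSpace F E) = ⟨q, v⟩
  act_mul : ∀ (g h : G) q (v : E q), (⟨(g * h) • q, act (g * h) q v⟩ : TotalSpace F E) =
    ⟨g • h • q, act g (h • q) (act h q v)⟩
  smooth : ContMDiff (𝓘(ℝ, EG).prod (𝓘(ℝ, EQ).prod 𝓘(ℝ, F))) (𝓘(ℝ, EQ).prod 𝓘(ℝ, F)) ∞
    (fun p : G × TotalSpace F E ↦ (⟨p.1 • p.2.1, act p.1 p.2.1 p.2.2⟩ : TotalSpace F E))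

namespace BundleAction

variable (a : BundleAction EG G EQ F E)

/-- The action of `g` as a map `E q → E q'`, when `q' = g • q`. -/
def actTo (g : G) {q q' : Q} (h : g • q = q') : E q →L[ℝ] E q' := h ▸ a.act g q

theorem actTo_rfl (g : G) (q : Q) : a.actTo g (rfl : g • q = g • q) = a.act g q := rfl

theorem mk_actTo (g : G) {q q' : Q} (h : g • q = q') (v : E q) :
    (⟨q', a.actTo g h v⟩ : TotalSpace F E) = ⟨g • q, a.act g q v⟩ := by
  subst h; rfl

theorem actTo_actTo {g g' k : G} {q q' q'' : Q} (h : g • q = q') (h' : g' • q' = q'')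
    (hk : k • q = q'') (hg : g' * g = k) (v : E q) :
    a.actTo g' h' (a.actTo g h v) = a.actTo k hk v := by
  subst hg
  apply totalSpace_mk_inj (F := F)
  rw [mk_actTo, mk_actTo]
  subst h
  exact (a.act_mul _ _ _ _).symm

theorem actTo_one {q : Q} (h : (1 : G) • q = q) (v : E q) : a.actTo 1 h v = v := by
  apply totalSpace_mk_inj (F := F)
  rw [mk_actTo, act_one]

end BundleAction

end Lift

section Quotient

variable {EG : Type*} [NormedAddCommGroup EG] [NormedSpace ℝ EG]
  {G : Type*} [Group G] [TopologicalSpace G] [ChartedSpace EG G]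
  {EQ : Type*} [NormedAddCommGroup EQ] [NormedSpace ℝ EQ]
  {Q : Type*} [TopologicalSpace Q] [ChartedSpace EQ Q] [MulAction G Q]
  {EN : Type*} [NormedAddCommGroup EN] [NormedSpace ℝ EN]
  {N : Type*} [TopologicalSpace N] [ChartedSpace EN N]
  {F : Type*} [NormedAddCommGroup F] [NormedSpace ℝ F]
  {E : Q → Type*} [∀ x, AddCommGroup (E x)] [∀ x, Module ℝ (E x)]
  [∀ x, TopologicalSpace (E x)]
  [TopologicalSpace (TotalSpace F E)] [FiberBundle F E] [VectorBundle ℝ F E]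
  (P : PrincipalBundle EG G EQ Q EN N) (a : BundleAction EG G EQ F E)

/-- The `G`-equivariant sections of `E` along the fibre over `b`. -/
def equivariantSections (b : N) : Submodule ℝ (∀ q : P.Fib b, E q.1) where
  carrier := {X | ∀ (g : G) (q : P.Fib b), X (q.act g) = a.act g q.1 (X q)}
  add_mem' {X Y} hX hY g q := by simp only [Pi.add_apply, hX g q, hY g q, map_add]
  zero_mem' g q := by simp
  smul_mem' c X hX g q := by simp only [Pi.smul_apply, hX g q, map_smul]

/-- The fibre over `b` of the quotient vector bundle `E/G → N`. An orbit of `G` in `E` over `b` is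
the graph of a `G`-equivariant section of `E` along the fibre of `Q → N` over `b`, so the fibre of
`E/G` is the vector space of these sections. -/
def QuotFiber (b : N) : Type _ := equivariantSections P a b

namespace QuotFiber

instance (b : N) : AddCommGroup (QuotFiber P a b) :=
  inferInstanceAs (AddCommGroup (equivariantSections P a b))

instance (b : N) : Module ℝ (QuotFiber P a b) :=
  inferInstanceAs (Module ℝ (equivariantSections P a b))

instance (b : N) : TopologicalSpace (QuotFiber P a b) :=
  inferInstanceAs (TopologicalSpace (equivariantSections P a b))

instance [∀ q, IsTopologicalAddGroup (E q)] (b : N) : IsTopologicalAddGroup (QuotFiber P a b) :=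
  inferInstanceAs (IsTopologicalAddGroup (equivariantSections P a b))

instance [∀ q, ContinuousSMul ℝ (E q)] (b : N) : ContinuousSMul ℝ (QuotFiber P a b) :=
  inferInstanceAs (ContinuousSMul ℝ (equivariantSections P a b))

variable {P a}

/-- The value at `q` of an element of `E/G`, seen as an equivariant section along a fibre. -/
def val {b : N} (X : QuotFiber P a b) (q : P.Fib b) : E q.1 := Subtype.val (p := _) X q

@[ext]
theorem ext {b : N} {X Y : QuotFiber P a b} (h : ∀ q, X.val q = Y.val q) : X = Y :=
  Subtype.ext (funext h)

theorem val_actTo {b : N} (X : QuotFiber P a b) (g : G) (q q' : P.Fib b) (h : g • q.1 = q'.1) :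
    X.val q' = a.actTo g h (X.val q) := by
  obtain rfl : q.act g = q' := Subtype.ext h
  exact X.2 g q

variable (P a)

/-- An element `v` of `E` at a point `q` over `b` extends uniquely to an equivariant section along
the fibre of `q`. -/
def extend {b : N} (q : P.Fib b) (v : E q.1) : QuotFiber P a b :=
  ⟨fun q' ↦ a.actTo (P.div q.1 q'.1 (q.2.trans q'.2.symm)) (P.div_smul _) v, fun g q' ↦ by
    refine ((a.actTo_actTo (P.div_smul (q.2.trans q'.2.symm)) (rfl : g • q'.1 = _) _ ?_ v).symm)
    refine P.smul_cancel (q := q.1) ?_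
    rw [mul_smul, P.div_smul, P.div_smul]⟩

theorem val_extend {b : N} (q q' : P.Fib b) (g : G) (h : g • q.1 = q'.1) (v : E q.1) :
    (extend P a q v).val q' = a.actTo g h v := by
  have : g = P.div q.1 q'.1 (q.2.trans q'.2.symm) :=
    P.smul_cancel (q := q.1) (by rw [h, P.div_smul])
  subst this
  rfl

/-- Evaluation of an equivariant section at a point of the fibre: the identification of the fibre
of `E/G` over `b` with the fibre of `E` at any point over `b`. -/
def evalEquiv {b : N} (q : P.Fib b) : QuotFiber P a b ≃L[ℝ] E q.1 where
  toFun X := X.val q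
  map_add' _ _ := rfl
  map_smul' _ _ := rfl
  invFun v := extend P a q v
  left_inv X := by
    ext q'
    exact (X.val_actTo _ q q' _).symm
  right_inv v := by
    change (extend P a q v).val q = v
    rw [val_extend P a q q 1 (one_smul _ _), a.actTo_one]
  continuous_toFun := (continuous_apply q).comp continuous_subtype_val
  continuous_invFun :=
    Continuous.subtype_mk (continuous_pi fun _ ↦ ContinuousLinearMap.continuous _) _

theorem evalEquiv_apply {b : N} (q : P.Fib b) (X : QuotFiber P a b) :
    evalEquiv P a q X = X.val q := rfl

end QuotFiber

/-- The point of the fibre over `b` given by a section of `Q → N`. -/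
abbrev PrincipalBundle.LocalSection.pt {P : PrincipalBundle EG G EQ Q EN N} (σ : P.LocalSection)
    (b : N) : P.Fib b := ⟨σ.sec b, σ.proj_sec b⟩

open QuotFiber

/-- A smooth local section of `Q → N` and a local trivialization of `E` induce
a local trivialization of `E/G`. -/
def quotPretriv (σ : P.LocalSection) (e : Trivialization F (π F E)) [MemTrivializationAtlas e] :
    Pretrivialization F (π F (QuotFiber P a)) where
  toFun x := (x.1, (e ⟨σ.sec x.1, evalEquiv P a (σ.pt x.1) x.2⟩).2)
  invFun p := ⟨p.1, (evalEquiv P a (σ.pt p.1)).symm (e.symm (σ.sec p.1) p.2)⟩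
  source := π F (QuotFiber P a) ⁻¹' (σ.baseSet ∩ σ.sec ⁻¹' e.baseSet)
  target := (σ.baseSet ∩ σ.sec ⁻¹' e.baseSet) ×ˢ univ
  map_source' x hx := ⟨hx, mem_univ _⟩
  map_target' p hp := hp.1
  left_inv' x hx := by
    obtain ⟨b, X⟩ := x
    refine congrArg (TotalSpace.mk b) ?_
    refine (ContinuousLinearEquiv.symm_apply_eq _).2 ?_
    exact e.symm_apply_apply_mk hx.2 _
  right_inv' p hp := by
    refine Prod.ext rfl ?_
    simp only [ContinuousLinearEquiv.apply_symm_apply]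
    exact congrArg Prod.snd (e.apply_mk_symm hp.1.2 p.2)
  open_target := (σ.smooth.continuousOn.isOpen_inter_preimage σ.isOpen_baseSet
    e.open_baseSet).prod isOpen_univ
  baseSet := σ.baseSet ∩ σ.sec ⁻¹' e.baseSet
  open_baseSet := σ.smooth.continuousOn.isOpen_inter_preimage σ.isOpen_baseSet e.open_baseSet
  source_eq := rfl
  target_eq := rfl
  proj_toFun _ _ := rfl

theorem quotPretriv_apply (σ : P.LocalSection) (e : Trivialization F (π F E))
    [MemTrivializationAtlas e] (x : TotalSpace F (QuotFiber P a)) :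
    quotPretriv P a σ e x = (x.1, (e ⟨σ.sec x.1, evalEquiv P a (σ.pt x.1) x.2⟩).2) := rfl

theorem quotPretriv_symm (σ : P.LocalSection) (e : Trivialization F (π F E))
    [MemTrivializationAtlas e] {b : N} (hb : b ∈ (quotPretriv P a σ e).baseSet) (v : F) :
    (quotPretriv P a σ e).symm b v = (evalEquiv P a (σ.pt b)).symm (e.symm (σ.sec b) v) :=
  totalSpace_mk_inj (F := F) (E := QuotFiber P a) ((quotPretriv P a σ e).mk_symm hb v)

instance (σ : P.LocalSection) (e : Trivialization F (π F E)) [MemTrivializationAtlas e] :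
    (quotPretriv P a σ e).IsLinear ℝ where
  linear b hb := ⟨fun X Y ↦ by
      simp only [quotPretriv_apply, map_add]
      exact (e.linear ℝ hb.2).map_add _ _,
    fun c X ↦ by
      simp only [quotPretriv_apply, map_smul]
      exact (e.linear ℝ hb.2).map_smul _ _⟩

theorem quotCoordChange [FiniteDimensional ℝ F] [LieGroup 𝓘(ℝ, EG) ∞ G]
    [ContMDiffVectorBundle ∞ F E 𝓘(ℝ, EQ)] (σ σ' : P.LocalSection)
    (e e' : Trivialization F (π F E)) [MemTrivializationAtlas e] [MemTrivializationAtlas e'] :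
    ∃ f : N → F →L[ℝ] F, ContMDiffOn 𝓘(ℝ, EN) 𝓘(ℝ, F →L[ℝ] F) ∞ f
      ((quotPretriv P a σ e).baseSet ∩ (quotPretriv P a σ' e').baseSet) ∧
      ∀ b ∈ (quotPretriv P a σ e).baseSet ∩ (quotPretriv P a σ' e').baseSet, ∀ v : F,
        f b v = (quotPretriv P a σ' e' ⟨b, (quotPretriv P a σ e).symm b v⟩).2 := by
  have hdiv : ∀ b, P.proj (σ.sec b) = P.proj (σ'.sec b) := fun b ↦
    (σ.proj_sec b).trans (σ'.proj_sec b).symm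
  let f : N → F →L[ℝ] F := fun b ↦ (e'.continuousLinearMapAt ℝ (σ'.sec b)).comp
    ((a.actTo (P.div _ _ (hdiv b)) (P.div_smul _)).comp (e.symmL ℝ (σ.sec b)))
  have key : ∀ b ∈ (quotPretriv P a σ e).baseSet ∩ (quotPretriv P a σ' e').baseSet, ∀ v : F,
      f b v = (e' ⟨σ'.sec b,
        a.actTo (P.div _ _ (hdiv b)) (P.div_smul _) (e.symm (σ.sec b) v)⟩).2 := by
    intro b hb v
    simp [f, Trivialization.symmL_apply _ hb.1.2, Trivialization.coe_linearMapAt_of_mem _ hb.2.2]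
  refine ⟨f, fun b₀ hb₀ ↦ ContMDiffAt.contMDiffWithinAt ?_, fun b hb v ↦ ?_⟩
  · have hσ := σ.smooth.contMDiffAt (σ.isOpen_baseSet.mem_nhds hb₀.1.1)
    have hσ' := σ'.smooth.contMDiffAt (σ'.isOpen_baseSet.mem_nhds hb₀.2.1)
    refine contMDiffAt_clm_of_apply fun v ↦ ?_
    have h1 := contMDiffAt_symm_const (E₁ := E) hσ e hb₀.1.2 v
    have h2 := a.smooth.contMDiffAt.comp b₀ ((P.contMDiffAt_div hdiv hσ hσ').prodMk h1)
    have h3 : ContMDiffAt 𝓘(ℝ, EN) (𝓘(ℝ, EQ).prod 𝓘(ℝ, F)) ∞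
        (fun b ↦ (⟨σ'.sec b, a.actTo (P.div _ _ (hdiv b)) (P.div_smul _)
          (e.symm (σ.sec b) v)⟩ : TotalSpace F E)) b₀ :=
      h2.congr_of_eventuallyEq (Filter.Eventually.of_forall fun b ↦ a.mk_actTo _ _ _)
    rw [e'.contMDiffAt_iff (by simpa [e'.mem_source] using hb₀.2.2)] at h3
    refine h3.2.congr_of_eventuallyEq ?_
    filter_upwards [((quotPretriv P a σ e).open_baseSet.inter
      (quotPretriv P a σ' e').open_baseSet).mem_nhds hb₀] with b hb
    exact key b hb v
  · rw [key b hb v, quotPretriv_apply, quotPretriv_symm P a σ e hb.1]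
    rfl

variable [FiniteDimensional ℝ F] [LieGroup 𝓘(ℝ, EG) ∞ G] [ContMDiffVectorBundle ∞ F E 𝓘(ℝ, EQ)]

/-- The vector bundle structure of `E/G → N`. -/
def quotPrebundle : VectorPrebundle ℝ F (QuotFiber P a) where
  pretrivializationAtlas := {e' | ∃ (σ : P.LocalSection) (e : Trivialization F (π F E))
    (_ : MemTrivializationAtlas e), e' = quotPretriv P a σ e}
  pretrivialization_linear' := by
    rintro _ ⟨σ, e, he, rfl⟩
    infer_instance
  pretrivializationAt b :=
    quotPretriv P a (P.sectionAt b) (trivializationAt F E ((P.sectionAt b).sec b))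
  mem_base_pretrivializationAt b := ⟨P.mem_sectionAt b, mem_baseSet_trivializationAt F E _⟩
  pretrivialization_mem_atlas b := ⟨_, _, inferInstance, rfl⟩
  exists_coordChange := by
    rintro _ ⟨σ, e, he, rfl⟩ _ ⟨σ', e', he', rfl⟩
    obtain ⟨f, hf, h⟩ := quotCoordChange P a σ σ' e e'
    exact ⟨f, hf.continuousOn, h⟩
  totalSpaceMk_isInducing b := by
    let σ := P.sectionAt b
    let e := trivializationAt F E (σ.sec b)
    have h1 : Topology.IsInducing (fun X : QuotFiber P a b ↦ (b, e.continuousLinearEquivAt ℝ (σ.sec b)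
        (mem_baseSet_trivializationAt F E _) (evalEquiv P a (σ.pt b) X))) :=
      Topology.isInducing_const_prod.2 ((evalEquiv P a (σ.pt b)).trans
        (e.continuousLinearEquivAt ℝ (σ.sec b)
          (mem_baseSet_trivializationAt F E _))).toHomeomorph.isInducing
    exact h1

instance quotPrebundle_isContMDiff : (quotPrebundle P a).IsContMDiff 𝓘(ℝ, EN) ∞ where
  exists_contMDiffCoordChange := by
    rintro _ ⟨σ, e, he, rfl⟩ _ ⟨σ', e', he', rfl⟩
    exact quotCoordChange P a σ σ' e e'

instance : TopologicalSpace (TotalSpace F (QuotFiber P a)) :=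
  (quotPrebundle P a).totalSpaceTopology

instance : FiberBundle F (QuotFiber P a) := (quotPrebundle P a).toFiberBundle

instance : VectorBundle ℝ F (QuotFiber P a) := (quotPrebundle P a).toVectorBundle

instance : ContMDiffVectorBundle ∞ F (QuotFiber P a) 𝓘(ℝ, EN) :=
  (quotPrebundle P a).contMDiffVectorBundle 𝓘(ℝ, EN)

end Quotient

section QuotientSmooth

variable {EG : Type*} [NormedAddCommGroup EG] [NormedSpace ℝ EG]
  {G : Type*} [Group G] [TopologicalSpace G] [ChartedSpace EG G]
  {EQ : Type*} [NormedAddCommGroup EQ] [NormedSpace ℝ EQ]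
  {Q : Type*} [TopologicalSpace Q] [ChartedSpace EQ Q] [MulAction G Q]
  {EN : Type*} [NormedAddCommGroup EN] [NormedSpace ℝ EN]
  {N : Type*} [TopologicalSpace N] [ChartedSpace EN N]
  {F : Type*} [NormedAddCommGroup F] [NormedSpace ℝ F]
  {E : Q → Type*} [∀ x, AddCommGroup (E x)] [∀ x, Module ℝ (E x)]
  [∀ x, TopologicalSpace (E x)]
  [TopologicalSpace (TotalSpace F E)] [FiberBundle F E] [VectorBundle ℝ F E]
  (P : PrincipalBundle EG G EQ Q EN N) (a : BundleAction EG G EQ F E)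
  [FiniteDimensional ℝ F] [LieGroup 𝓘(ℝ, EG) ∞ G] [ContMDiffVectorBundle ∞ F E 𝓘(ℝ, EQ)]
  {EM : Type*} [NormedAddCommGroup EM] [NormedSpace ℝ EM] {HM : Type*} [TopologicalSpace HM]
  {IM : ModelWithCorners ℝ EM HM} {M : Type*} [TopologicalSpace M] [ChartedSpace HM M]

open QuotFiber

theorem contMDiffAt_quot_iff_section {f : M → TotalSpace F (QuotFiber P a)} {m₀ : M}
    (σ : P.LocalSection) (hσ : (f m₀).1 ∈ σ.baseSet) :
    ContMDiffAt IM (𝓘(ℝ, EN).prod 𝓘(ℝ, F)) ∞ f m₀ ↔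
      ContMDiffAt IM 𝓘(ℝ, EN) ∞ (fun m ↦ (f m).1) m₀ ∧
      ContMDiffAt IM (𝓘(ℝ, EQ).prod 𝓘(ℝ, F)) ∞
        (fun m ↦ (⟨σ.sec (f m).1, (f m).2.val (σ.pt (f m).1)⟩ : TotalSpace F E)) m₀ := by
  let e := trivializationAt F E (σ.sec (f m₀).1)
  have hmem : quotPretriv P a σ e ∈ (quotPrebundle P a).pretrivializationAtlas :=
    ⟨σ, e, inferInstance, rfl⟩
  let ē : Trivialization F (π F (QuotFiber P a)) :=
    (quotPrebundle P a).trivializationOfMemPretrivializationAtlas hmem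
  have : MemTrivializationAtlas ē := ⟨⟨_, hmem, rfl⟩⟩
  have hb : σ.sec (f m₀).1 ∈ e.baseSet := mem_baseSet_trivializationAt F E _
  have hsource : f m₀ ∈ ē.source := ⟨hσ, hb⟩
  rw [ē.contMDiffAt_iff hsource, e.contMDiffAt_iff (by simpa [e.mem_source] using hb)]
  refine and_congr_right fun h ↦ ⟨fun h2 ↦ ⟨?_, h2⟩, fun h2 ↦ h2.2⟩
  have hs : ContMDiffAt IM 𝓘(ℝ, EQ) ∞ (fun m ↦ σ.sec (f m).1) m₀ :=
    (σ.smooth.contMDiffAt (σ.isOpen_baseSet.mem_nhds hσ)).comp m₀ h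
  exact hs

/-- A map into `E/G` is smooth iff it is so when read in `E` along a smooth lift of its base
map. -/
theorem contMDiffAt_quot_iff {f : M → TotalSpace F (QuotFiber P a)} {m₀ : M} {u : M → Q}
    (h : ∀ m, P.proj (u m) = (f m).1) (hu : ContMDiffAt IM 𝓘(ℝ, EQ) ∞ u m₀) :
    ContMDiffAt IM (𝓘(ℝ, EN).prod 𝓘(ℝ, F)) ∞ f m₀ ↔
      ContMDiffAt IM (𝓘(ℝ, EQ).prod 𝓘(ℝ, F)) ∞
        (fun m ↦ (⟨u m, (f m).2.val ⟨u m, h m⟩⟩ : TotalSpace F E)) m₀ := by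
  let σ := P.sectionAt (f m₀).1
  have hσ : (f m₀).1 ∈ σ.baseSet := P.mem_sectionAt _
  have hb : ContMDiffAt IM 𝓘(ℝ, EN) ∞ (fun m ↦ (f m).1) m₀ :=
    (P.proj_smooth.contMDiffAt.comp m₀ hu).congr_of_eventuallyEq
      (Filter.Eventually.of_forall fun m ↦ (h m).symm)
  have hs : ContMDiffAt IM 𝓘(ℝ, EQ) ∞ (fun m ↦ σ.sec (f m).1) m₀ :=
    (σ.smooth.contMDiffAt (σ.isOpen_baseSet.mem_nhds hσ)).comp m₀ hb
  have hd : ∀ m, P.proj (u m) = P.proj (σ.sec (f m).1) := fun m ↦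
    (h m).trans (σ.proj_sec _).symm
  rw [contMDiffAt_quot_iff_section P a σ hσ]
  refine ⟨fun h2 ↦ ?_, fun h2 ↦ ⟨hb, ?_⟩⟩
  · refine (a.smooth.contMDiffAt.comp m₀
      ((P.contMDiffAt_div (fun m ↦ (hd m).symm) hs hu).prodMk h2.2)).congr_of_eventuallyEq
      (Filter.Eventually.of_forall fun m ↦ ?_)
    dsimp only
    rw [(f m).2.val_actTo _ (σ.pt _) ⟨u m, h m⟩ (P.div_smul (hd m).symm), a.mk_actTo]
    rfl
  · refine (a.smooth.contMDiffAt.comp m₀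
      ((P.contMDiffAt_div hd hu hs).prodMk h2)).congr_of_eventuallyEq
      (Filter.Eventually.of_forall fun m ↦ ?_)
    dsimp only
    rw [(f m).2.val_actTo _ ⟨u m, h m⟩ (σ.pt _) (P.div_smul (hd m)), a.mk_actTo]
    rfl

/-- A section of `E/G` is smooth iff the corresponding equivariant section of `E` is. -/
theorem contMDiff_quot_section_iff (X : ∀ b, QuotFiber P a b) :
    ContMDiff 𝓘(ℝ, EN) (𝓘(ℝ, EN).prod 𝓘(ℝ, F)) ∞
      (fun b ↦ (⟨b, X b⟩ : TotalSpace F (QuotFiber P a))) ↔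
    ContMDiff 𝓘(ℝ, EQ) (𝓘(ℝ, EQ).prod 𝓘(ℝ, F)) ∞
      (fun q ↦ (⟨q, (X (P.proj q)).val ⟨q, rfl⟩⟩ : TotalSpace F E)) := by
  constructor
  · intro h q
    exact (contMDiffAt_quot_iff P a (f := fun q ↦ ⟨P.proj q, X (P.proj q)⟩) (u := id)
      (fun _ ↦ rfl) contMDiffAt_id).1 (h.comp P.proj_smooth q)
  · intro h b
    let σ := P.sectionAt b
    have hσ := σ.smooth.contMDiffAt (σ.isOpen_baseSet.mem_nhds (P.mem_sectionAt b))
    refine (contMDiffAt_quot_iff P a (u := σ.sec) (fun b ↦ σ.proj_sec b) hσ).2 ?_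
    refine (h.contMDiffAt.comp b hσ).congr_of_eventuallyEq
      (Filter.Eventually.of_forall fun c ↦ ?_)
    have key : ∀ (c' : N) (hc : P.proj (σ.sec c) = c'),
        (⟨σ.sec c, (X c').val ⟨σ.sec c, hc⟩⟩ : TotalSpace F E) =
          ⟨σ.sec c, (X (P.proj (σ.sec c))).val ⟨σ.sec c, rfl⟩⟩ := by
      rintro _ rfl
      rfl
    exact key c (σ.proj_sec c)

/-- The canonical projection `E* → E*/G ≅ (E/G)*`: the value of the image of `β ∈ E*_q` at an
element of `E/G` is the value of `β` at its representative in `E_q`. -/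
def quotDualProj : DualMorphism EQ F E EN F (QuotFiber P a) P.proj where
  toFun q := dualMap (evalEquiv P a (⟨q, rfl⟩ : P.Fib (P.proj q)) :
    QuotFiber P a (P.proj q) →L[ℝ] E q)
  smooth β₀ := by
    have hb' : ContMDiffAt (𝓘(ℝ, EQ).prod 𝓘(ℝ, F →L[ℝ] ℝ)) 𝓘(ℝ, EQ) ∞
      (fun β : DualTotal F E ↦ β.1) β₀ := (contMDiff_proj _).contMDiffAt
    have hb := P.proj_smooth.contMDiffAt.comp β₀ hb'
    refine contMDiffAt_dual_of_apply hb fun v ↦ ?_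
    refine contMDiffAt_dual_apply (b := fun β : DualTotal F E ↦ β.1) (α := fun β ↦ β.2)
      contMDiffAt_id ?_
    exact (contMDiffAt_quot_iff P a (u := fun β : DualTotal F E ↦ β.1) (fun _ ↦ rfl) hb').1
      (contMDiffAt_symm_const hb _ (mem_baseSet_trivializationAt F (QuotFiber P a) _) v)

end QuotientSmooth

section TangentAction

variable {EG : Type*} [NormedAddCommGroup EG] [NormedSpace ℝ EG]
  {G : Type*} [Group G] [TopologicalSpace G] [ChartedSpace EG G]
  {EQ : Type*} [NormedAddCommGroup EQ] [NormedSpace ℝ EQ]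
  {Q : Type*} [TopologicalSpace Q] [ChartedSpace EQ Q] [MulAction G Q]
  [LieGroup 𝓘(ℝ, EG) ∞ G] [IsManifold 𝓘(ℝ, EQ) ∞ Q]

variable (EG EQ) in
theorem contMDiff_smul_left [ContMDiffSMul 𝓘(ℝ, EG) 𝓘(ℝ, EQ) ∞ G Q] (g : G) :
    ContMDiff 𝓘(ℝ, EQ) 𝓘(ℝ, EQ) ∞ (fun q : Q ↦ g • q) :=
  (contMDiff_smul (I := 𝓘(ℝ, EG)) (I' := 𝓘(ℝ, EQ)) (n := ∞) (G := G) (M := Q)).comp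
    (contMDiff_const.prodMk contMDiff_id)

variable (EG EQ) in
theorem mdifferentiable_smul_left [ContMDiffSMul 𝓘(ℝ, EG) 𝓘(ℝ, EQ) ∞ G Q] (g : G) :
    MDifferentiable 𝓘(ℝ, EQ) 𝓘(ℝ, EQ) (fun q : Q ↦ g • q) :=
  (contMDiff_smul_left EG EQ g).mdifferentiable (by simp)

variable [ContMDiffSMul 𝓘(ℝ, EG) 𝓘(ℝ, EQ) ∞ G Q]

variable (EG G EQ Q) in
/-- The tangent lift of the action of `G` on `Q`. -/
def tangentAction : BundleAction EG G EQ EQ (TangentSpace 𝓘(ℝ, EQ) (M := Q)) where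
  act g q := mfderiv 𝓘(ℝ, EQ) 𝓘(ℝ, EQ) (fun q : Q ↦ g • q) q
  act_one q v := by
    change tangentMap 𝓘(ℝ, EQ) 𝓘(ℝ, EQ) (fun q : Q ↦ (1 : G) • q) ⟨q, v⟩ = ⟨q, v⟩
    have : (fun q : Q ↦ (1 : G) • q) = id := funext fun q ↦ one_smul G q
    rw [this, tangentMap_id]
    rfl
  act_mul g h q v := by
    change tangentMap 𝓘(ℝ, EQ) 𝓘(ℝ, EQ) (fun q : Q ↦ (g * h) • q) ⟨q, v⟩ =
      tangentMap 𝓘(ℝ, EQ) 𝓘(ℝ, EQ) (fun q : Q ↦ g • q)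
        (tangentMap 𝓘(ℝ, EQ) 𝓘(ℝ, EQ) (fun q : Q ↦ h • q) ⟨q, v⟩)
    have : (fun q : Q ↦ (g * h) • q) = (fun q : Q ↦ g • q) ∘ (fun q : Q ↦ h • q) :=
      funext fun q ↦ mul_smul g h q
    rw [this, tangentMap_comp (mdifferentiable_smul_left EG EQ g)
      (mdifferentiable_smul_left EG EQ h)]
    rfl
  smooth p₀ := by
    have hsm : ContMDiff (𝓘(ℝ, EG).prod 𝓘(ℝ, EQ)) 𝓘(ℝ, EQ) ∞ (fun p : G × Q ↦ p.1 • p.2) :=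
      contMDiff_smul
    have h1 : ContMDiffAt (𝓘(ℝ, EG).prod (𝓘(ℝ, EQ).prod 𝓘(ℝ, EQ))) 𝓘(ℝ, EG) ∞
        (fun p : G × TangentBundle 𝓘(ℝ, EQ) Q ↦ p.1) p₀ := contMDiffAt_fst
    have h2 : ContMDiffAt (𝓘(ℝ, EG).prod (𝓘(ℝ, EQ).prod 𝓘(ℝ, EQ))) (𝓘(ℝ, EQ).prod 𝓘(ℝ, EQ)) ∞
        (fun p : G × TangentBundle 𝓘(ℝ, EQ) Q ↦ p.2) p₀ := contMDiffAt_snd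
    have h3 : ContMDiffAt (𝓘(ℝ, EG).prod (𝓘(ℝ, EQ).prod 𝓘(ℝ, EQ))) 𝓘(ℝ, EQ) ∞
        (fun p : G × TangentBundle 𝓘(ℝ, EQ) Q ↦ p.2.1) p₀ :=
      (contMDiff_proj _).contMDiffAt.comp p₀ h2
    have h4 : ContMDiffAt (𝓘(ℝ, EG).prod (𝓘(ℝ, EQ).prod 𝓘(ℝ, EQ))) 𝓘(ℝ, EQ) ∞
        (fun p : G × TangentBundle 𝓘(ℝ, EQ) Q ↦ p.1 • p.2.1) p₀ :=
      hsm.contMDiffAt.comp p₀ (h1.prodMk h3)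
    refine ContMDiffAt.clm_apply_of_inCoordinates
      (b₁ := fun p : G × TangentBundle 𝓘(ℝ, EQ) Q ↦ p.2.1)
      (b₂ := fun p : G × TangentBundle 𝓘(ℝ, EQ) Q ↦ p.1 • p.2.1)
      (ϕ := fun p ↦ mfderiv 𝓘(ℝ, EQ) 𝓘(ℝ, EQ) (fun q : Q ↦ p.1 • q) p.2.1)
      (v := fun p ↦ p.2.2) ?_ h2 h4
    refine ContMDiffAt.mfderiv (n := ∞) (fun (p : G × TangentBundle 𝓘(ℝ, EQ) Q) (q : Q) ↦ p.1 • q)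
      (fun p ↦ p.2.1) ?_ h3 (by simp)
    exact hsm.contMDiffAt.comp _ ((contMDiffAt_fst.comp _ contMDiffAt_fst).prodMk contMDiffAt_snd)

end TangentAction

section TangentAlgebroid

variable {EQ : Type*} [NormedAddCommGroup EQ] [NormedSpace ℝ EQ] [FiniteDimensional ℝ EQ]
  {Q : Type*} [TopologicalSpace Q] [ChartedSpace EQ Q] [IsManifold 𝓘(ℝ, EQ) ∞ Q]

variable (EQ Q) in
/-- The space `𝔛(Q)` of smooth vector fields. -/
abbrev VField : Type _ := Sections (EB := EQ) EQ (TangentSpace 𝓘(ℝ, EQ) (M := Q))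

theorem mdifferentiableAt_vfield (X : VField EQ Q) (q : Q) :
    MDifferentiableAt 𝓘(ℝ, EQ) 𝓘(ℝ, EQ).tangent
      (fun q ↦ (⟨q, X q⟩ : TangentBundle 𝓘(ℝ, EQ) Q)) q :=
  (X.contMDiff q).mdifferentiableAt (by simp)

theorem contMDiff_lieBr (X Y : VField EQ Q) :
    ContMDiff 𝓘(ℝ, EQ) 𝓘(ℝ, EQ).tangent ∞ (fun q ↦
      (⟨q, VectorField.mlieBracket 𝓘(ℝ, EQ) X Y q⟩ : TangentBundle 𝓘(ℝ, EQ) Q)) := by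
  have := FiniteDimensional.complete ℝ EQ
  have : IsManifold 𝓘(ℝ, EQ) (((⊤ : ℕ∞) : ℕ∞ω) + 1) Q := ‹IsManifold 𝓘(ℝ, EQ) ∞ Q›
  have : IsManifold 𝓘(ℝ, EQ) (minSmoothness ℝ 2) Q := by
    rw [minSmoothness_of_isRCLikeNormedField]; infer_instance
  exact fun q ↦ ContMDiffAt.mlieBracket_vectorField (n := ⊤) (m := ⊤)
    (X.contMDiff q) (Y.contMDiff q) (by simp)

/-- The Lie bracket of vector fields. -/
def lieBr (X Y : VField EQ Q) : VField EQ Q :=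
  ⟨VectorField.mlieBracket 𝓘(ℝ, EQ) X Y, contMDiff_lieBr X Y⟩

theorem lieBr_apply (X Y : VField EQ Q) (q : Q) :
    lieBr X Y q = VectorField.mlieBracket 𝓘(ℝ, EQ) X Y q := rfl

variable (EQ Q) in
/-- The tangent bundle as a Lie algebroid, with the Lie bracket of vector fields and the identity
as anchor. -/
def tangentAlgebroid : LieAlgebroid (EB := EQ) EQ (TangentSpace 𝓘(ℝ, EQ) (M := Q)) where
  bracket := lieBr
  anchor q := ContinuousLinearMap.id ℝ _
  anchor_smooth := contMDiff_id
  add_left X X' Y := by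
    have := FiniteDimensional.complete ℝ EQ
    ext q
    exact VectorField.mlieBracket_add_left (mdifferentiableAt_vfield X q) (mdifferentiableAt_vfield X' q)
  smul_left c X Y := by
    have := FiniteDimensional.complete ℝ EQ
    ext q
    exact VectorField.mlieBracket_const_smul_left (mdifferentiableAt_vfield X q)
  skew X Y := by
    ext q
    exact VectorField.mlieBracket_swap_apply
  leibniz X Y f q := by
    have := FiniteDimensional.complete ℝ EQ
    refine (VectorField.mlieBracket_smul_right (V := X) (f := f)
      ((f.contMDiff q).mdifferentiableAt (by simp)) (mdifferentiableAt_vfield Y q)).trans ?_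
    exact add_comm _ _
  jacobi X Y Z := by
    have := FiniteDimensional.complete ℝ EQ
    ext q
    have : IsManifold 𝓘(ℝ, EQ) (minSmoothness ℝ 3) Q := by
      rw [minSmoothness_of_isRCLikeNormedField]; infer_instance
    have h : ∀ X : VField EQ Q, ContMDiffAt 𝓘(ℝ, EQ) 𝓘(ℝ, EQ).tangent (minSmoothness ℝ 2)
        (fun q ↦ (⟨q, X q⟩ : TangentBundle 𝓘(ℝ, EQ) Q)) q := fun X ↦ by
      rw [minSmoothness_of_isRCLikeNormedField]
      exact (X.contMDiff q).of_le (ENat.LEInfty.out)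
    exact VectorField.leibniz_identity_mlieBracket_apply (h X) (h Y) (h Z)

end TangentAlgebroid

section QuotientSections

variable {EG : Type*} [NormedAddCommGroup EG] [NormedSpace ℝ EG]
  {G : Type*} [Group G] [TopologicalSpace G] [ChartedSpace EG G]
  {EQ : Type*} [NormedAddCommGroup EQ] [NormedSpace ℝ EQ]
  {Q : Type*} [TopologicalSpace Q] [ChartedSpace EQ Q] [MulAction G Q]
  {EN : Type*} [NormedAddCommGroup EN] [NormedSpace ℝ EN]
  {N : Type*} [TopologicalSpace N] [ChartedSpace EN N]
  {F : Type*} [NormedAddCommGroup F] [NormedSpace ℝ F]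
  {E : Q → Type*} [∀ x, AddCommGroup (E x)] [∀ x, Module ℝ (E x)]
  [∀ x, TopologicalSpace (E x)]
  [TopologicalSpace (TotalSpace F E)] [FiberBundle F E] [VectorBundle ℝ F E]
  {P : PrincipalBundle EG G EQ Q EN N} {a : BundleAction EG G EQ F E}
  [FiniteDimensional ℝ F] [LieGroup 𝓘(ℝ, EG) ∞ G] [ContMDiffVectorBundle ∞ F E 𝓘(ℝ, EQ)]

/-- The equivariant section of `E` corresponding to a section of `E/G`. -/
def liftSection (X : Sections (EB := EN) F (QuotFiber P a)) : Sections (EB := EQ) F E :=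
  ⟨fun q ↦ (X (P.proj q)).val ⟨q, rfl⟩, (contMDiff_quot_section_iff P a X).1 X.contMDiff⟩

theorem liftSection_eq_val (X : Sections (EB := EN) F (QuotFiber P a)) {b : N} (q : P.Fib b) :
    liftSection X q.1 = (X b).val q := by
  obtain ⟨q, rfl⟩ := q
  rfl

theorem liftSection_smul (X : Sections (EB := EN) F (QuotFiber P a)) (g : G) (q : Q) :
    liftSection X (g • q) = a.act g q (liftSection X q) :=
  (liftSection_eq_val X (b := P.proj q) ⟨g • q, P.proj_smul g q⟩).trans
    ((X (P.proj q)).2 g ⟨q, rfl⟩)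

variable (P a) in
/-- The section of `E/G` corresponding to an equivariant section of `E`. -/
def descendSection (Y : Sections (EB := EQ) F E) (hY : ∀ (g : G) q, Y (g • q) = a.act g q (Y q)) :
    Sections (EB := EN) F (QuotFiber P a) :=
  ⟨fun _ ↦ ⟨fun q ↦ Y q.1, fun g q ↦ hY g q.1⟩,
    (contMDiff_quot_section_iff P a _).2 Y.contMDiff⟩

theorem lift_descendSection (Y : Sections (EB := EQ) F E)
    (hY : ∀ (g : G) q, Y (g • q) = a.act g q (Y q)) :
    liftSection (descendSection P a Y hY) = Y := rfl

theorem liftSection_injective :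
    Function.Injective (liftSection : Sections (EB := EN) F (QuotFiber P a) → _) := by
  intro X Y h
  ext b : 1
  refine QuotFiber.ext fun q ↦ ?_
  rw [← liftSection_eq_val, ← liftSection_eq_val, h]

end QuotientSections

section Atiyah

variable {EG : Type*} [NormedAddCommGroup EG] [NormedSpace ℝ EG]
  {G : Type*} [Group G] [TopologicalSpace G] [ChartedSpace EG G]
  {EQ : Type*} [NormedAddCommGroup EQ] [NormedSpace ℝ EQ] [FiniteDimensional ℝ EQ]
  {Q : Type*} [TopologicalSpace Q] [ChartedSpace EQ Q] [IsManifold 𝓘(ℝ, EQ) ∞ Q]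
  [MulAction G Q]
  {EN : Type*} [NormedAddCommGroup EN] [NormedSpace ℝ EN]
  {N : Type*} [TopologicalSpace N] [ChartedSpace EN N] [IsManifold 𝓘(ℝ, EN) ∞ N]
  (P : PrincipalBundle EG G EQ Q EN N)

variable (EG EQ) in
theorem isInvertible_mfderiv_smul [LieGroup 𝓘(ℝ, EG) ∞ G]
    [ContMDiffSMul 𝓘(ℝ, EG) 𝓘(ℝ, EQ) ∞ G Q] (g : G) (q : Q) :
    (mfderiv 𝓘(ℝ, EQ) 𝓘(ℝ, EQ) (fun q : Q ↦ g • q) q).IsInvertible := by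
  let a : BundleAction EG G EQ EQ (TangentSpace 𝓘(ℝ, EQ) (M := Q)) := tangentAction EG G EQ Q
  have hg : g⁻¹ • g • q = q := inv_smul_smul g q
  refine ContinuousLinearMap.IsInvertible.of_inverse (g := a.actTo g⁻¹ hg) ?_ ?_
  · ext v
    exact (a.actTo_actTo hg rfl (one_smul G (g • q)) (mul_inv_cancel g) v).trans (a.actTo_one _ _)
  · ext v
    exact (a.actTo_actTo rfl hg (one_smul G q) (inv_mul_cancel g) v).trans (a.actTo_one _ _)

variable [LieGroup 𝓘(ℝ, EG) ∞ G] [ContMDiffSMul 𝓘(ℝ, EG) 𝓘(ℝ, EQ) ∞ G Q]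

theorem tangentAction_act (g : G) (q : Q) : (tangentAction EG G EQ Q).act g q =
    mfderiv 𝓘(ℝ, EQ) 𝓘(ℝ, EQ) (fun q : Q ↦ g • q) q := rfl

/-- The Lie bracket of invariant vector fields is invariant. -/
theorem lieBr_smul (X Y : VField EQ Q)
    (hX : ∀ (g : G) q, X (g • q) = (tangentAction EG G EQ Q).act g q (X q))
    (hY : ∀ (g : G) q, Y (g • q) = (tangentAction EG G EQ Q).act g q (Y q)) (g : G) (q : Q) :
    lieBr X Y (g • q) = (tangentAction EG G EQ Q).act g q (lieBr X Y q) := by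
  have := FiniteDimensional.complete ℝ EQ
  have : IsManifold 𝓘(ℝ, EQ) (minSmoothness ℝ 2) Q := by
    rw [minSmoothness_of_isRCLikeNormedField]; infer_instance
  have : IsManifold 𝓘(ℝ, EQ) (minSmoothness ℝ 3) Q := by
    rw [minSmoothness_of_isRCLikeNormedField]; infer_instance
  have key : ∀ Z : VField EQ Q, (∀ (g : G) q, Z (g • q) = (tangentAction EG G EQ Q).act g q (Z q)) →
      VectorField.mpullback 𝓘(ℝ, EQ) 𝓘(ℝ, EQ) (fun q : Q ↦ g • q) Z = Z := by
    intro Z hZ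
    funext q
    rw [VectorField.mpullback_apply, hZ g q, tangentAction_act]
    obtain ⟨e, he⟩ := isInvertible_mfderiv_smul EG EQ g q
    rw [← he, ContinuousLinearMap.inverse_equiv]
    exact e.symm_apply_apply _
  have h := VectorField.mpullback_mlieBracket (n := ∞) (x₀ := q) (mdifferentiableAt_vfield X (g • q))
    (mdifferentiableAt_vfield Y (g • q)) (contMDiff_smul_left EG EQ g q)
    (by rw [minSmoothness_of_isRCLikeNormedField]; exact ENat.LEInfty.out)
  rw [key X hX, key Y hY, VectorField.mpullback_apply] at h
  rw [lieBr_apply, lieBr_apply, ← h, tangentAction_act]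
  obtain ⟨e, he⟩ := isInvertible_mfderiv_smul EG EQ g q
  rw [← he, ContinuousLinearMap.inverse_equiv]
  exact (e.apply_symm_apply _).symm

/-- The vector bundle `TQ/G → N`. -/
abbrev AtiyahFiber (b : N) : Type _ := QuotFiber P (tangentAction EG G EQ Q) b

/-- The derivative of the projection `Q → N`, as a map from `T_q Q` to the tangent space at a
given point `b = π(q)`. -/
def projDeriv : ∀ {b : N} (q : P.Fib b),
    TangentSpace 𝓘(ℝ, EQ) q.1 →L[ℝ] TangentSpace 𝓘(ℝ, EN) b
  | _, ⟨q, rfl⟩ => mfderiv 𝓘(ℝ, EQ) 𝓘(ℝ, EN) P.proj q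

theorem mk_projDeriv {b : N} (q : P.Fib b) (v : TangentSpace 𝓘(ℝ, EQ) q.1) :
    (⟨b, projDeriv P q v⟩ : TangentBundle 𝓘(ℝ, EN) N) =
      tangentMap 𝓘(ℝ, EQ) 𝓘(ℝ, EN) P.proj ⟨q.1, v⟩ := by
  obtain ⟨q, rfl⟩ := q
  rfl

/-- The derivative of `Q → N` takes the same value on all the vectors of an orbit of `G`. -/
theorem projDeriv_val {b : N} (X : AtiyahFiber P b) (q q' : P.Fib b) :
    projDeriv P q (X.val q) = projDeriv P q' (X.val q') := by
  obtain ⟨g, hg⟩ := P.exists_smul (q.2.trans q'.2.symm)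
  apply totalSpace_mk_inj (F := EN)
  refine (mk_projDeriv P q _).trans (Eq.trans ?_ (mk_projDeriv P q' _).symm)
  rw [X.val_actTo g q q' hg, BundleAction.mk_actTo]
  have h : P.proj = P.proj ∘ (fun q : Q ↦ g • q) := funext fun q ↦ (P.proj_smul g q).symm
  have h2 := tangentMap_comp (I := 𝓘(ℝ, EQ)) (I' := 𝓘(ℝ, EQ)) (I'' := 𝓘(ℝ, EN))
    (P.proj_smooth.mdifferentiable (by simp)) (mdifferentiable_smul_left EG EQ (Q := Q) g)
  rw [← h] at h2
  exact congrFun h2 ⟨q.1, X.val q⟩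

/-- The anchor of the Atiyah algebroid: the derivative of `Q → N`, evaluated on a representative. -/
def atiyahAnchor (b : N) : AtiyahFiber P b →L[ℝ] TangentSpace 𝓘(ℝ, EN) b :=
  (projDeriv P ((P.sectionAt b).pt b)).comp
    (QuotFiber.evalEquiv P (tangentAction EG G EQ Q) ((P.sectionAt b).pt b)).toContinuousLinearMap

theorem atiyahAnchor_apply {b : N} (X : AtiyahFiber P b) (q : P.Fib b) :
    atiyahAnchor P b X = projDeriv P q (X.val q) := projDeriv_val P X _ q

theorem contMDiff_atiyahAnchor : ContMDiff (𝓘(ℝ, EN).prod 𝓘(ℝ, EQ)) 𝓘(ℝ, EN).tangent ∞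
    (fun X : TotalSpace EQ (AtiyahFiber P) ↦
      (⟨X.1, atiyahAnchor P X.1 X.2⟩ : TangentBundle 𝓘(ℝ, EN) N)) := by
  intro X₀
  let σ := P.sectionAt X₀.1
  have h1 := ((contMDiffAt_quot_iff_section P (tangentAction EG G EQ Q) σ
    (P.mem_sectionAt X₀.1)).1 (contMDiffAt_id (x := X₀))).2
  have h2 := (P.proj_smooth.contMDiff_tangentMap (m := ∞) (by simp)).contMDiffAt.comp X₀ h1
  refine h2.congr_of_eventuallyEq (Filter.Eventually.of_forall fun X ↦ ?_)
  dsimp only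
  rw [atiyahAnchor_apply P X.2 (σ.pt X.1)]
  exact mk_projDeriv P (σ.pt X.1) _

/-- The Lie bracket on the sections of `TQ/G`, which are the invariant vector fields. -/
def atiyahBracket (X Y : Sections (EB := EN) EQ (AtiyahFiber P)) :
    Sections (EB := EN) EQ (AtiyahFiber P) :=
  descendSection P (tangentAction EG G EQ Q) (lieBr (liftSection X) (liftSection Y))
    (lieBr_smul _ _ (liftSection_smul X) (liftSection_smul Y))

theorem lift_atiyahBracket (X Y : Sections (EB := EN) EQ (AtiyahFiber P)) :
    liftSection (atiyahBracket P X Y) = lieBr (liftSection X) (liftSection Y) := rfl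

/-- The Atiyah algebroid `TQ/G → N` of a principal bundle `Q → N`. -/
def atiyahAlgebroid : LieAlgebroid (EB := EN) EQ (AtiyahFiber P) where
  bracket := atiyahBracket P
  anchor := atiyahAnchor P
  anchor_smooth := contMDiff_atiyahAnchor P
  add_left X X' Y := liftSection_injective
    ((tangentAlgebroid EQ Q).add_left (liftSection X) (liftSection X') (liftSection Y))
  smul_left c X Y := liftSection_injective
    ((tangentAlgebroid EQ Q).smul_left c (liftSection X) (liftSection Y))
  skew X Y := liftSection_injective
    ((tangentAlgebroid EQ Q).skew (liftSection X) (liftSection Y))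
  leibniz X Y f b := by
    let f' : Smooth EQ Q := ⟨fun q ↦ f (P.proj q), f.contMDiff.comp P.proj_smooth⟩
    refine QuotFiber.ext fun q ↦ ?_
    obtain ⟨q, rfl⟩ := q
    refine ((tangentAlgebroid EQ Q).leibniz (liftSection X) (liftSection Y) f' q).trans ?_
    rw [atiyahAnchor_apply P _ ⟨q, rfl⟩]
    have h : dirDeriv f' q (liftSection X q) =
        dirDeriv f (P.proj q) (projDeriv P ⟨q, rfl⟩ ((X (P.proj q)).val ⟨q, rfl⟩)) := by
      have := mfderiv_comp q (I := 𝓘(ℝ, EQ)) (I' := 𝓘(ℝ, EN)) (I'' := 𝓘(ℝ, ℝ)) (g := f) (f := P.proj)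
        ((f.contMDiff _).mdifferentiableAt (by simp))
        ((P.proj_smooth q).mdifferentiableAt (by simp))
      exact congrArg (fun L : EQ →L[ℝ] ℝ ↦ L (liftSection X q)) this
    change f' q • (lieBr (liftSection X) (liftSection Y)) q +
      dirDeriv f' q (liftSection X q) • liftSection Y q = _
    rw [h]
    rfl
  jacobi X Y Z := liftSection_injective
    ((tangentAlgebroid EQ Q).jacobi (liftSection X) (liftSection Y) (liftSection Z))

end Atiyah

section Reduction

variable {EG : Type*} [NormedAddCommGroup EG] [NormedSpace ℝ EG]
  {G : Type*} [Group G] [TopologicalSpace G] [ChartedSpace EG G]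
  {EQ : Type*} [NormedAddCommGroup EQ] [NormedSpace ℝ EQ]
  {Q : Type*} [TopologicalSpace Q] [ChartedSpace EQ Q] [MulAction G Q]
  {EN : Type*} [NormedAddCommGroup EN] [NormedSpace ℝ EN]
  {N : Type*} [TopologicalSpace N] [ChartedSpace EN N]
  {F : Type*} [NormedAddCommGroup F] [NormedSpace ℝ F]
  {E : Q → Type*} [∀ x, AddCommGroup (E x)] [∀ x, Module ℝ (E x)]
  [∀ x, TopologicalSpace (E x)]
  [TopologicalSpace (TotalSpace F E)] [FiberBundle F E] [VectorBundle ℝ F E]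
  [∀ x, IsTopologicalAddGroup (E x)] [∀ x, ContinuousSMul ℝ (E x)]
  {FD : Type*} [NormedAddCommGroup FD] [NormedSpace ℝ FD]
  {D : Q → Type*} [∀ x, AddCommGroup (D x)] [∀ x, Module ℝ (D x)]
  [∀ x, TopologicalSpace (D x)]
  [TopologicalSpace (TotalSpace FD D)] [FiberBundle FD D] [VectorBundle ℝ FD D]
  [∀ x, IsTopologicalAddGroup (D x)] [∀ x, ContinuousSMul ℝ (D x)]

/-- Two covectors `β ∈ E*_q` and `β' ∈ E*_{q'}` are in the same orbit of the action of `G` on `E*`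
which is dual to its action on `E`: there is `g` with `q' = g q` and `β'(g v) = β(v)`. -/
def BundleAction.SameDualOrbit (a : BundleAction EG G EQ F E) (β β' : DualTotal F E) : Prop :=
  ∃ (g : G) (h : g • β.1 = β'.1), ∀ v : E β.1, β'.2 (a.actTo g h v) = β.2 v

/-- Invariance of a nonholonomic system under an action of `G`: the bundle metric, the potential
and the subbundle `D` are invariant. -/
structure NonholonomicSystem.IsInvariant (S : NonholonomicSystem EQ F E FD D)
    (a : BundleAction EG G EQ F E) : Prop where
  metric : ∀ (g : G) (q : Q) (v w : E q),
    S.metric.inner (g • q) (a.act g q v) (a.act g q w) = S.metric.inner q v w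
  potential : ∀ (g : G) (q : Q), S.potential (g • q) = S.potential q
  distribution : ∀ (g : G) (q : Q) (d : D q), ∃ d' : D (g • q),
    S.incl (g • q) d' = a.act g q (S.incl q d)

namespace NonholonomicSystem

variable {S : NonholonomicSystem EQ F E FD D} {a : BundleAction EG G EQ F E}

variable (S) in
theorem inclTotal_injective : Function.Injective
    (fun v : TotalSpace FD D ↦ (⟨v.1, S.incl v.1 v.2⟩ : TotalSpace F E)) := by
  rintro ⟨x, v⟩ ⟨y, w⟩ h
  obtain rfl : x = y := congrArg TotalSpace.proj h
  exact congrArg (TotalSpace.mk x) (S.incl_injective x (totalSpace_mk_inj h))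

variable [FiniteDimensional ℝ F] [FiniteDimensional ℝ FD]

theorem IsInvariant.incl_act (h : S.IsInvariant a) (g : G) (q : Q) (d : D q) :
    S.incl (g • q) (S.orthProj (g • q) (a.act g q (S.incl q d))) = a.act g q (S.incl q d) := by
  obtain ⟨d', hd'⟩ := h.distribution g q d
  rw [← hd', S.orthProj_incl]

variable [ContMDiffVectorBundle ∞ F E 𝓘(ℝ, EQ)] [ContMDiffVectorBundle ∞ FD D 𝓘(ℝ, EQ)]

/-- The restriction to the invariant subbundle `D` of the action of `G` on `E`. The orthogonal
projector is only used to read an element of `D`, seen in `E`, as an element of `D`. -/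
def IsInvariant.distAction (h : S.IsInvariant a) : BundleAction EG G EQ FD D where
  act g q := (S.orthProj (g • q)).comp ((a.act g q).comp (S.incl q))
  act_one q d := by
    apply S.inclTotal_injective
    refine Eq.trans ?_ (a.act_one q (S.incl q d))
    exact congrArg (TotalSpace.mk _) (h.incl_act 1 q d)
  act_mul g g' q d := by
    apply S.inclTotal_injective
    refine Eq.trans (congrArg (TotalSpace.mk _) (h.incl_act (g * g') q d)) ?_
    refine (a.act_mul g g' q (S.incl q d)).trans ?_
    refine congrArg (TotalSpace.mk _) ((congrArg (a.act g (g' • q)) (h.incl_act g' q d)).symm.trans ?_)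
    exact (h.incl_act g (g' • q) _).symm
  smooth p₀ := by
    refine contMDiffAt_of_injective (F₂ := F) (E₂ := E) (i := S.incl) S.incl_injective
      S.incl_smooth ?_
    refine ((a.smooth.comp (contMDiff_fst.prodMk (S.incl_smooth.comp contMDiff_snd)))
      p₀).congr_of_eventuallyEq (Filter.Eventually.of_forall fun p ↦ ?_)
    exact congrArg (TotalSpace.mk _) (h.incl_act p.1 p.2.1 p.2.2)

theorem IsInvariant.incl_distAction (h : S.IsInvariant a) (g : G) (q : Q) (d : D q) :
    S.incl (g • q) (h.distAction.act g q d) = a.act g q (S.incl q d) := h.incl_act g q d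

theorem IsInvariant.metric_val (h : S.IsInvariant a) {P : PrincipalBundle EG G EQ Q EN N} {b : N}
    (X Y : QuotFiber P a b) (q q' : P.Fib b) :
    S.metric.inner q.1 (X.val q) (Y.val q) = S.metric.inner q'.1 (X.val q') (Y.val q') := by
  obtain ⟨g, hg⟩ := P.exists_smul (q.2.trans q'.2.symm)
  obtain rfl : q.act g = q' := Subtype.ext hg
  rw [X.val_actTo g q (q.act g) rfl, Y.val_actTo g q (q.act g) rfl]
  exact (h.metric g q.1 _ _).symm

theorem IsInvariant.potential_eq (h : S.IsInvariant a) (P : PrincipalBundle EG G EQ Q EN N)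
    {q q' : Q} (hq : P.proj q = P.proj q') : S.potential q = S.potential q' := by
  obtain ⟨g, rfl⟩ := P.exists_smul hq
  exact (h.potential g q).symm

variable [LieGroup 𝓘(ℝ, EG) ∞ G] (h : S.IsInvariant a) (P : PrincipalBundle EG G EQ Q EN N)

/-- The bundle metric on `E/G`, at `b`, evaluated through the representatives at a point over
`b`. -/
def reducedInner (S : NonholonomicSystem EQ F E FD D) (a : BundleAction EG G EQ F E)
    (P : PrincipalBundle EG G EQ Q EN N) (b : N) :
    QuotFiber P a b →L[ℝ] QuotFiber P a b →L[ℝ] ℝ :=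
  let ev := (QuotFiber.evalEquiv P a ((P.sectionAt b).pt b)).toContinuousLinearMap
  (ContinuousLinearMap.precomp ℝ ev).comp ((S.metric.inner ((P.sectionAt b).sec b)).comp ev)

theorem IsInvariant.reducedInner_apply (h : S.IsInvariant a) {b : N} (X Y : QuotFiber P a b)
    (q : P.Fib b) : reducedInner S a P b X Y = S.metric.inner q.1 (X.val q) (Y.val q) :=
  h.metric_val X Y ((P.sectionAt b).pt b) q

/-- The bundle metric on `E/G` induced by an invariant bundle metric on `E`. -/
def IsInvariant.reducedMetric : ContMDiffRiemannianMetric 𝓘(ℝ, EN) ∞ F (QuotFiber P a) where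
  inner := reducedInner S a P
  symm b X Y := S.metric.symm _ _ _
  pos b X hX := S.metric.pos _ _ fun h0 ↦ hX
    ((QuotFiber.evalEquiv P a ((P.sectionAt b).pt b)).injective (h0.trans (map_zero _).symm))
  isVonNBounded b := by
    let ev := QuotFiber.evalEquiv P a ((P.sectionAt b).pt b)
    refine ((S.metric.isVonNBounded ((P.sectionAt b).sec b)).image
      (ev.symm : E ((P.sectionAt b).sec b) →L[ℝ] QuotFiber P a b)).subset fun X hX ↦ ?_
    exact ⟨ev X, hX, ev.symm_apply_apply X⟩
  contMDiff b₀ := by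
    let σ := P.sectionAt b₀
    have hσ : b₀ ∈ σ.baseSet := P.mem_sectionAt b₀
    have hs : ContMDiffAt 𝓘(ℝ, EN) 𝓘(ℝ, EQ) ∞ σ.sec b₀ :=
      σ.smooth.contMDiffAt (σ.isOpen_baseSet.mem_nhds hσ)
    have hv : ∀ v : F, ContMDiffAt 𝓘(ℝ, EN) (𝓘(ℝ, EQ).prod 𝓘(ℝ, F)) ∞ (fun b ↦
        (⟨σ.sec b, ((trivializationAt F (QuotFiber P a) b₀).symm b v).val (σ.pt b)⟩ :
          TotalSpace F E)) b₀ := fun v ↦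
      (contMDiffAt_quot_iff P a (u := σ.sec) σ.proj_sec hs).1
        (contMDiffAt_symm_const contMDiffAt_id _
          (mem_baseSet_trivializationAt F (QuotFiber P a) b₀) v)
    refine contMDiffAt_hom_of_apply (E₂ := fun b ↦ QuotFiber P a b →L[ℝ] ℝ) (b := id)
      contMDiffAt_id fun v ↦ ?_
    refine contMDiffAt_dual_of_apply (b := id) contMDiffAt_id fun w ↦ ?_
    refine (contMDiffAt_dual_apply (E₁ := E) (b := σ.sec) (ContMDiffAt.clm_bundle_apply (E₁ := E)
      (E₂ := fun x ↦ E x →L[ℝ] ℝ) (ϕ := fun b ↦ S.metric.inner (σ.sec b))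
      (S.metric.contMDiff.contMDiffAt.comp b₀ hs) (hv v)) (hv w)).congr_of_eventuallyEq
      (Filter.Eventually.of_forall fun b ↦ ?_)
    exact h.reducedInner_apply P _ _ (σ.pt b)

/-- The potential on `N` induced by an invariant potential on `Q`. -/
def IsInvariant.reducedPotential : Smooth EN N :=
  ⟨fun b ↦ S.potential ((P.sectionAt b).sec b), fun b₀ ↦ by
    let σ := P.sectionAt b₀
    have hs : ContMDiffAt 𝓘(ℝ, EN) 𝓘(ℝ, EQ) ∞ σ.sec b₀ :=
      σ.smooth.contMDiffAt (σ.isOpen_baseSet.mem_nhds (P.mem_sectionAt b₀))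
    refine (S.potential.contMDiff.contMDiffAt.comp b₀ hs).congr_of_eventuallyEq
      (Filter.Eventually.of_forall fun b ↦ ?_)
    exact h.potential_eq P (((P.sectionAt b).proj_sec b).trans (σ.proj_sec b).symm)⟩

theorem IsInvariant.reducedPotential_proj (q : Q) :
    h.reducedPotential P (P.proj q) = S.potential q :=
  h.potential_eq P ((P.sectionAt _).proj_sec _)

/-- The inclusion of `D/G` in `E/G`. -/
def IsInvariant.reducedIncl (b : N) : QuotFiber P h.distAction b →L[ℝ] QuotFiber P a b where
  toFun X := ⟨fun q ↦ S.incl q.1 (X.val q), fun g q ↦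
    (congrArg (S.incl (g • q.1)) (X.val_actTo g q (q.act g) rfl)).trans
      (h.incl_distAction g q.1 (X.val q))⟩
  map_add' X Y := QuotFiber.ext fun q ↦ map_add (S.incl q.1) (X.val q) (Y.val q)
  map_smul' c X := QuotFiber.ext fun q ↦ map_smul (S.incl q.1) c (X.val q)
  cont := Continuous.subtype_mk (continuous_pi fun q ↦
    (S.incl q.1).continuous.comp (QuotFiber.evalEquiv P h.distAction q).continuous) _

theorem IsInvariant.reducedIncl_val {b : N} (X : QuotFiber P h.distAction b) (q : P.Fib b) :
    (h.reducedIncl P b X).val q = S.incl q.1 (X.val q) := rfl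

/-- The reduction by `G` of an invariant nonholonomic system `(L, D)` on `E`: the nonholonomic
system on `E/G` with the induced bundle metric and potential, and the subbundle `D/G`. -/
def IsInvariant.reduced :
    NonholonomicSystem EN F (QuotFiber P a) FD (QuotFiber P h.distAction) where
  metric := h.reducedMetric P
  potential := h.reducedPotential P
  incl := h.reducedIncl P
  incl_injective b X Y hXY := QuotFiber.ext fun q ↦ S.incl_injective q.1
    (congrArg (fun Z : QuotFiber P a b ↦ Z.val q) hXY)
  incl_smooth X₀ := by
    let σ := P.sectionAt X₀.1
    have hσ : X₀.1 ∈ σ.baseSet := P.mem_sectionAt _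
    have h1 := (contMDiffAt_quot_iff_section P h.distAction σ hσ).1 (contMDiffAt_id (x := X₀))
    refine (contMDiffAt_quot_iff_section P a σ hσ).2 ⟨h1.1, ?_⟩
    exact S.incl_smooth.contMDiffAt.comp X₀ h1.2

end NonholonomicSystem

end Reduction

end NH

end

/-! A bracket on `C^∞(E*)` which is a derivation in each argument is determined at a point by the
differentials of its two arguments there: a point derivation kills every function whose differential
vanishes, by Hadamard's lemma and cut-offs (`pointDerivation_eq_zero`). Every covector of the
manifold `E*` at a point is the differential of some `X̂ + f ∘ τ`, with `X` a section of `E` and `f`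
a function on the base (`exists_local_generators`). So a bracket induced by an algebroid is known as
soon as it is known on these functions, where the three defining relations give it. This is
uniqueness.

Existence rests on the same two facts. The relations prescribe a bilinear form `affineBracket` on
pairs `(X, f)` at each `α ∈ E*`, and the point is that it descends to differentials
(`affineBracket_eq_zero`). If `X̂ + f ∘ τ` has zero differential at `α`, over `x`, then `X` vanishes
at `x`, so near `x` it is a sum `∑ Cᵢ Yᵢ` with `Cᵢ(x) = 0`. The Leibniz rule turns the form against
`(Z, h)` into the derivative along `ρ(Z)`, at `x`, of `∑ α(Yᵢ) Cᵢ + f`, a function whose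
differential at `x` is zero by hypothesis. The resulting bracket is smooth because nearby
differentials are combinations of finitely many generators with smooth coefficients.

For the reduction, the structure of the Atiyah algebroid is read on invariant lifts: its bracket is
the Lie bracket of the lifted vector fields, its anchor is the derivative of `Q → N` on a
representative. The two forms `affineBracket` therefore correspond under lifting, and `T*Q →
(TQ/G)*` is a Poisson morphism. Invariance of the metric and of `D` makes the inclusion `i` and the
orthogonal projector commute with passing to the quotient. Dually, `i*` and `P*` commute with the
projections `E* → (E/G)*` and `D* → (D/G)*`. The nonholonomic bracket is made of the bracket of
`E*`, `i*` and `P*`, so it inherits the morphism property. Surjectivity of `D* → (D/G)*` leaves at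
most one bracket on the target with this property. -/

noncomputable section

set_option linter.unusedSectionVars false

namespace NH

/-! ### Hadamard's lemma with smooth dependence on the point. -/

section Hadamard

universe u

variable {W V : Type u} [NormedAddCommGroup W] [NormedSpace ℝ W] [FiniteDimensional ℝ W]
  [NormedAddCommGroup V] [NormedSpace ℝ V] [CompleteSpace V]

/-- Differentiation under the integral sign. A constant is enough as dominating function: the
partial derivative is continuous, hence bounded on the compact product of a closed ball and `[0,
1]`. -/
theorem hasFDerivAt_parametric_integral {g : W × ℝ → V} (hg : ContDiff ℝ ∞ g) (y : W) :
    HasFDerivAt (fun y ↦ ∫ t in (0 : ℝ)..1, g (y, t))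
      (∫ t in (0 : ℝ)..1, (fderiv ℝ g (y, t)).comp (ContinuousLinearMap.inl ℝ W ℝ)) y := by
  have hc : Continuous g := hg.continuous
  have hd : Continuous fun p : W × ℝ ↦ (fderiv ℝ g p).comp (ContinuousLinearMap.inl ℝ W ℝ) :=
    (hg.continuous_fderiv (by simp)).clm_comp continuous_const
  obtain ⟨C, hC⟩ := ((isCompact_closedBall y 1).prod
    (isCompact_Icc (a := (0 : ℝ)) (b := 1))).exists_bound_of_continuousOn hd.continuousOn
  refine intervalIntegral.hasFDerivAt_integral_of_dominated_of_fderiv_le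
    (F' := fun y t ↦ (fderiv ℝ g (y, t)).comp (ContinuousLinearMap.inl ℝ W ℝ))
    (bound := fun _ ↦ C) (Metric.closedBall_mem_nhds y one_pos) ?_ ?_ ?_ ?_ ?_ ?_
  · exact Eventually.of_forall fun x ↦
      (hc.comp (Continuous.prodMk_right x)).aestronglyMeasurable
  · exact (hc.comp (Continuous.prodMk_right y)).intervalIntegrable _ _
  · exact (hd.comp (Continuous.prodMk_right y)).aestronglyMeasurable
  · refine Eventually.of_forall fun t ht x hx ↦ hC (x, t) ⟨hx, ?_⟩
    rw [uIoc_of_le zero_le_one] at ht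
    exact ⟨ht.1.le, ht.2⟩
  · exact intervalIntegrable_const
  · refine Eventually.of_forall fun t _ x _ ↦ ?_
    exact ((hg.differentiable (by simp) (x, t)).hasFDerivAt).comp x
      (hasFDerivAt_prodMk_left x t)

/-- The derivative of such an integral is again one, with values in `W →L[ℝ] V`, which gives an
induction on the order of differentiability. Since `V` changes to `W →L[ℝ] V` along the induction,
`W` and `V` are taken in the same universe. -/
theorem contDiff_parametric_integral {g : W × ℝ → V} (hg : ContDiff ℝ ∞ g) :
    ContDiff ℝ ∞ fun y ↦ ∫ t in (0 : ℝ)..1, g (y, t) := by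
  refine contDiff_infty.2 fun n ↦ ?_
  induction n generalizing V with
  | zero =>
    exact contDiff_zero.2 (continuous_iff_continuousAt.2 fun y ↦
      (hasFDerivAt_parametric_integral hg y).continuousAt)
  | succ n ih =>
    refine contDiff_succ_iff_hasFDerivAt.2 ⟨fun y ↦
      ∫ t in (0 : ℝ)..1, (fderiv ℝ g (y, t)).comp (ContinuousLinearMap.inl ℝ W ℝ), ?_,
      hasFDerivAt_parametric_integral hg⟩
    exact ih (g := fun p ↦ (fderiv ℝ g p).comp (ContinuousLinearMap.inl ℝ W ℝ))
      ((hg.fderiv_right (m := ∞) (by simp)).clm_comp contDiff_const)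

/-- Hadamard's lemma. -/
theorem exists_hadamard {h : W → ℝ} (hh : ContDiff ℝ ∞ h) (y₀ : W) :
    ∃ G : W → W →L[ℝ] ℝ, ContDiff ℝ ∞ G ∧ G y₀ = fderiv ℝ h y₀ ∧
      ∀ y, h y = h y₀ + G y (y - y₀) := by
  have hp : ContDiff ℝ ∞ fun p : W × ℝ ↦ fderiv ℝ h (y₀ + p.2 • (p.1 - y₀)) :=
    (hh.fderiv_right (m := ∞) (by simp)).comp (by fun_prop)
  -- `G y` is the average of the derivative of `h` along the segment from `y₀` to `y`. The integrand
  -- is constant for `y = y₀`, and the fundamental theorem of calculus gives the increment of `h`.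
  refine ⟨fun y ↦ ∫ t in (0 : ℝ)..1, fderiv ℝ h (y₀ + t • (y - y₀)),
    contDiff_parametric_integral hp, by simp, fun y ↦ ?_⟩
  have hcont : Continuous fun t : ℝ ↦ fderiv ℝ h (y₀ + t • (y - y₀)) :=
    hp.continuous.comp (Continuous.prodMk_right y)
  have hderiv : ∀ t ∈ uIcc (0 : ℝ) 1, HasDerivAt (fun t : ℝ ↦ h (y₀ + t • (y - y₀)))
      (fderiv ℝ h (y₀ + t • (y - y₀)) (y - y₀)) t := fun t _ ↦ by
    refine (hh.differentiable (by simp) _).hasFDerivAt.comp_hasDerivAt t ?_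
    simpa using ((hasDerivAt_id t).smul_const (y - y₀)).const_add y₀
  rw [ContinuousLinearMap.intervalIntegral_apply (hcont.intervalIntegrable _ _),
    intervalIntegral.integral_eq_sub_of_hasDerivAt hderiv
      ((hcont.clm_apply continuous_const).intervalIntegrable _ _)]
  simp

end Hadamard

/-! ### Cut-off functions, which make local objects global. -/

section Bump

variable {W : Type*} [NormedAddCommGroup W] [NormedSpace ℝ W] [FiniteDimensional ℝ W]
  {H : Type*} [TopologicalSpace H] {I : ModelWithCorners ℝ W H}
  {M : Type*} [TopologicalSpace M] [T2Space M] [ChartedSpace H M] [IsManifold I ∞ M]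

variable (I) in
theorem exists_bump {m : M} {U : Set M} (hU : U ∈ 𝓝 m) :
    ∃ χ : C^∞⟮I, M; 𝓘(ℝ), ℝ⟯, χ =ᶠ[𝓝 m] 1 ∧ tsupport χ ⊆ U := by
  obtain ⟨f, -, hf⟩ := (SmoothBumpFunction.nhds_basis_tsupport (I := I) m).mem_iff.1 hU
  exact ⟨⟨f, f.contMDiff⟩, f.eventuallyEq_one, hf⟩

variable (I) in
/-- A function which is smooth near a point agrees near this point with a smooth function. -/
theorem exists_smooth_eventuallyEq {V : Type*} [NormedAddCommGroup V] [NormedSpace ℝ V]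
    {m : M} {U : Set M} (hU : U ∈ 𝓝 m) {g : M → V} (hg : ∀ x ∈ U, ContMDiffAt I 𝓘(ℝ, V) ∞ g x) :
    ∃ g' : C^∞⟮I, M; 𝓘(ℝ, V), V⟯, g' =ᶠ[𝓝 m] g := by
  obtain ⟨χ, h1, h2⟩ := exists_bump I hU
  refine ⟨⟨fun x ↦ χ x • g x, contMDiff_of_tsupport fun x hx ↦ ?_⟩, ?_⟩
  · exact χ.contMDiff.contMDiffAt.smul (hg x (h2 (tsupport_smul_subset_left _ _ hx)))
  · filter_upwards [h1] with x hx
    change χ x • g x = g x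
    rw [hx]
    simp

end Bump

/-! ### Point derivations see only the differential. -/

section PointDerivation

universe u

variable {W : Type u} [NormedAddCommGroup W] [NormedSpace ℝ W]
  {H : Type*} [TopologicalSpace H] {I : ModelWithCorners ℝ W H} [I.Boundaryless]
  {M : Type*} [TopologicalSpace M] [ChartedSpace H M] [IsManifold I ∞ M]

theorem contDiffAt_comp_extChartAt_symm (f : C^∞⟮I, M; 𝓘(ℝ), ℝ⟯) (m : M) {y : W}
    (hy : y ∈ (extChartAt I m).target) : ContDiffAt ℝ ∞ (f ∘ (extChartAt I m).symm) y := by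
  rw [← contMDiffAt_iff_contDiffAt]
  exact f.contMDiff.contMDiffAt.comp y ((contMDiffOn_extChartAt_symm m).contMDiffAt
    ((isOpen_extChartAt_target m).mem_nhds hy))

/-- The chart stays the one at `m₀` while `m` moves in its domain, so that the first factor depends
smoothly on `m`. This is what gives smooth coefficients in `exists_differential_eq_sum`. -/
theorem mfderiv_eq_fderiv_comp_extChartAt (f : C^∞⟮I, M; 𝓘(ℝ), ℝ⟯) {m₀ m : M}
    (hm : m ∈ (extChartAt I m₀).source) :
    mfderiv I 𝓘(ℝ) f m = (fderiv ℝ (f ∘ (extChartAt I m₀).symm) (extChartAt I m₀ m)).comp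
      (mfderiv I 𝓘(ℝ, W) (extChartAt I m₀) m) := by
  have h1 : f =ᶠ[𝓝 m] (f ∘ (extChartAt I m₀).symm) ∘ extChartAt I m₀ := by
    filter_upwards [(isOpen_extChartAt_source m₀).mem_nhds hm] with x hx
    exact congrArg f ((extChartAt I m₀).left_inv hx).symm
  rw [h1.mfderiv_eq, mfderiv_comp (I' := 𝓘(ℝ, W)) m, mfderiv_eq_fderiv]
  · rfl
  · exact (contDiffAt_comp_extChartAt_symm f m₀
      ((extChartAt I m₀).map_source hm)).differentiableAt (by simp) |>.mdifferentiableAt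
  · exact (contMDiffAt_extChartAt' (by simpa using hm) :
      ContMDiffAt I 𝓘(ℝ, W) ∞ _ m).mdifferentiableAt (by simp)

variable [FiniteDimensional ℝ W] [T2Space M]

/-- Near a point, a smooth function is the sum of its value and of products of two smooth functions,
one of which takes the value of a partial derivative at the point while the other one vanishes
there. -/
theorem exists_eventuallyEq_sum_mul (f : C^∞⟮I, M; 𝓘(ℝ), ℝ⟯) (m : M) :
    ∃ (n : ℕ) (w : Fin n → W) (a b : Fin n → C^∞⟮I, M; 𝓘(ℝ), ℝ⟯),
      (∀ k, a k m = fderiv ℝ (f ∘ (extChartAt I m).symm) (extChartAt I m m) (w k)) ∧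
      (∀ k, b k m = 0) ∧ ∀ᶠ x in 𝓝 m, f x = f m + ∑ k, a k x * b k x := by
  set Ψ := extChartAt I m
  have hΨ : Ψ.target ∈ 𝓝 (Ψ m) := extChartAt_target_mem_nhds m
  -- Hadamard's lemma is about functions on the whole model space, whereas `f` read in the chart is
  -- only smooth on its target. It is replaced by a smooth `h` with the same germ.
  obtain ⟨h, hh⟩ := exists_smooth_eventuallyEq 𝓘(ℝ, W) hΨ (g := f ∘ Ψ.symm) fun y hy ↦
    (contDiffAt_comp_extChartAt_symm f m hy).contMDiffAt
  obtain ⟨G, hG, hG0, hGy⟩ := exists_hadamard h.contMDiff.contDiff (Ψ m)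
  let β := Module.finBasis ℝ W
  have hsrc : Ψ.source ∈ 𝓝 m := extChartAt_source_mem_nhds m
  have hsm : ∀ x ∈ Ψ.source, ContMDiffAt I 𝓘(ℝ, W) ∞ Ψ x := fun x hx ↦
    contMDiffAt_extChartAt' (by simpa [Ψ] using hx)
  -- The factors are the components of `G ∘ Ψ` and the coordinates centred at `m`. Both live on the
  -- chart domain only and are replaced by global functions with the same germs at `m`.
  have ha : ∀ k, ∃ a : C^∞⟮I, M; 𝓘(ℝ), ℝ⟯, a =ᶠ[𝓝 m] fun x ↦ G (Ψ x) (β k) := fun k ↦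
    exists_smooth_eventuallyEq I hsrc fun x hx ↦
      ((hG.clm_apply contDiff_const).contMDiff).contMDiffAt.comp x (hsm x hx)
  have hb : ∀ k, ∃ b : C^∞⟮I, M; 𝓘(ℝ), ℝ⟯, b =ᶠ[𝓝 m] fun x ↦
      LinearMap.toContinuousLinearMap (β.coord k) (Ψ x - Ψ m) := fun k ↦
    exists_smooth_eventuallyEq I hsrc fun x hx ↦
      (ContinuousLinearMap.contMDiff _).contMDiffAt.comp x ((hsm x hx).sub contMDiffAt_const)
  choose a ha using ha
  choose b hb using hb
  refine ⟨_, β, a, b, fun k ↦ ?_, fun k ↦ ?_, ?_⟩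
  · rw [(ha k).self_of_nhds, ← hh.fderiv_eq, ← hG0]
  · rw [(hb k).self_of_nhds]
    simp
  · have hh' : ∀ᶠ x in 𝓝 m, h (Ψ x) = (f ∘ Ψ.symm) (Ψ x) :=
      (continuousAt_extChartAt m).eventually hh
    filter_upwards [eventually_all.2 ha, eventually_all.2 hb, hh', hsrc] with x h1 h2 h3 h4
    have h5 : f x = h (Ψ x) := h3.symm ▸ (congrArg f (Ψ.left_inv h4)).symm
    have h6 : f m = h (Ψ m) :=
      hh.self_of_nhds.symm ▸ (congrArg f (Ψ.left_inv (mem_extChartAt_source m))).symm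
    rw [h5, h6, hGy]
    congr 1
    conv_lhs => rw [← β.sum_repr (Ψ x - Ψ m), map_sum]
    refine Finset.sum_congr rfl fun k _ ↦ ?_
    rw [h1, h2]
    simp [mul_comm]

/-- A point derivation of the algebra of smooth functions depends only on the differential. -/
theorem pointDerivation_eq_zero {m : M} (δ : C^∞⟮I, M; 𝓘(ℝ), ℝ⟯ →ₗ[ℝ] ℝ)
    (hδ : ∀ f g, δ (f * g) = f m * δ g + g m * δ f) {f : C^∞⟮I, M; 𝓘(ℝ), ℝ⟯}
    (hf : mfderiv I 𝓘(ℝ) f m = 0) : δ f = 0 := by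
  have hone : δ 1 = 0 := by
    have h := hδ 1 1
    rw [mul_one] at h
    have h1 : (1 : C^∞⟮I, M; 𝓘(ℝ), ℝ⟯) m = 1 := rfl
    rw [h1] at h
    linarith
  -- Locality: a cut-off `χ` supported where `g` vanishes and equal to `1` at `m` has `χ * g = 0`,
  -- and the Leibniz rule at `m` reduces to `0 = δ g`.
  have hloc : ∀ g : C^∞⟮I, M; 𝓘(ℝ), ℝ⟯, g =ᶠ[𝓝 m] 0 → δ g = 0 := by
    intro g hg
    obtain ⟨χ, h1, h2⟩ := exists_bump I hg
    have h3 : χ * g = 0 := by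
      ext x
      by_cases hx : x ∈ tsupport χ
      · have h4 : g x = 0 := h2 hx
        exact mul_eq_zero_of_right _ h4
      · exact mul_eq_zero_of_left (image_eq_zero_of_notMem_tsupport hx) _
    have h5 := hδ χ g
    rw [h3, map_zero, hg.self_of_nhds, h1.self_of_nhds] at h5
    simpa using h5.symm
  obtain ⟨n, w, a, b, ha, hb, hab⟩ := exists_eventuallyEq_sum_mul f m
  -- By definition the differential is the derivative in the preferred chart at `m`, within the
  -- range of the model. That range is everything, since there is no boundary.
  have hd : fderiv ℝ (f ∘ (extChartAt I m).symm) (extChartAt I m m) = 0 := by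
    have h2 := ((f.contMDiff m).mdifferentiableAt (by simp)).mfderiv.symm.trans hf
    rw [I.range_eq_univ, fderivWithin_univ] at h2
    exact h2
  -- Up to a function vanishing near `m`, `f` is a constant plus products `a k * b k`. Both factors
  -- vanish at `m`, the `a k` because the derivative of `f` does, so `δ` kills every product.
  have h1 := hloc (f - (f m • 1 + ∑ k, a k * b k)) (by
    filter_upwards [hab] with x hx
    have h2 : (∑ k, a k * b k : C^∞⟮I, M; 𝓘(ℝ), ℝ⟯) x = ∑ k, a k x * b k x := by
      rw [← ContMDiffMap.coeFnAddMonoidHom_apply, map_sum, Finset.sum_apply]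
      rfl
    change f x - (f m * 1 + (∑ k, a k * b k : C^∞⟮I, M; 𝓘(ℝ), ℝ⟯) x) = 0
    rw [h2, hx]
    ring)
  rw [map_sub, map_add, map_smul, hone, map_sum, sub_eq_zero] at h1
  rw [h1]
  simp only [hδ, ha, hb, hd]
  simp

end PointDerivation

/-! ### Total spaces are Hausdorff. -/

section TotalSpace

/-- Points over different base points are separated in the base, points over the same one in a
common trivialization. This provides the cut-off functions on `E*` needed to apply
`pointDerivation_eq_zero` there. -/
theorem t2Space_totalSpace {B : Type*} [TopologicalSpace B] [T2Space B]
    (F : Type*) [TopologicalSpace F] [T2Space F] (E : B → Type*)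
    [∀ x, TopologicalSpace (E x)] [TopologicalSpace (TotalSpace F E)] [FiberBundle F E] :
    T2Space (TotalSpace F E) := by
  refine ⟨fun p q hpq ↦ ?_⟩
  have hπ := FiberBundle.continuous_proj F E
  by_cases h : p.1 = q.1
  · let e := trivializationAt F E p.1
    have hp : p ∈ e.source := e.mem_source.2 (mem_baseSet_trivializationAt F E p.1)
    have hq : q ∈ e.source := e.mem_source.2 (h ▸ mem_baseSet_trivializationAt F E p.1)
    obtain ⟨u, v, hu, hv, hpu, hqv, huv⟩ := t2_separation (e.injOn.ne hp hq hpq)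
    exact ⟨e.source ∩ e ⁻¹' u, e.source ∩ e ⁻¹' v,
      e.continuousOn.isOpen_inter_preimage e.open_source hu,
      e.continuousOn.isOpen_inter_preimage e.open_source hv, ⟨hp, hpu⟩, ⟨hq, hqv⟩,
      (huv.preimage e).mono inter_subset_right inter_subset_right⟩
  · obtain ⟨u, v, hu, hv, hpu, hqv, huv⟩ := t2_separation h
    exact ⟨_, _, hu.preimage hπ, hv.preimage hπ, hpu, hqv, huv.preimage _⟩

end TotalSpace

/-! ### Differentials as covectors on the model space, and local coframes. -/

section Differential

variable {W : Type*} [NormedAddCommGroup W] [NormedSpace ℝ W]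
  {H : Type*} [TopologicalSpace H] {I : ModelWithCorners ℝ W H}
  {M : Type*} [TopologicalSpace M] [ChartedSpace H M]

/-- The differential at `m` of a smooth function, as a linear form on the model space. -/
def differential (m : M) : C^∞⟮I, M; 𝓘(ℝ), ℝ⟯ →ₗ[ℝ] (W →L[ℝ] ℝ) where
  toFun f := mfderiv I 𝓘(ℝ) f m
  map_add' f g := (((f.contMDiff m).mdifferentiableAt (by simp)).hasMFDerivAt.add
    ((g.contMDiff m).mdifferentiableAt (by simp)).hasMFDerivAt).mfderiv
  map_smul' c f := (((f.contMDiff m).mdifferentiableAt (by simp)).hasMFDerivAt.const_smul c).mfderiv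

theorem differential_apply (m : M) (f : C^∞⟮I, M; 𝓘(ℝ), ℝ⟯) :
    differential m f = mfderiv I 𝓘(ℝ) f m := rfl

theorem differential_mul (m : M) (f g : C^∞⟮I, M; 𝓘(ℝ), ℝ⟯) :
    differential m (f * g) = f m • differential m g + g m • differential m f :=
  (((f.contMDiff m).mdifferentiableAt (by simp)).hasMFDerivAt.mul
    ((g.contMDiff m).mdifferentiableAt (by simp)).hasMFDerivAt).mfderiv

theorem differential_congr {m : M} {f g : C^∞⟮I, M; 𝓘(ℝ), ℝ⟯} (h : f =ᶠ[𝓝 m] g) :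
    differential m f = differential m g := h.mfderiv_eq

/-- The chain rule for the composition of a smooth function and a map which is differentiable
at `m`. -/
theorem differential_comp_eq_of_eq {W' : Type*} [NormedAddCommGroup W'] [NormedSpace ℝ W']
    {H' : Type*} [TopologicalSpace H'] {I' : ModelWithCorners ℝ W' H'}
    {M' : Type*} [TopologicalSpace M'] [ChartedSpace H' M'] {Φ : M → M'} {m : M}
    (hΦ : MDifferentiableAt I I' Φ m) {f g : C^∞⟮I', M'; 𝓘(ℝ), ℝ⟯}
    (h : differential (Φ m) f = differential (Φ m) g) :
    mfderiv I 𝓘(ℝ) (fun x ↦ f (Φ x)) m = mfderiv I 𝓘(ℝ) (fun x ↦ g (Φ x)) m := by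
  have h1 := mfderiv_comp m (I'' := 𝓘(ℝ)) ((f.contMDiff (Φ m)).mdifferentiableAt (by simp)) hΦ
  have h2 := mfderiv_comp m (I'' := 𝓘(ℝ)) ((g.contMDiff (Φ m)).mdifferentiableAt (by simp)) hΦ
  refine h1.trans (Eq.trans ?_ h2.symm)
  exact congrArg (fun L : W' →L[ℝ] ℝ ↦ L.comp (mfderiv I I' Φ m : W →L[ℝ] W')) h

theorem coe_sum_contMDiffMap {ι : Type*} (s : Finset ι) (f : ι → C^∞⟮I, M; 𝓘(ℝ), ℝ⟯) (m : M) :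
    (∑ i ∈ s, f i) m = ∑ i ∈ s, f i m := by
  rw [← ContMDiffMap.coeFnAddMonoidHom_apply, map_sum, Finset.sum_apply]
  rfl

/-- Functions which agree near `m₀` with the coordinates of a chart have, near `m₀`, differentials
which span the cotangent spaces, with smooth coefficients. -/
theorem exists_differential_eq_sum [FiniteDimensional ℝ W] [I.Boundaryless] [IsManifold I ∞ M]
    {ι : Type*} [Fintype ι] (β : Module.Basis ι ℝ W) {m₀ : M} {y : ι → C^∞⟮I, M; 𝓘(ℝ), ℝ⟯}
    (hy : ∀ i, y i =ᶠ[𝓝 m₀] fun m ↦ β.repr (extChartAt I m₀ m) i) (f : C^∞⟮I, M; 𝓘(ℝ), ℝ⟯) :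
    ∃ g : ι → M → ℝ, (∀ i, ContMDiffAt I 𝓘(ℝ) ∞ (g i) m₀) ∧
      ∀ᶠ m in 𝓝 m₀, differential m f = ∑ i, g i m • differential m (y i) := by
  set Ψ := extChartAt I m₀
  -- The coefficients are the partial derivatives of `f` in the fixed chart at `m₀`.
  refine ⟨fun i m ↦ fderiv ℝ (f ∘ Ψ.symm) (Ψ m) (β i), fun i ↦ ?_, ?_⟩
  · have h1 : ContDiffAt ℝ ∞ (fun z ↦ fderiv ℝ (f ∘ Ψ.symm) z (β i)) (Ψ m₀) :=
      ((contDiffAt_comp_extChartAt_symm f m₀ (mem_extChartAt_target m₀)).fderiv_right (m := ∞)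
        (by simp)).clm_apply contDiffAt_const
    exact h1.contMDiffAt.comp m₀ contMDiffAt_extChartAt
  -- Differentials at `m` are compared, so `y i` must agree with the coordinate on a neighbourhood
  -- of each `m` close to `m₀`, not just at `m`. Hence `eventuallyEq_nhds`.
  · filter_upwards [eventually_all.2 fun i ↦ (hy i).eventuallyEq_nhds,
      extChartAt_source_mem_nhds (I := I) m₀] with m h1 h2
    let T : W →L[ℝ] W := mfderiv I 𝓘(ℝ, W) Ψ m
    have hT : MDifferentiableAt I 𝓘(ℝ, W) Ψ m :=
      (contMDiffAt_extChartAt' (by simpa using h2) :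
        ContMDiffAt I 𝓘(ℝ, W) ∞ _ m).mdifferentiableAt (by simp)
    -- Both `differential m (y i)` and `differential m f` factor through the derivative `T` of the
    -- chart, so the expansion takes place on the model space and the invertibility of `T` is not
    -- needed.
    have h3 : ∀ i, differential m (y i) = (LinearMap.toContinuousLinearMap (β.coord i)).comp T := by
      intro i
      refine (h1 i).mfderiv_eq.trans ?_
      exact ((LinearMap.toContinuousLinearMap (β.coord i)).hasMFDerivAt.comp m
        hT.hasMFDerivAt).mfderiv
    have h4 : differential m f = (fderiv ℝ (f ∘ Ψ.symm) (Ψ m)).comp T :=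
      mfderiv_eq_fderiv_comp_extChartAt f h2
    rw [h4]
    simp only [h3]
    ext w
    rw [ContinuousLinearMap.comp_apply]
    conv_lhs => rw [← β.sum_repr (T w), map_sum]
    simp [mul_comm]

end Differential

/-! ### Local frames; fibrewise linear functions on `E*` are sections of `E`. -/

section Frames

variable {EB : Type*} [NormedAddCommGroup EB] [NormedSpace ℝ EB] [FiniteDimensional ℝ EB]
  {B : Type*} [TopologicalSpace B] [T2Space B] [ChartedSpace EB B] [IsManifold 𝓘(ℝ, EB) ∞ B]
  {F : Type*} [NormedAddCommGroup F] [NormedSpace ℝ F] [FiniteDimensional ℝ F]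
  {E : B → Type*} [∀ x, AddCommGroup (E x)] [∀ x, Module ℝ (E x)]
  [∀ x, TopologicalSpace (E x)]
  [TopologicalSpace (TotalSpace F E)] [FiberBundle F E] [VectorBundle ℝ F E]
  [ContMDiffVectorBundle ∞ F E 𝓘(ℝ, EB)]

/-- The product of a smooth function `χ` and a section which is smooth on a neighbourhood of the
support of `χ`. -/
def cutoffSection (χ : Smooth EB B) (s : ∀ x, E x)
    (hs : ∀ x ∈ tsupport χ, ContMDiffAt 𝓘(ℝ, EB) (𝓘(ℝ, EB).prod 𝓘(ℝ, F)) ∞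
      (fun x ↦ (⟨x, s x⟩ : TotalSpace F E)) x) : Sections (EB := EB) F E :=
  ⟨fun x ↦ χ x • s x, fun x ↦ by
    by_cases hx : x ∈ tsupport χ
    · exact χ.contMDiff.contMDiffAt.smul_section (hs x hx)
    · refine (contMDiff_zeroSection ℝ E).contMDiffAt.congr_of_eventuallyEq ?_
      filter_upwards [(isClosed_tsupport χ).isOpen_compl.mem_nhds hx] with z hz
      rw [image_eq_zero_of_notMem_tsupport hz, zero_smul]
      rfl⟩

theorem cutoffSection_apply (χ : Smooth EB B) (s : ∀ x, E x)
    (hs : ∀ x ∈ tsupport χ, ContMDiffAt 𝓘(ℝ, EB) (𝓘(ℝ, EB).prod 𝓘(ℝ, F)) ∞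
      (fun x ↦ (⟨x, s x⟩ : TotalSpace F E)) x) (x : B) :
    cutoffSection (F := F) χ s hs x = χ x • s x := rfl

theorem contMDiffAt_frame (e : Trivialization F (π F E)) [MemTrivializationAtlas e] {x : B}
    (hx : x ∈ e.baseSet) (v : F) :
    ContMDiffAt 𝓘(ℝ, EB) (𝓘(ℝ, EB).prod 𝓘(ℝ, F)) ∞
      (fun x ↦ (⟨x, e.symm x v⟩ : TotalSpace F E)) x :=
  contMDiffAt_symm_const (b := id) contMDiffAt_id e hx v

/-- Vectors of a fibre are separated by covectors. -/
theorem eq_of_forall_dual {B : Type*} [TopologicalSpace B]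
    (F : Type*) [NormedAddCommGroup F] [NormedSpace ℝ F] [FiniteDimensional ℝ F]
    {E : B → Type*} [∀ x, AddCommGroup (E x)] [∀ x, Module ℝ (E x)]
    [∀ x, TopologicalSpace (E x)] [TopologicalSpace (TotalSpace F E)] [FiberBundle F E]
    [VectorBundle ℝ F E] {x : B} {v w : E x} (h : ∀ γ : E x →L[ℝ] ℝ, γ v = γ w) : v = w := by
  let T := (trivializationAt F E x).continuousLinearEquivAt ℝ x
    (mem_baseSet_trivializationAt F E x)
  refine T.injective ((Module.finBasis ℝ F).ext_elem fun i ↦ ?_)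
  exact h ((LinearMap.toContinuousLinearMap ((Module.finBasis ℝ F).coord i)).comp
    (T : E x →L[ℝ] F))

theorem sum_smulSection_apply {ι : Type*} (s : Finset ι) (C : ι → Smooth EB B)
    (Y : ι → Sections (EB := EB) F E) (x : B) :
    (∑ i ∈ s, smulSection (C i) (Y i)) x = ∑ i ∈ s, C i x • Y i x := by
  rw [← ContMDiffSection.coeAddHom_apply, map_sum, Finset.sum_apply]
  rfl

/-- Near a point, a section is a combination of sections whose coefficients are smooth functions,
which vanish at the point if the section does. -/
theorem exists_smulSection_eq_sum (X : Sections (EB := EB) F E) (x : B) :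
    ∃ (χ : Smooth EB B) (n : ℕ) (C : Fin n → Smooth EB B) (Y : Fin n → Sections (EB := EB) F E),
      χ =ᶠ[𝓝 x] 1 ∧ smulSection χ X = ∑ i, smulSection (C i) (Y i) ∧
        (X x = 0 → ∀ i, C i x = 0) := by
  let e := trivializationAt F E x
  obtain ⟨χ, h1, h2⟩ := exists_bump 𝓘(ℝ, EB) (e.open_baseSet.mem_nhds
    (mem_baseSet_trivializationAt F E x))
  let β := Module.finBasis ℝ F
  let c : Fin (Module.finrank ℝ F) → B → ℝ := fun i y ↦
    LinearMap.toContinuousLinearMap (β.coord i) (e ⟨y, X y⟩).2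
  have hc : ∀ i, ∀ y ∈ e.baseSet, ContMDiffAt 𝓘(ℝ, EB) 𝓘(ℝ) ∞ (c i) y := fun i y hy ↦
    (ContinuousLinearMap.contMDiff _).contMDiffAt.comp y
      ((e.contMDiffAt_iff (by simpa [e.mem_source] using hy)).1 (X.contMDiff y)).2
  -- The coefficients and the frame must each be cut off to become global, so the cut-off in front
  -- of `X` is the square `χ * χ`.
  refine ⟨χ * χ, _, fun i ↦ ⟨fun y ↦ χ y • c i y, contMDiff_of_tsupport fun y hy ↦
      χ.contMDiff.contMDiffAt.smul (hc i y (h2 (tsupport_smul_subset_left _ _ hy)))⟩,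
    fun i ↦ cutoffSection χ (fun y ↦ e.symm y (β i)) fun y hy ↦ contMDiffAt_frame e (h2 hy) _,
    ?_, ?_, fun hX i ↦ ?_⟩
  · filter_upwards [h1] with y hy
    change χ y * χ y = 1
    rw [hy]
    simp
  · ext y : 1
    refine Eq.trans ?_ (sum_smulSection_apply _ _ _ y).symm
    change (χ y * χ y) • X y = ∑ i, (χ y • c i y) • (χ y • e.symm y (β i))
    by_cases hy : y ∈ e.baseSet
    · have h3 : X y = ∑ i, c i y • e.symm y (β i) := by
        let T := e.continuousLinearEquivAt ℝ y hy
        refine T.injective ?_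
        have h4 : ∀ v, T (e.symm y v) = v := fun v ↦ T.apply_symm_apply v
        simp only [map_sum, map_smul, h4]
        exact (β.sum_repr (T (X y))).symm
      conv_lhs => rw [h3, Finset.smul_sum]
      refine Finset.sum_congr rfl fun i _ ↦ ?_
      rw [smul_smul, smul_smul]
      congr 1
      simp only [smul_eq_mul]
      ring
    · have h3 : χ y = 0 := image_eq_zero_of_notMem_tsupport fun h ↦ hy (h2 h)
      simp [h3]
  · have h3 : (e ⟨x, X x⟩).2 = 0 := by
      rw [hX]
      exact (e.continuousLinearEquivAt ℝ x (mem_baseSet_trivializationAt F E x)).map_zero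
    change χ x • LinearMap.toContinuousLinearMap (β.coord i) (e ⟨x, X x⟩).2 = 0
    rw [h3, map_zero, smul_zero]

/-- A fibrewise linear function on `E*` is given by a section of `E`. -/
theorem IsFiberLinear.exists_linearFun {φ : SmoothDual (EB := EB) F E} (h : IsFiberLinear φ) :
    ∃ X : Sections (EB := EB) F E, φ = linearFun X := by
  let β := Module.finBasis ℝ F
  -- The coframe dual to the frame `e.symm y (β i)`. A linear form on the dual of `E y` is the
  -- evaluation at the vector `V e y` whose coordinates are its values on this coframe.
  let cof : ∀ (e : Trivialization F (π F E)) [e.IsLinear ℝ],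
      Fin (Module.finrank ℝ F) → ∀ y, E y →L[ℝ] ℝ := fun e _ i y ↦
    (LinearMap.toContinuousLinearMap (β.coord i)).comp (e.continuousLinearMapAt ℝ y)
  let V : ∀ (e : Trivialization F (π F E)) [e.IsLinear ℝ] (y : B), E y := fun e _ y ↦
    ∑ i, φ ⟨y, cof e i y⟩ • e.symm y (β i)
  have key : ∀ (e : Trivialization F (π F E)) [MemTrivializationAtlas e] (y : B),
      y ∈ e.baseSet → ∀ α : E y →L[ℝ] ℝ, α (V e y) = φ ⟨y, α⟩ := by
    intro e _ y hy α
    let L : (E y →L[ℝ] ℝ) →ₗ[ℝ] ℝ := (h y).mk' _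
    have h1 : α = ∑ i, α (e.symm y (β i)) • cof e i y := by
      ext v
      let T := e.continuousLinearEquivAt ℝ y hy
      obtain ⟨w, rfl⟩ := T.symm.surjective v
      have h2 : ∀ i, cof e i y (T.symm w) = β.repr w i := fun i ↦ by
        change β.coord i (e.continuousLinearMapAt ℝ y (T.symm w)) = _
        rw [Trivialization.continuousLinearMapAt_apply, Trivialization.coe_linearMapAt_of_mem _ hy]
        exact congrArg (β.coord i) (T.apply_symm_apply w)
      have h3 : T.symm w = ∑ i, β.repr w i • T.symm (β i) := by
        conv_lhs => rw [← β.sum_repr w, map_sum]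
        simp only [map_smul]
      conv_lhs => rw [h3, map_sum]
      simp only [_root_.sum_apply, _root_.smul_apply, h2, map_smul, smul_eq_mul]
      refine Finset.sum_congr rfl fun i _ ↦ mul_comm _ _
    have h4 : φ ⟨y, α⟩ = L α := rfl
    rw [h4]
    conv_rhs => rw [h1, map_sum]
    rw [map_sum]
    refine Finset.sum_congr rfl fun i _ ↦ ?_
    rw [map_smul, map_smul, smul_eq_mul, smul_eq_mul, mul_comm]
    rfl
  -- Each `y` uses its own preferred trivialization. No partition of unity is needed: by `key`,
  -- every covector `α` takes the value `φ ⟨y, α⟩` on `V e y`, which determines this vector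
  -- independently of `e`. Near `x` it may therefore be computed in the single trivialization at
  -- `x`.
  refine ⟨⟨fun y ↦ V (trivializationAt F E y) y, fun x ↦ ?_⟩, ?_⟩
  · let e := trivializationAt F E x
    have hx : x ∈ e.baseSet := mem_baseSet_trivializationAt F E x
    have h1 : ContMDiffAt 𝓘(ℝ, EB) (𝓘(ℝ, EB).prod 𝓘(ℝ, F)) ∞
        (fun y ↦ (⟨y, V e y⟩ : TotalSpace F E)) x := by
      refine ContMDiffAt.sum_section fun i _ ↦ ContMDiffAt.smul_section ?_ (contMDiffAt_frame e hx _)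
      refine φ.contMDiff.contMDiffAt.comp x (f := fun y ↦ (⟨y, cof e i y⟩ : DualTotal F E)) ?_
      refine contMDiffAt_dual_of_apply (b := id) contMDiffAt_id fun v ↦ ?_
      refine (contMDiffAt_const (c := β.repr v i)).congr_of_eventuallyEq ?_
      filter_upwards [e.open_baseSet.mem_nhds hx] with y hy
      change β.coord i (e.continuousLinearMapAt ℝ y (e.symm y v)) = _
      rw [Trivialization.continuousLinearMapAt_apply, Trivialization.coe_linearMapAt_of_mem _ hy]
      exact congrArg (fun p ↦ β.coord i p.2) (e.apply_mk_symm hy v)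
    refine h1.congr_of_eventuallyEq ?_
    filter_upwards [e.open_baseSet.mem_nhds hx] with y hy
    refine congrArg (TotalSpace.mk y) (eq_of_forall_dual F fun γ ↦ ?_)
    rw [key _ y (mem_baseSet_trivializationAt F E y), key _ y hy]
  · ext α
    exact (key _ α.1 (mem_baseSet_trivializationAt F E α.1) α.2).symm

end Frames

/-! ### The functions `X̂ + f ∘ τ` generate the cotangent spaces of `E*`. -/

section Generators

variable {EB : Type*} [NormedAddCommGroup EB] [NormedSpace ℝ EB] [FiniteDimensional ℝ EB]
  {B : Type*} [TopologicalSpace B] [T2Space B] [ChartedSpace EB B] [IsManifold 𝓘(ℝ, EB) ∞ B]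
  {F : Type*} [NormedAddCommGroup F] [NormedSpace ℝ F] [FiniteDimensional ℝ F]
  {E : B → Type*} [∀ x, AddCommGroup (E x)] [∀ x, Module ℝ (E x)]
  [∀ x, TopologicalSpace (E x)]
  [TopologicalSpace (TotalSpace F E)] [FiberBundle F E] [VectorBundle ℝ F E]
  [ContMDiffVectorBundle ∞ F E 𝓘(ℝ, EB)]

/-- The function `X̂ + f ∘ τ` on `E*`, for a section `X` of `E` and a function `f` on the base. -/
def affineFun : (Sections (EB := EB) F E × Smooth EB B) →ₗ[ℝ] SmoothDual (EB := EB) F E where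
  toFun u := linearFun u.1 + basicFun u.2
  map_add' u v := by
    ext α
    change α.2 (u.1 α.1 + v.1 α.1) + (u.2 α.1 + v.2 α.1) =
      (α.2 (u.1 α.1) + u.2 α.1) + (α.2 (v.1 α.1) + v.2 α.1)
    rw [map_add]
    ring
  map_smul' c u := by
    ext α
    change α.2 (c • u.1 α.1) + c * u.2 α.1 = c * (α.2 (u.1 α.1) + u.2 α.1)
    rw [map_smul, smul_eq_mul]
    ring

theorem affineFun_mk (X : Sections (EB := EB) F E) (f : Smooth EB B) :
    affineFun (X, f) = linearFun X + basicFun f := rfl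

theorem affineFun_apply (u : Sections (EB := EB) F E × Smooth EB B) (α : DualTotal F E) :
    affineFun u α = α.2 (u.1 α.1) + u.2 α.1 := rfl

/-- The coordinates of a covector, read in the local trivialization. -/
theorem dual_trivializationAt_apply {x₀ : B} {α : DualTotal F E}
    (h : α.1 ∈ (trivializationAt F E x₀).baseSet) (v : F) :
    (trivializationAt (F →L[ℝ] ℝ) (fun x ↦ E x →L[ℝ] ℝ) x₀ α).2 v =
      α.2 ((trivializationAt F E x₀).symm α.1 v) := by
  refine Eq.trans (congrArg (fun p : B × (F →L[ℝ] ℝ) ↦ p.2 v)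
    (hom_trivializationAt_apply (F₂ := ℝ) (E₂ := Bundle.Trivial B ℝ) (RingHom.id ℝ) x₀ α)) ?_
  simp [ContinuousLinearMap.inCoordinates, Trivialization.symmL_apply _ h]

/-- The differentials of finitely many functions `X̂ + f ∘ τ` span the cotangent spaces of `E*`
near a given point, with smooth coefficients. -/
theorem exists_local_generators (α₀ : DualTotal F E) :
    ∃ (ι : Type) (_ : Fintype ι) (u : ι → Sections (EB := EB) F E × Smooth EB B),
      ∀ φ : SmoothDual (EB := EB) F E, ∃ g : ι → DualTotal F E → ℝ,
        (∀ i, ContMDiffAt (𝓘(ℝ, EB).prod 𝓘(ℝ, F →L[ℝ] ℝ)) 𝓘(ℝ) ∞ (g i) α₀) ∧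
        ∀ᶠ α in 𝓝 α₀, differential α φ = ∑ i, g i α • differential α (affineFun (u i)) := by
  let e := trivializationAt F E α₀.1
  have hx : α₀.1 ∈ e.baseSet := mem_baseSet_trivializationAt F E α₀.1
  let βF := Module.finBasis ℝ F
  let βB := Module.finBasis ℝ EB
  -- In the bundle chart of `E*` the coordinates of `α` in this basis are the coordinates of its
  -- base point, followed by the values of `α` on the local frame.
  let β := βB.prod (βF.dualBasis.map (LinearMap.toContinuousLinearMap (𝕜 := ℝ) (E := F) (F' := ℝ)))
  obtain ⟨χ, h1, h2⟩ := exists_bump 𝓘(ℝ, EB) (e.open_baseSet.mem_nhds hx)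
  have hf : ∀ j, ∃ f : Smooth EB B, f =ᶠ[𝓝 α₀.1] fun x ↦
      LinearMap.toContinuousLinearMap (βB.coord j) (extChartAt 𝓘(ℝ, EB) α₀.1 x) := fun j ↦
    exists_smooth_eventuallyEq 𝓘(ℝ, EB) (extChartAt_source_mem_nhds (I := 𝓘(ℝ, EB)) α₀.1) fun x hx ↦
      (ContinuousLinearMap.contMDiff _).contMDiffAt.comp x
        (contMDiffAt_extChartAt' (by simpa using hx))
  choose f hf using hf
  let X : Fin (Module.finrank ℝ F) → Sections (EB := EB) F E := fun i ↦
    cutoffSection χ (fun y ↦ e.symm y (βF i)) fun y hy ↦ contMDiffAt_frame e (h2 hy) _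
  have hπ : Tendsto (fun α : DualTotal F E ↦ α.1) (𝓝 α₀) (𝓝 α₀.1) :=
    (FiberBundle.continuous_proj (F →L[ℝ] ℝ) (fun x ↦ E x →L[ℝ] ℝ)).continuousAt
  -- Base coordinates are functions `f ∘ τ`, fibre coordinates are functions `X̂` for `X` in the
  -- frame, up to cut-offs equal to `1` near the base point of `α₀`. It remains to check that they
  -- agree with the chart coordinates near `α₀`.
  refine ⟨_, inferInstance, Sum.elim (fun j ↦ (0, f j)) (fun i ↦ (X i, 0)),
    exists_differential_eq_sum β fun k ↦ ?_⟩
  rcases k with j | i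
  · filter_upwards [hπ.eventually (hf j), hπ.eventually (e.open_baseSet.mem_nhds hx)] with α hα hb
    rw [FiberBundle.extChartAt]
    simp only [Sum.elim_inl, affineFun_apply]
    refine Eq.trans (b := f j α.1) ?_ ?_
    · exact (congrArg (· + f j α.1) (map_zero α.2)).trans (zero_add _)
    rw [hα]
    simp only [β, Module.Basis.prod_repr_inl]
    refine congrArg (fun x ↦ βB.coord j (extChartAt 𝓘(ℝ, EB) α₀.1 x)) ?_
    exact ((trivializationAt (F →L[ℝ] ℝ) (fun x ↦ E x →L[ℝ] ℝ) α₀.1).coe_fst'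
      ⟨hb, mem_univ _⟩).symm
  · filter_upwards [hπ.eventually h1, hπ.eventually (e.open_baseSet.mem_nhds hx)] with α hα hb
    rw [FiberBundle.extChartAt]
    simp only [Sum.elim_inr, affineFun_apply, β, Module.Basis.prod_repr_inr]
    have h3 : X i α.1 = e.symm α.1 (βF i) := by
      rw [cutoffSection_apply, hα]
      exact one_smul ℝ _
    have h4 := dual_trivializationAt_apply (α := α) hb (βF i)
    rw [h3]
    refine Eq.trans (add_zero _) (h4.symm.trans ?_)
    simp

end Generators

theorem LinearAlmostPoisson.ext_bracket {EB : Type*} [NormedAddCommGroup EB] [NormedSpace ℝ EB]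
    {B : Type*} [TopologicalSpace B] [ChartedSpace EB B]
    {F : Type*} [NormedAddCommGroup F] [NormedSpace ℝ F]
    {E : B → Type*} [∀ x, AddCommGroup (E x)] [∀ x, Module ℝ (E x)]
    [∀ x, TopologicalSpace (E x)]
    [TopologicalSpace (TotalSpace F E)] [FiberBundle F E] [VectorBundle ℝ F E]
    {P P' : LinearAlmostPoisson (EB := EB) F E}
    (h : ∀ φ ψ α, P.bracket φ ψ α = P'.bracket φ ψ α) : P = P' := by
  cases P
  cases P'
  congr
  funext φ ψ
  exact ContMDiffMap.ext (h φ ψ)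

/-! ### Existence and uniqueness of the bracket induced by an algebroid. -/

section Induced

variable {EB : Type*} [NormedAddCommGroup EB] [NormedSpace ℝ EB] [FiniteDimensional ℝ EB]
  {B : Type*} [TopologicalSpace B] [T2Space B] [ChartedSpace EB B] [IsManifold 𝓘(ℝ, EB) ∞ B]
  {F : Type*} [NormedAddCommGroup F] [NormedSpace ℝ F] [FiniteDimensional ℝ F]
  {E : B → Type*} [∀ x, AddCommGroup (E x)] [∀ x, Module ℝ (E x)]
  [∀ x, TopologicalSpace (E x)]
  [TopologicalSpace (TotalSpace F E)] [FiberBundle F E] [VectorBundle ℝ F E]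
  [ContMDiffVectorBundle ∞ F E 𝓘(ℝ, EB)]

/-- If the differential of `f ∘ τ` vanishes at a point of `E*`, so does that of `f` at the base
point. -/
theorem differential_eq_zero_of_basicFun {f : Smooth EB B} {α : DualTotal F E}
    (h : differential α (basicFun (F := F) (E := E) f) = 0) : differential α.1 f = 0 := by
  let e := trivializationAt (F →L[ℝ] ℝ) (fun x ↦ E x →L[ℝ] ℝ) α.1
  have hx : α.1 ∈ e.baseSet := mem_baseSet_trivializationAt _ _ α.1
  -- A local section of `E*` through `α`, constant in a trivialization: `f` is recovered as `(f ∘ τ)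
  -- ∘ s`, and the chain rule applies.
  let s : B → DualTotal F E := fun y ↦ ⟨y, e.symm y (e α).2⟩
  have hs : ContMDiffAt 𝓘(ℝ, EB) (𝓘(ℝ, EB).prod 𝓘(ℝ, F →L[ℝ] ℝ)) ∞ s α.1 :=
    contMDiffAt_frame (E := fun x ↦ E x →L[ℝ] ℝ) e hx _
  have hsα : s α.1 = α := congrArg (TotalSpace.mk α.1) (e.symm_apply_apply_mk hx α.2)
  have h0 : differential (s α.1) (basicFun (F := F) (E := E) f) =
      differential (s α.1) (0 : SmoothDual (EB := EB) F E) := by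
    rw [hsα, h, map_zero]
  refine (differential_comp_eq_of_eq (hs.mdifferentiableAt (by simp)) h0).trans ?_
  exact (differential (I := 𝓘(ℝ, EB)) α.1).map_zero

/-- If the differential of `X̂ + f ∘ τ` vanishes at a point of `E*`, then `X` vanishes at the base
point. -/
theorem apply_eq_zero_of_differential_affineFun {u : Sections (EB := EB) F E × Smooth EB B}
    {α : DualTotal F E} (h : differential α (affineFun u) = 0) : u.1 α.1 = 0 := by
  refine eq_of_forall_dual F fun γ ↦ ?_
  rw [map_zero]
  -- Along this line in the fibre, `X̂ + f ∘ τ` is an affine function of `t` with slope `γ (X x)`.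
  let c : ℝ → DualTotal F E := fun t ↦ ⟨α.1, α.2 + t • γ⟩
  have hc : ContMDiffAt 𝓘(ℝ, ℝ) (𝓘(ℝ, EB).prod 𝓘(ℝ, F →L[ℝ] ℝ)) ∞ c 0 := by
    refine contMDiffAt_dual_of_apply (b := fun _ ↦ α.1) contMDiffAt_const fun v ↦ ?_
    refine ContDiffAt.contMDiffAt ?_
    change ContDiffAt ℝ ∞ (fun t : ℝ ↦ α.2 _ + t * γ _) 0
    fun_prop
  have hc0 : c 0 = α := by simp [c]
  have h0 : differential (c 0) (affineFun u) =
      differential (c 0) (0 : SmoothDual (EB := EB) F E) := by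
    rw [hc0, h, map_zero]
  have h1 : mfderiv 𝓘(ℝ, ℝ) 𝓘(ℝ) (fun t ↦ affineFun u (c t)) 0 = 0 :=
    (differential_comp_eq_of_eq (hc.mdifferentiableAt (by simp)) h0).trans
      (differential (I := 𝓘(ℝ, ℝ)) (0 : ℝ)).map_zero
  rw [mfderiv_eq_fderiv] at h1
  have h2 : HasDerivAt (fun t : ℝ ↦ affineFun u (c t)) (γ (u.1 α.1)) 0 := by
    have h3 : (fun t : ℝ ↦ affineFun u (c t)) =
        fun t ↦ t * γ (u.1 α.1) + (α.2 (u.1 α.1) + u.2 α.1) := by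
      funext t
      change α.2 (u.1 α.1) + t * γ (u.1 α.1) + u.2 α.1 = _
      ring
    rw [h3]
    simpa using ((hasDerivAt_id (0 : ℝ)).mul_const (γ (u.1 α.1))).add_const
      (α.2 (u.1 α.1) + u.2 α.1)
  rw [← h2.deriv, ← fderiv_apply_one_eq_deriv]
  exact congrArg (fun L : ℝ →L[ℝ] ℝ ↦ L 1) h1

namespace SkewAlgebroid

variable (S : SkewAlgebroid (EB := EB) F E)

theorem add_right (X Y Y' : Sections (EB := EB) F E) :
    S.bracket X (Y + Y') = S.bracket X Y + S.bracket X Y' := by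
  rw [S.skew, S.add_left, neg_add, ← S.skew, ← S.skew]

theorem smul_right (c : ℝ) (X Y : Sections (EB := EB) F E) :
    S.bracket X (c • Y) = c • S.bracket X Y := by
  rw [S.skew, S.smul_left, ← smul_neg, ← S.skew]

theorem sum_right {ι : Type*} (s : Finset ι) (X : Sections (EB := EB) F E)
    (Y : ι → Sections (EB := EB) F E) :
    S.bracket X (∑ i ∈ s, Y i) = ∑ i ∈ s, S.bracket X (Y i) :=
  map_sum (AddMonoidHom.mk' (S.bracket X) (S.add_right X)) Y s

/-- The value at `x` of the vector field `ρ(X)`, as a vector of the model space. -/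
def anchorAt (x : B) : Sections (EB := EB) F E →ₗ[ℝ] EB where
  toFun X := S.anchor x (X x)
  map_add' X Y := (S.anchor x).map_add (X x) (Y x)
  map_smul' c X := (S.anchor x).map_smul c (X x)

theorem anchorAt_eq_zero {x : B} {X : Sections (EB := EB) F E} (h : X x = 0) :
    S.anchorAt x X = 0 :=
  (congrArg (S.anchor x) h).trans (map_zero _)

/-- The function `ρ(X)(f)`. -/
def anchorDeriv (X : Sections (EB := EB) F E) (f : Smooth EB B) : Smooth EB B :=
  ⟨fun x ↦ dirDeriv f x (S.anchor x (X x)), by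
    have h1 : ContMDiff 𝓘(ℝ, EB) 𝓘(ℝ, ℝ).tangent ∞
        (fun x ↦ tangentMap 𝓘(ℝ, EB) 𝓘(ℝ) f ⟨x, S.anchor x (X x)⟩) :=
      (f.contMDiff.contMDiff_tangentMap (m := ∞) (by simp)).comp (S.anchor_smooth.comp X.contMDiff)
    exact (contMDiff_snd_tangentBundle_modelSpace ℝ 𝓘(ℝ)).comp h1⟩

theorem anchorDeriv_apply (X : Sections (EB := EB) F E) (f : Smooth EB B) (x : B) :
    S.anchorDeriv X f x = differential x f (S.anchorAt x X) := rfl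

/-- The value at `α ∈ E*` of the bracket of the functions `X̂ + f ∘ τ` and `Ŷ + h ∘ τ`. -/
def affineBracket (α : DualTotal F E) :
    (Sections (EB := EB) F E × Smooth EB B) →ₗ[ℝ] (Sections (EB := EB) F E × Smooth EB B) →ₗ[ℝ] ℝ :=
  -- The convention `{f ∘ τ, X̂} = ρ(X)(f) ∘ τ` gives a plus sign to `ρ(Y)(f)` and, by
  -- skew-symmetry, a minus sign to `ρ(X)(h)`.
  LinearMap.mk₂ ℝ (fun u v ↦ -α.2 (S.bracket u.1 v.1 α.1) +
      S.anchorDeriv v.1 u.2 α.1 - S.anchorDeriv u.1 v.2 α.1)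
    (fun u u' v ↦ by
      simp only [anchorDeriv_apply, Prod.fst_add, Prod.snd_add, S.add_left, map_add,
        ContMDiffSection.coe_add, Pi.add_apply, _root_.add_apply]
      ring)
    (fun c u v ↦ by
      simp only [anchorDeriv_apply, Prod.smul_fst, Prod.smul_snd, S.smul_left, map_smul,
        ContMDiffSection.coe_smul, Pi.smul_apply, _root_.smul_apply, smul_eq_mul]
      ring)
    (fun u v v' ↦ by
      simp only [anchorDeriv_apply, Prod.fst_add, Prod.snd_add, S.add_right, map_add,
        ContMDiffSection.coe_add, Pi.add_apply, _root_.add_apply]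
      ring)
    (fun c u v ↦ by
      simp only [anchorDeriv_apply, Prod.smul_fst, Prod.smul_snd, S.smul_right, map_smul,
        ContMDiffSection.coe_smul, Pi.smul_apply, _root_.smul_apply, smul_eq_mul]
      ring)

theorem affineBracket_apply (α : DualTotal F E) (u v : Sections (EB := EB) F E × Smooth EB B) :
    S.affineBracket α u v = -α.2 (S.bracket u.1 v.1 α.1) +
      S.anchorDeriv v.1 u.2 α.1 - S.anchorDeriv u.1 v.2 α.1 := rfl

theorem affineBracket_skew (α : DualTotal F E) (u v : Sections (EB := EB) F E × Smooth EB B) :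
    S.affineBracket α u v = -S.affineBracket α v u := by
  rw [affineBracket_apply, affineBracket_apply, S.skew, ContMDiffSection.coe_neg, Pi.neg_apply,
    map_neg]
  ring

theorem contMDiff_affineBracket (u v : Sections (EB := EB) F E × Smooth EB B) :
    ContMDiff (𝓘(ℝ, EB).prod 𝓘(ℝ, F →L[ℝ] ℝ)) 𝓘(ℝ) ∞
      (fun α : DualTotal F E ↦ S.affineBracket α u v) :=
  (-linearFun (S.bracket u.1 v.1) + basicFun (S.anchorDeriv v.1 u.2) -
    basicFun (S.anchorDeriv u.1 v.2) : SmoothDual (EB := EB) F E).contMDiff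

/-- This is why the bracket is well defined. The section `X = u.1` vanishes at the base point `x`,
so near `x` it is `∑ Cᵢ Yᵢ` with `Cᵢ(x) = 0`. The Leibniz rule gives `⟦Z, X⟧(x) = ∑ ρ(Z)(Cᵢ) Yᵢ(x)`
for `Z = v.1`, while `X̂` has at `α` the same differential as `∑ α(Yᵢ) Cᵢ ∘ τ`. The form is thus
`ρ(Z)` applied at `x` to `∑ α(Yᵢ) Cᵢ + u.2`, whose differential vanishes. -/
theorem affineBracket_eq_zero {α : DualTotal F E}
    {u : Sections (EB := EB) F E × Smooth EB B} (h : differential α (affineFun u) = 0)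
    (v : Sections (EB := EB) F E × Smooth EB B) : S.affineBracket α u v = 0 := by
  have hX : u.1 α.1 = 0 := apply_eq_zero_of_differential_affineFun h
  obtain ⟨χ, n, C, Y, hχ, hsum, hC⟩ := exists_smulSection_eq_sum u.1 α.1
  replace hC := hC hX
  -- the bracket of `v.1` and `u.1` is determined by the differentials of the coefficients
  have h1 : S.bracket v.1 u.1 α.1 = ∑ i, S.anchorDeriv v.1 (C i) α.1 • Y i α.1 := by
    -- Multiplying `u.1` by `χ` does not change the bracket at this point: `χ` is `1` there, and the
    -- derivative of `χ` is multiplied by the zero value of `u.1`.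
    have h2 := S.leibniz v.1 u.1 χ α.1
    rw [hX, smul_zero, add_zero, hχ.self_of_nhds] at h2
    refine ((one_smul ℝ _).symm.trans h2.symm).trans ?_
    rw [hsum, S.sum_right, ← ContMDiffSection.coeAddHom_apply, map_sum, Finset.sum_apply]
    refine Finset.sum_congr rfl fun i _ ↦ ?_
    refine (S.leibniz v.1 (Y i) (C i) α.1).trans ?_
    rw [hC i, zero_smul, zero_add]
    rfl
  have h3 : linearFun u.1 =ᶠ[𝓝 α] (∑ i, basicFun (C i) * linearFun (Y i) :
      SmoothDual (EB := EB) F E) := by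
    filter_upwards [(FiberBundle.continuous_proj (F →L[ℝ] ℝ)
      (fun x ↦ E x →L[ℝ] ℝ)).continuousAt.eventually hχ] with γ hγ
    rw [coe_sum_contMDiffMap]
    have h4 : u.1 γ.1 = ∑ i, C i γ.1 • Y i γ.1 := by
      rw [← sum_smulSection_apply, ← hsum]
      change u.1 γ.1 = χ γ.1 • u.1 γ.1
      rw [hγ]
      exact (one_smul ℝ _).symm
    change γ.2 (u.1 γ.1) = ∑ i, C i γ.1 * γ.2 (Y i γ.1)
    rw [h4, map_sum]
    simp only [map_smul, smul_eq_mul]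
  -- In the differential of `Cᵢ ∘ τ` times `Ŷᵢ` at `α`, only the term with the differential of `Cᵢ ∘
  -- τ` survives, because `Cᵢ` vanishes at the base point. The remaining factor is the number
  -- `α(Yᵢ)`, and the whole differential comes from the base.
  have h5 : differential α (basicFun (F := F) (E := E)
      (∑ i, α.2 (Y i α.1) • C i + u.2)) = 0 := by
    have h6 : basicFun (F := F) (E := E) (∑ i, α.2 (Y i α.1) • C i + u.2) =
        ∑ i, α.2 (Y i α.1) • basicFun (C i) + basicFun u.2 := by
      ext γ
      change (∑ i, α.2 (Y i α.1) • C i) γ.1 + u.2 γ.1 =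
        (∑ i, α.2 (Y i α.1) • basicFun (C i) : SmoothDual (EB := EB) F E) γ + u.2 γ.1
      rw [coe_sum_contMDiffMap, coe_sum_contMDiffMap]
      rfl
    rw [← h, h6, show affineFun u = linearFun u.1 + basicFun u.2 from rfl, map_add, map_add,
      differential_congr h3, map_sum, map_sum]
    congr 1
    refine Finset.sum_congr rfl fun i _ ↦ ?_
    have h7 : basicFun (F := F) (E := E) (C i) α = 0 := hC i
    rw [differential_mul, h7, zero_smul, zero_add, map_smul]
    rfl
  have h8 := congrArg (fun L : EB →L[ℝ] ℝ ↦ L (S.anchorAt α.1 v.1))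
    (differential_eq_zero_of_basicFun h5)
  simp only [map_add, map_sum, map_smul, _root_.add_apply, _root_.sum_apply,
    _root_.smul_apply, smul_eq_mul, _root_.zero_apply] at h8
  rw [affineBracket_skew, affineBracket_apply, h1, map_sum]
  simp only [map_smul, smul_eq_mul, anchorDeriv_apply, S.anchorAt_eq_zero hX, map_zero]
  rw [add_zero, neg_sub, sub_neg_eq_add, add_comm]
  refine Eq.trans ?_ h8
  congr 1
  exact Finset.sum_congr rfl fun i _ ↦ mul_comm _ _

/-- By bilinearity and skew-symmetry, the vanishing in the first argument makes the form descend to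
differentials in both. -/
theorem affineBracket_congr {α : DualTotal F E}
    {u u' v v' : Sections (EB := EB) F E × Smooth EB B}
    (hu : differential α (affineFun u) = differential α (affineFun u'))
    (hv : differential α (affineFun v) = differential α (affineFun v')) :
    S.affineBracket α u v = S.affineBracket α u' v' := by
  have h1 : S.affineBracket α (u - u') v = 0 :=
    S.affineBracket_eq_zero (by rw [map_sub, map_sub, hu, sub_self]) v
  have h2 : S.affineBracket α (v - v') u' = 0 :=
    S.affineBracket_eq_zero (by rw [map_sub, map_sub, hv, sub_self]) u'
  rw [map_sub, LinearMap.sub_apply, sub_eq_zero] at h1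
  rw [map_sub, LinearMap.sub_apply, sub_eq_zero] at h2
  rw [h1, affineBracket_skew, h2, ← affineBracket_skew]

end SkewAlgebroid

/-- Freezing at `α` the coefficients of the local generators gives a combination with constant
coefficients, which is again a pair of a section and a function. -/
theorem exists_affineFun (φ : SmoothDual (EB := EB) F E) (α : DualTotal F E) :
    ∃ u : Sections (EB := EB) F E × Smooth EB B, differential α (affineFun u) = differential α φ := by
  obtain ⟨ι, _, u, hu⟩ := exists_local_generators (EB := EB) α
  obtain ⟨g, -, hg⟩ := hu φ
  refine ⟨∑ i, g i α • u i, ?_⟩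
  rw [hg.self_of_nhds, map_sum, map_sum]
  simp only [map_smul]

/-- A section and a function `(X, f)` such that `X̂ + f ∘ τ` and `φ` have the same differential
at `α`. -/
def affineAt (φ : SmoothDual (EB := EB) F E) (α : DualTotal F E) :
    Sections (EB := EB) F E × Smooth EB B := Classical.choose (exists_affineFun φ α)

theorem differential_affineAt (φ : SmoothDual (EB := EB) F E) (α : DualTotal F E) :
    differential α (affineFun (affineAt φ α)) = differential α φ :=
  Classical.choose_spec (exists_affineFun φ α)

namespace SkewAlgebroid

variable (S : SkewAlgebroid (EB := EB) F E)

theorem affineBracket_affineAt {φ ψ : SmoothDual (EB := EB) F E} {α : DualTotal F E}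
    {u v : Sections (EB := EB) F E × Smooth EB B}
    (hu : differential α (affineFun u) = differential α φ)
    (hv : differential α (affineFun v) = differential α ψ) :
    S.affineBracket α (affineAt φ α) (affineAt ψ α) = S.affineBracket α u v :=
  S.affineBracket_congr ((differential_affineAt φ α).trans hu.symm)
    ((differential_affineAt ψ α).trans hv.symm)

/-- The bracket on `C^∞(E*)` induced by an algebroid structure. -/
def poissonFun (φ ψ : SmoothDual (EB := EB) F E) : SmoothDual (EB := EB) F E :=
  ⟨fun α ↦ S.affineBracket α (affineAt φ α) (affineAt ψ α), fun α₀ ↦ by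
    obtain ⟨ι, _, u, hu⟩ := exists_local_generators (EB := EB) α₀
    obtain ⟨g, hg, hφ⟩ := hu φ
    obtain ⟨k, hk, hψ⟩ := hu ψ
    -- The pairs `affineAt` are chosen point by point, without any continuity in `α`. Smoothness
    -- comes from expanding both arguments in a fixed family of generators near `α₀`.
    have h1 : ContMDiffAt (𝓘(ℝ, EB).prod 𝓘(ℝ, F →L[ℝ] ℝ)) 𝓘(ℝ) ∞ (fun α : DualTotal F E ↦
        ∑ i, ∑ j, g i α * (k j α * S.affineBracket α (u i) (u j))) α₀ :=
      contMDiffAt_finsetSum fun i _ ↦ contMDiffAt_finsetSum fun j _ ↦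
        (hg i).mul ((hk j).mul (S.contMDiff_affineBracket _ _ α₀))
    refine h1.congr_of_eventuallyEq ?_
    filter_upwards [hφ, hψ] with α hα hα'
    have h2 : ∀ c : ι → ℝ, differential α (affineFun (∑ i, c i • u i)) =
        ∑ i, c i • differential α (affineFun (u i)) := fun c ↦ by
      rw [map_sum, map_sum]
      simp only [map_smul]
    -- At each nearby `α` the chosen pairs may be replaced by combinations of the generators, with
    -- the values of `g` and `k` at `α` as constants.
    rw [S.affineBracket_affineAt ((h2 fun i ↦ g i α).trans hα.symm)
      ((h2 fun i ↦ k i α).trans hα'.symm)]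
    simp only [map_sum, map_smul, LinearMap.sum_apply, LinearMap.smul_apply, smul_eq_mul,
      Finset.mul_sum]
    rw [Finset.sum_comm]
    refine Finset.sum_congr rfl fun i _ ↦ Finset.sum_congr rfl fun j _ ↦ ?_
    ring⟩

/-- Any representatives compute the bracket, so each axiom below reduces to the choice of a
convenient pair with the right differential at one point. -/
theorem poissonFun_apply {φ ψ : SmoothDual (EB := EB) F E} {α : DualTotal F E}
    {u v : Sections (EB := EB) F E × Smooth EB B}
    (hu : differential α (affineFun u) = differential α φ)
    (hv : differential α (affineFun v) = differential α ψ) :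
    S.poissonFun φ ψ α = S.affineBracket α u v := S.affineBracket_affineAt hu hv

theorem affineFun_section (X : Sections (EB := EB) F E) :
    affineFun (X, (0 : Smooth EB B)) = linearFun X := by
  ext α
  exact add_zero _

theorem affineFun_basic (f : Smooth EB B) :
    affineFun ((0 : Sections (EB := EB) F E), f) = basicFun f := by
  ext α
  exact (congrArg (· + f α.1) (map_zero α.2)).trans (zero_add _)

theorem poissonFun_linearFun (X Y : Sections (EB := EB) F E) :
    S.poissonFun (linearFun X) (linearFun Y) = -linearFun (S.bracket X Y) := by
  ext α
  rw [S.poissonFun_apply (congrArg _ (affineFun_section X)) (congrArg _ (affineFun_section Y)),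
    affineBracket_apply]
  simp only [anchorDeriv_apply, map_zero, _root_.zero_apply, add_zero, sub_zero]
  rfl

/-- The linear almost Poisson structure on `E*` induced by an algebroid structure on `E`. -/
def toPoisson : LinearAlmostPoisson (EB := EB) F E where
  bracket := S.poissonFun
  add_left φ φ' ψ := by
    ext α
    have h := S.poissonFun_apply (φ := φ + φ') (u := affineAt φ α + affineAt φ' α)
      (by simp only [map_add, differential_affineAt]) (differential_affineAt ψ α)
    rw [h, map_add, LinearMap.add_apply]
    rfl
  smul_left c φ ψ := by
    ext α
    have h := S.poissonFun_apply (φ := c • φ) (u := c • affineAt φ α)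
      (by simp only [map_smul, differential_affineAt]) (differential_affineAt ψ α)
    rw [h, map_smul, LinearMap.smul_apply]
    rfl
  skew φ ψ := by
    ext α
    exact S.affineBracket_skew α _ _
  leibniz φ φ' ψ := by
    ext α
    -- The coefficients `φ α` and `φ' α` are constants, and the product rule at `α` says that this
    -- pair represents `φ * φ'` there.
    have h := S.poissonFun_apply (φ := φ * φ') (u := φ α • affineAt φ' α + φ' α • affineAt φ α)
      (by simp only [map_add, map_smul, differential_affineAt, differential_mul])
      (differential_affineAt ψ α)
    rw [h, map_add, LinearMap.add_apply, map_smul, map_smul, LinearMap.smul_apply,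
      LinearMap.smul_apply]
    rfl
  linear φ ψ hφ hψ := by
    obtain ⟨X, rfl⟩ := hφ.exists_linearFun
    obtain ⟨Y, rfl⟩ := hψ.exists_linearFun
    rw [poissonFun_linearFun]
    intro x
    exact ⟨fun α α' ↦ neg_add _ _, fun c α ↦ (smul_neg c (α (S.bracket X Y x))).symm⟩

theorem toPoisson_isInducedBy : S.toPoisson.IsInducedBy S where
  linear_linear := S.poissonFun_linearFun
  basic_linear f X α := by
    refine (S.poissonFun_apply (congrArg _ (affineFun_basic f))
      (congrArg _ (affineFun_section X))).trans ?_
    have h : S.bracket 0 X = 0 := by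
      have := S.smul_left 0 0 X
      rwa [zero_smul, zero_smul] at this
    rw [affineBracket_apply, h]
    simp only [anchorDeriv_apply, ContMDiffSection.coe_zero, Pi.zero_apply, map_zero, neg_zero,
      zero_add, sub_zero]
    rfl
  basic_basic f g := by
    ext α
    refine (S.poissonFun_apply (congrArg _ (affineFun_basic f))
      (congrArg _ (affineFun_basic g))).trans ?_
    have h : S.bracket 0 0 = 0 := by
      have := S.smul_left 0 0 0
      rwa [zero_smul, zero_smul] at this
    rw [affineBracket_apply, h]
    simp only [anchorDeriv_apply, ContMDiffSection.coe_zero, Pi.zero_apply, map_zero, neg_zero,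
      zero_add, sub_zero]
    rfl

end SkewAlgebroid

namespace LinearAlmostPoisson

variable (P : LinearAlmostPoisson (EB := EB) F E)

theorem add_right (φ ψ ψ' : SmoothDual (EB := EB) F E) :
    P.bracket φ (ψ + ψ') = P.bracket φ ψ + P.bracket φ ψ' := by
  rw [P.skew, P.add_left, neg_add, ← P.skew, ← P.skew]

/-- With `ψ` and `α` fixed, bracketing with `ψ` and evaluating at `α` is a point derivation, by
`leibniz`. It kills `φ - φ'`, whose differential at `α` is zero. -/
theorem bracket_congr_left {φ φ' : SmoothDual (EB := EB) F E} {α : DualTotal F E}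
    (h : differential α φ = differential α φ') (ψ : SmoothDual (EB := EB) F E) :
    P.bracket φ ψ α = P.bracket φ' ψ α := by
  have := t2Space_totalSpace (F →L[ℝ] ℝ) (fun x ↦ E x →L[ℝ] ℝ)
  let δ : SmoothDual (EB := EB) F E →ₗ[ℝ] ℝ :=
    { toFun := fun φ ↦ P.bracket φ ψ α
      map_add' := fun φ φ' ↦ by rw [P.add_left]; rfl
      map_smul' := fun c φ ↦ by rw [P.smul_left]; rfl }
  have h0 : δ (φ - φ') = 0 := pointDerivation_eq_zero (m := α) δ
    (fun f g ↦ congrArg (fun χ : SmoothDual (EB := EB) F E ↦ χ α) (P.leibniz f g ψ))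
    (by rw [← differential_apply, map_sub, h, sub_self]; rfl)
  rw [map_sub, sub_eq_zero] at h0
  exact h0

/-- An almost Poisson bracket depends only on the differentials of the functions. -/
theorem bracket_congr {φ φ' ψ ψ' : SmoothDual (EB := EB) F E} {α : DualTotal F E}
    (h : differential α φ = differential α φ') (h' : differential α ψ = differential α ψ') :
    P.bracket φ ψ α = P.bracket φ' ψ' α := by
  have hneg : ∀ φ ψ, P.bracket φ ψ α = -P.bracket ψ φ α := fun φ ψ ↦
    congrArg (fun χ : SmoothDual (EB := EB) F E ↦ χ α) (P.skew φ ψ)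
  rw [P.bracket_congr_left h, hneg, P.bracket_congr_left h', ← hneg]

variable {P} {S : SkewAlgebroid (EB := EB) F E}

/-- Expanding by additivity leaves exactly the three defining relations, so they fix the bracket on
the functions `X̂ + f ∘ τ`. Together with `bracket_congr` this fixes it everywhere. -/
theorem IsInducedBy.bracket_affineFun (hP : P.IsInducedBy S)
    (u v : Sections (EB := EB) F E × Smooth EB B) (α : DualTotal F E) :
    P.bracket (affineFun u) (affineFun v) α = S.affineBracket α u v := by
  obtain ⟨X, f⟩ := u
  obtain ⟨Y, h⟩ := v
  rw [affineFun_mk, affineFun_mk, P.add_left, P.add_right, P.add_right, hP.linear_linear,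
    hP.basic_basic, P.skew (linearFun X) (basicFun h)]
  change -(α.2 (S.bracket X Y α.1)) + -(P.bracket (basicFun h) (linearFun X) α) +
    (P.bracket (basicFun f) (linearFun Y) α + 0) = _
  rw [hP.basic_linear, hP.basic_linear, SkewAlgebroid.affineBracket_apply]
  change _ = -(α.2 (S.bracket X Y α.1)) + dirDeriv f α.1 (S.anchor α.1 (Y α.1)) -
    dirDeriv h α.1 (S.anchor α.1 (X α.1))
  ring

theorem IsInducedBy.bracket_apply (hP : P.IsInducedBy S) {φ ψ : SmoothDual (EB := EB) F E}
    {α : DualTotal F E} {u v : Sections (EB := EB) F E × Smooth EB B}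
    (hu : differential α (affineFun u) = differential α φ)
    (hv : differential α (affineFun v) = differential α ψ) :
    P.bracket φ ψ α = S.affineBracket α u v := by
  rw [← hP.bracket_affineFun, P.bracket_congr hu hv]

end LinearAlmostPoisson

/-- An algebroid structure on `E` induces exactly one linear almost Poisson structure on `E*`. -/
theorem SkewAlgebroid.existsUnique_isInducedBy (S : SkewAlgebroid (EB := EB) F E) :
    ∃! P : LinearAlmostPoisson (EB := EB) F E, P.IsInducedBy S := by
  refine ⟨S.toPoisson, S.toPoisson_isInducedBy, fun P hP ↦
    LinearAlmostPoisson.ext_bracket fun φ ψ α ↦ ?_⟩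
  rw [hP.bracket_apply (differential_affineAt φ α) (differential_affineAt ψ α)]
  rfl

end Induced

/-! ### `E* → (E/G)*` is the projection onto the orbits. -/

section QuotientDual

variable {EG : Type*} [NormedAddCommGroup EG] [NormedSpace ℝ EG]
  {G : Type*} [Group G] [TopologicalSpace G] [ChartedSpace EG G]
  {EQ : Type*} [NormedAddCommGroup EQ] [NormedSpace ℝ EQ]
  {Q : Type*} [TopologicalSpace Q] [ChartedSpace EQ Q] [MulAction G Q]
  {EN : Type*} [NormedAddCommGroup EN] [NormedSpace ℝ EN]
  {N : Type*} [TopologicalSpace N] [ChartedSpace EN N]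
  {F : Type*} [NormedAddCommGroup F] [NormedSpace ℝ F]
  {E : Q → Type*} [∀ x, AddCommGroup (E x)] [∀ x, Module ℝ (E x)]
  [∀ x, TopologicalSpace (E x)]
  [TopologicalSpace (TotalSpace F E)] [FiberBundle F E] [VectorBundle ℝ F E]
  (P : PrincipalBundle EG G EQ Q EN N) (a : BundleAction EG G EQ F E)
  [FiniteDimensional ℝ F] [LieGroup 𝓘(ℝ, EG) ∞ G] [ContMDiffVectorBundle ∞ F E 𝓘(ℝ, EQ)]

open QuotFiber

/-- On each fibre the map is dual to an isomorphism, the evaluation at `q`, and `Q → N` is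
surjective. -/
theorem quotDualProj_surjective : Function.Surjective (quotDualProj P a).total := by
  rintro ⟨b, γ⟩
  obtain ⟨q, rfl⟩ := P.surjective b
  let T := evalEquiv P a (⟨q, rfl⟩ : P.Fib (P.proj q))
  refine ⟨⟨q, γ.comp (T.symm : E q →L[ℝ] QuotFiber P a (P.proj q))⟩,
    congrArg (TotalSpace.mk (P.proj q)) (ContinuousLinearMap.ext fun X ↦ ?_)⟩
  exact congrArg γ (T.symm_apply_apply X)

/-- Two covectors of the same orbit have images over `P.proj β.1` and `P.proj β'.1`, which are equal
but not by definition. With `b` free, both images can be written in the same fibre. -/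
theorem quotDualProj_total_eq (β : DualTotal F E) {b : N} (h : P.proj β.1 = b) :
    (quotDualProj P a).total β =
      ⟨b, β.2.comp (evalEquiv P a (⟨β.1, h⟩ : P.Fib b) : QuotFiber P a b →L[ℝ] E β.1)⟩ := by
  subst h
  rfl

theorem quotDualProj_total_eq_iff (β β' : DualTotal F E) :
    (quotDualProj P a).total β = (quotDualProj P a).total β' ↔ a.SameDualOrbit β β' := by
  constructor
  · intro h
    have hb : P.proj β.1 = P.proj β'.1 := congrArg TotalSpace.proj h
    obtain ⟨g, hg⟩ := P.exists_smul hb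
    refine ⟨g, hg, fun v ↦ ?_⟩
    rw [quotDualProj_total_eq P a β hb, quotDualProj_total_eq P a β' rfl] at h
    let q : P.Fib (P.proj β'.1) := ⟨β.1, hb⟩
    -- The test element is the equivariant extension of `v`: its value at the base point of `β` is
    -- `v`, and at that of `β'` it is `g v`.
    have h1 := congrArg (fun γ : QuotFiber P a (P.proj β'.1) →L[ℝ] ℝ ↦ γ (extend P a q v))
      (totalSpace_mk_inj (F := F →L[ℝ] ℝ)
        (E := fun b ↦ QuotFiber P a b →L[ℝ] ℝ) h)
    have h2 : β.2 ((extend P a q v).val q) = β'.2 ((extend P a q v).val ⟨β'.1, rfl⟩) := h1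
    rw [val_extend P a q ⟨β'.1, rfl⟩ g hg, val_extend P a q q 1 (one_smul _ _), a.actTo_one] at h2
    exact h2.symm
  · rintro ⟨g, hg, h⟩
    have hb : P.proj β.1 = P.proj β'.1 := by rw [← hg, P.proj_smul]
    rw [quotDualProj_total_eq P a β hb, quotDualProj_total_eq P a β' rfl]
    refine congrArg (TotalSpace.mk _) (ContinuousLinearMap.ext fun X ↦ ?_)
    refine (h (X.val ⟨β.1, hb⟩)).symm.trans ?_
    exact congrArg β'.2 (X.val_actTo g ⟨β.1, hb⟩ ⟨β'.1, rfl⟩ hg).symm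

end QuotientDual

/-! ### The Atiyah algebroid: `T*Q → (TQ/G)*` is Poisson. -/

section AtiyahPoisson

variable {EG : Type*} [NormedAddCommGroup EG] [NormedSpace ℝ EG]
  {G : Type*} [Group G] [TopologicalSpace G] [ChartedSpace EG G]
  {EQ : Type*} [NormedAddCommGroup EQ] [NormedSpace ℝ EQ] [FiniteDimensional ℝ EQ]
  {Q : Type*} [TopologicalSpace Q] [T2Space Q] [ChartedSpace EQ Q] [IsManifold 𝓘(ℝ, EQ) ∞ Q]
  [MulAction G Q]
  {EN : Type*} [NormedAddCommGroup EN] [NormedSpace ℝ EN] [FiniteDimensional ℝ EN]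
  {N : Type*} [TopologicalSpace N] [T2Space N] [ChartedSpace EN N] [IsManifold 𝓘(ℝ, EN) ∞ N]
  (PB : PrincipalBundle EG G EQ Q EN N)
  [LieGroup 𝓘(ℝ, EG) ∞ G] [ContMDiffSMul 𝓘(ℝ, EG) 𝓘(ℝ, EQ) ∞ G Q]

/-- The invariant vector field and the invariant function on `Q` corresponding to a section of
`TQ/G` and a function on `N`. -/
def liftAffine (u : Sections (EB := EN) EQ (AtiyahFiber PB) × Smooth EN N) :
    VField EQ Q × Smooth EQ Q :=
  (liftSection u.1, ⟨fun q ↦ u.2 (PB.proj q), u.2.contMDiff.comp PB.proj_smooth⟩)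

/-- The chain rule for `u.2 ∘ π`, since the Atiyah anchor is the derivative of `π` on any
representative. -/
theorem anchorDeriv_liftAffine (X : Sections (EB := EN) EQ (AtiyahFiber PB))
    (u : Sections (EB := EN) EQ (AtiyahFiber PB) × Smooth EN N) (q : Q) :
    (tangentAlgebroid EQ Q).anchorDeriv (liftSection X) (liftAffine PB u).2 q =
      (atiyahAlgebroid PB).anchorDeriv X u.2 (PB.proj q) := by
  have h := mfderiv_comp q (I := 𝓘(ℝ, EQ)) (I' := 𝓘(ℝ, EN)) (I'' := 𝓘(ℝ, ℝ)) (g := u.2)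
    (f := PB.proj) ((u.2.contMDiff _).mdifferentiableAt (by simp))
    ((PB.proj_smooth q).mdifferentiableAt (by simp))
  refine (congrArg (fun L : EQ →L[ℝ] ℝ ↦ L (liftSection X q)) h).trans ?_
  change _ = dirDeriv u.2 (PB.proj q) (atiyahAnchor PB (PB.proj q) (X (PB.proj q)))
  rw [atiyahAnchor_apply PB _ ⟨q, rfl⟩]
  rfl

/-- The bracket terms agree by definition: the Atiyah bracket is the Lie bracket of the lifts, and
the image of `α` pairs with an element of `TQ/G` through its representative at the base point of
`α`. -/
theorem affineBracket_liftAffine (u v : Sections (EB := EN) EQ (AtiyahFiber PB) × Smooth EN N)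
    (α : DualTotal EQ (TangentSpace 𝓘(ℝ, EQ) (M := Q))) :
    (tangentAlgebroid EQ Q).affineBracket α (liftAffine PB u) (liftAffine PB v) =
      (atiyahAlgebroid PB).affineBracket
        ((quotDualProj PB (tangentAction EG G EQ Q)).total α) u v := by
  rw [SkewAlgebroid.affineBracket_apply, SkewAlgebroid.affineBracket_apply]
  exact congrArg₂ (· - ·) (congrArg₂ (· + ·) rfl (anchorDeriv_liftAffine PB v.1 u α.1))
    (anchorDeriv_liftAffine PB u.1 v α.1)

/-- The projection `T*Q → (TQ/G)*` is a Poisson morphism. -/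
theorem isLinearAlmostPoissonMorphism_atiyah
    {P : LinearAlmostPoisson (EB := EQ) EQ (TangentSpace 𝓘(ℝ, EQ) (M := Q))}
    (hP : P.IsInducedBy (tangentAlgebroid EQ Q).toSkewAlgebroid)
    {P' : LinearAlmostPoisson (EB := EN) EQ (AtiyahFiber PB)}
    (hP' : P'.IsInducedBy (atiyahAlgebroid PB).toSkewAlgebroid) :
    IsLinearAlmostPoissonMorphism (quotDualProj PB (tangentAction EG G EQ Q)) P P' := by
  intro φ ψ
  ext α
  let Φ := quotDualProj PB (tangentAction EG G EQ Q)
  -- The pull-back of `X̂ + f ∘ τ` is by definition the function attached to the lifted pair. A pair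
  -- representing `χ` at `Φ.total α` therefore lifts to one representing `χ ∘ Φ` at `α`.
  have key : ∀ χ : SmoothDual (EB := EN) EQ (AtiyahFiber PB),
      differential α (affineFun (liftAffine PB (affineAt χ (Φ.total α)))) =
        differential α (Φ.pullback χ) := fun χ ↦
    differential_comp_eq_of_eq ((Φ.smooth α).mdifferentiableAt (by simp))
      (differential_affineAt χ (Φ.total α))
  rw [hP.bracket_apply (key φ) (key ψ), affineBracket_liftAffine]
  exact (hP'.bracket_apply (differential_affineAt φ _) (differential_affineAt ψ _)).symm

end AtiyahPoisson

/-! ### Passing from `E` to the subbundle `D`. -/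

section NonholonomicReduction

variable {EG : Type*} [NormedAddCommGroup EG] [NormedSpace ℝ EG]
  {G : Type*} [Group G] [TopologicalSpace G] [ChartedSpace EG G]
  {EQ : Type*} [NormedAddCommGroup EQ] [NormedSpace ℝ EQ]
  {Q : Type*} [TopologicalSpace Q] [ChartedSpace EQ Q] [MulAction G Q]
  {EN : Type*} [NormedAddCommGroup EN] [NormedSpace ℝ EN]
  {N : Type*} [TopologicalSpace N] [ChartedSpace EN N]
  {F : Type*} [NormedAddCommGroup F] [NormedSpace ℝ F]
  {E : Q → Type*} [∀ x, AddCommGroup (E x)] [∀ x, Module ℝ (E x)]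
  [∀ x, TopologicalSpace (E x)]
  [TopologicalSpace (TotalSpace F E)] [FiberBundle F E] [VectorBundle ℝ F E]
  [∀ x, IsTopologicalAddGroup (E x)] [∀ x, ContinuousSMul ℝ (E x)]
  {FD : Type*} [NormedAddCommGroup FD] [NormedSpace ℝ FD]
  {D : Q → Type*} [∀ x, AddCommGroup (D x)] [∀ x, Module ℝ (D x)]
  [∀ x, TopologicalSpace (D x)]
  [TopologicalSpace (TotalSpace FD D)] [FiberBundle FD D] [VectorBundle ℝ FD D]
  [∀ x, IsTopologicalAddGroup (D x)] [∀ x, ContinuousSMul ℝ (D x)]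
  [FiniteDimensional ℝ F] [FiniteDimensional ℝ FD]
  [ContMDiffVectorBundle ∞ F E 𝓘(ℝ, EQ)] [ContMDiffVectorBundle ∞ FD D 𝓘(ℝ, EQ)]
  [LieGroup 𝓘(ℝ, EG) ∞ G]
  {S : NonholonomicSystem EQ F E FD D} {a : BundleAction EG G EQ F E}
  (h : S.IsInvariant a) (PB : PrincipalBundle EG G EQ Q EN N)

namespace NonholonomicSystem

/-- The metric and the inclusion of the reduced system can be evaluated at any point `q` over `b`,
so the orthogonality characterizing the reduced projector becomes the one characterizing `S.orthProj
q.1`. All `d` in `D` at `q` are tested, because each is the value of an element of `D/G`. -/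
theorem IsInvariant.reduced_orthProj_val {b : N} (X : QuotFiber PB a b) (q : PB.Fib b) :
    ((h.reduced PB).orthProj b X).val q = S.orthProj q.1 (X.val q) := by
  refine S.flatD_injective q.1 (ContinuousLinearMap.ext fun d ↦ ?_)
  obtain ⟨Z, rfl⟩ := (QuotFiber.evalEquiv PB h.distAction q).surjective d
  have h1 := (h.reduced PB).orthProj_spec b X Z
  have h2 : reducedInner S a PB b (X - h.reducedIncl PB b ((h.reduced PB).orthProj b X))
      (h.reducedIncl PB b Z) = 0 := h1
  rw [map_sub, _root_.sub_apply, sub_eq_zero, h.reducedInner_apply PB _ _ q,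
    h.reducedInner_apply PB _ _ q] at h2
  have h3 := S.orthProj_spec q.1 (X.val q) (Z.val q)
  rw [map_sub, _root_.sub_apply, sub_eq_zero] at h3
  exact h2.symm.trans h3

/-- Dual form of the compatibility of the orthogonal projectors: the square formed by the maps `P*`
and the two projections to the quotients commutes. -/
theorem IsInvariant.quotDualProj_projDual (β : DualTotal FD D) :
    (quotDualProj PB a).total (S.projDual.total β) =
      (h.reduced PB).projDual.total ((quotDualProj PB h.distAction).total β) :=
  congrArg (TotalSpace.mk (PB.proj β.1)) (ContinuousLinearMap.ext fun X ↦
    congrArg β.2 (h.reduced_orthProj_val PB X ⟨β.1, rfl⟩).symm)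

/-- If `E* → (E/G)*` is a linear almost Poisson morphism, then so is `D* → (D/G)*`, for the
nonholonomic brackets. -/
theorem IsInvariant.isLinearAlmostPoissonMorphism {P : LinearAlmostPoisson (EB := EQ) F E}
    {P' : LinearAlmostPoisson (EB := EN) F (QuotFiber PB a)}
    (hP : IsLinearAlmostPoissonMorphism (quotDualProj PB a) P P') :
    IsLinearAlmostPoissonMorphism (quotDualProj PB h.distAction) (S.nonholonomicBracket P)
      ((h.reduced PB).nonholonomicBracket P') := by
  intro φ ψ
  ext β
  -- The corresponding square for `i*` commutes by definition, since `reducedIncl` acts through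
  -- `S.incl` at each point. Hence the hypothesis, applied to the pull-backs by the reduced `i*` and
  -- evaluated at `P* β`, already has the required left-hand side. The square for `P*` settles the
  -- right-hand side.
  have h1 := congrArg (fun χ : SmoothDual (EB := EQ) F E ↦ χ (S.projDual.total β))
    (hP ((h.reduced PB).inclDual.pullback φ) ((h.reduced PB).inclDual.pullback ψ))
  refine h1.trans ?_
  exact congrArg (P'.bracket ((h.reduced PB).inclDual.pullback φ)
    ((h.reduced PB).inclDual.pullback ψ)) (h.quotDualProj_projDual PB β)

end NonholonomicSystem

end NonholonomicReduction

/-! ### Uniqueness of the reduced bracket, and the theorem. -/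

/-- A surjective vector bundle morphism is a linear almost Poisson morphism for at most one linear
almost Poisson structure on its target. -/
theorem IsLinearAlmostPoissonMorphism.eq_of_surjective
    {EB : Type*} [NormedAddCommGroup EB] [NormedSpace ℝ EB]
    {B : Type*} [TopologicalSpace B] [ChartedSpace EB B]
    {F : Type*} [NormedAddCommGroup F] [NormedSpace ℝ F]
    {E : B → Type*} [∀ x, AddCommGroup (E x)] [∀ x, Module ℝ (E x)]
    [∀ x, TopologicalSpace (E x)]
    [TopologicalSpace (TotalSpace F E)] [FiberBundle F E] [VectorBundle ℝ F E]
    {EB' : Type*} [NormedAddCommGroup EB'] [NormedSpace ℝ EB']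
    {B' : Type*} [TopologicalSpace B'] [ChartedSpace EB' B']
    {F' : Type*} [NormedAddCommGroup F'] [NormedSpace ℝ F']
    {E' : B' → Type*} [∀ x, AddCommGroup (E' x)] [∀ x, Module ℝ (E' x)]
    [∀ x, TopologicalSpace (E' x)]
    [TopologicalSpace (TotalSpace F' E')] [FiberBundle F' E'] [VectorBundle ℝ F' E']
    {f : B → B'} {Φ : DualMorphism EB F E EB' F' E' f} (hΦ : Function.Surjective Φ.total)
    {P : LinearAlmostPoisson (EB := EB) F E} {R R' : LinearAlmostPoisson (EB := EB') F' E'}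
    (hR : IsLinearAlmostPoissonMorphism Φ P R) (hR' : IsLinearAlmostPoissonMorphism Φ P R') :
    R = R' := by
  refine LinearAlmostPoisson.ext_bracket fun φ ψ γ ↦ ?_
  obtain ⟨β, rfl⟩ := hΦ γ
  exact congrArg (fun χ : SmoothDual (EB := EB) F E ↦ χ β) ((hR φ ψ).symm.trans (hR' φ ψ))

end NH

end

/-- The Poisson structures enter as arbitrary `P` and `P'` satisfying the defining relations. The
two `∃!` clauses show that this quantification is over exactly one structure on each side, so the
last clause is not vacuous. -/
theorem mainTheorem11
    {EG : Type*} [NormedAddCommGroup EG] [NormedSpace ℝ EG] [FiniteDimensional ℝ EG]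
    {G : Type*} [Group G] [TopologicalSpace G] [ChartedSpace EG G] [LieGroup 𝓘(ℝ, EG) ∞ G]
    {EQ : Type*} [NormedAddCommGroup EQ] [NormedSpace ℝ EQ] [FiniteDimensional ℝ EQ]
    {Q : Type*} [TopologicalSpace Q] [T2Space Q] [ChartedSpace EQ Q] [IsManifold 𝓘(ℝ, EQ) ∞ Q]
    [MulAction G Q] [ContMDiffSMul 𝓘(ℝ, EG) 𝓘(ℝ, EQ) ∞ G Q]
    {EN : Type*} [NormedAddCommGroup EN] [NormedSpace ℝ EN] [FiniteDimensional ℝ EN]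
    {N : Type*} [TopologicalSpace N] [T2Space N] [ChartedSpace EN N] [IsManifold 𝓘(ℝ, EN) ∞ N]
    {FD : Type*} [NormedAddCommGroup FD] [NormedSpace ℝ FD] [FiniteDimensional ℝ FD]
    {D : Q → Type*} [∀ q, AddCommGroup (D q)] [∀ q, Module ℝ (D q)]
    [∀ q, TopologicalSpace (D q)] [∀ q, IsTopologicalAddGroup (D q)]
    [∀ q, ContinuousSMul ℝ (D q)]
    [TopologicalSpace (TotalSpace FD D)] [FiberBundle FD D] [VectorBundle ℝ FD D]
    [ContMDiffVectorBundle ∞ FD D 𝓘(ℝ, EQ)]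
    -- the principal bundle `Q → N = Q/G`, and the invariant nonholonomic system `(L, D)` on `TQ`
    (PB : NH.PrincipalBundle EG G EQ Q EN N)
    (S : NH.NonholonomicSystem EQ EQ (TangentSpace 𝓘(ℝ, EQ) (M := Q)) FD D)
    (hS : S.IsInvariant (NH.tangentAction EG G EQ Q)) :
    -- the linear Poisson structures on `T*Q` and on `(TQ/G)*` exist and are unique
    (∃! P : NH.LinearAlmostPoisson (EB := EQ) EQ (TangentSpace 𝓘(ℝ, EQ) (M := Q)),
      P.IsInducedBy (NH.tangentAlgebroid EQ Q).toSkewAlgebroid) ∧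
    (∃! P' : NH.LinearAlmostPoisson (EB := EN) EQ (NH.AtiyahFiber PB),
      P'.IsInducedBy (NH.atiyahAlgebroid PB).toSkewAlgebroid) ∧
    -- `D* → (D/G)*` is the projection onto the space of orbits of `G` in `D*`
    Function.Surjective (NH.quotDualProj PB hS.distAction).total ∧
    (∀ β β' : NH.DualTotal FD D,
      (NH.quotDualProj PB hS.distAction).total β = (NH.quotDualProj PB hS.distAction).total β' ↔
        hS.distAction.SameDualOrbit β β') ∧
    ∀ P : NH.LinearAlmostPoisson (EB := EQ) EQ (TangentSpace 𝓘(ℝ, EQ) (M := Q)),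
      P.IsInducedBy (NH.tangentAlgebroid EQ Q).toSkewAlgebroid →
    ∀ P' : NH.LinearAlmostPoisson (EB := EN) EQ (NH.AtiyahFiber PB),
      P'.IsInducedBy (NH.atiyahAlgebroid PB).toSkewAlgebroid →
      -- it is a linear almost Poisson morphism for the nonholonomic brackets
      NH.IsLinearAlmostPoissonMorphism (NH.quotDualProj PB hS.distAction)
        (S.nonholonomicBracket P) ((hS.reduced PB).nonholonomicBracket P') ∧
      -- and this characterizes the reduced nonholonomic bracket
      ∀ R : NH.LinearAlmostPoisson (EB := EN) FD (NH.QuotFiber PB hS.distAction),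
        NH.IsLinearAlmostPoissonMorphism (NH.quotDualProj PB hS.distAction)
          (S.nonholonomicBracket P) R →
        R = (hS.reduced PB).nonholonomicBracket P' := by
  refine ⟨(NH.tangentAlgebroid EQ Q).existsUnique_isInducedBy,
    (NH.atiyahAlgebroid PB).existsUnique_isInducedBy, NH.quotDualProj_surjective PB _,
    NH.quotDualProj_total_eq_iff PB _, fun P hP P' hP' ↦ ?_⟩
  have h := hS.isLinearAlmostPoissonMorphism PB
    (NH.isLinearAlmostPoissonMorphism_atiyah PB hP hP')
  exact ⟨h, fun R hR ↦ hR.eq_of_surjective (NH.quotDualProj_surjective PB _) h⟩
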